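/- Let $k$ be an algebraically closed field of characteristic zero, $A$ a complete local noetherian $k$-algebra with residue field $k$, and $\pi$ an element of its maximal ideal. **Matrix factorizations.** For a commutative ring $B$ and $w\in B$, a matrix factorization $M$ of $w$ consists of free $B$-modules $M_0,M_1$ of finite rank and maps $\varphi:M_0\to M_1$, $\psi:M_1\to M_0$ with $\varphi\psi=w$, $\psi\varphi=w$. The category $\mathrm{MF}(w)$ has these as objects. Its morphisms $M\to N$ are pairs $f=(S,T)$, $S:M_0\to N_0$, $T:M_1\to N_1$, with $\varphi_N S=T\varphi_M$, $\psi_N T=S\psi_M$, modulo the pairs $(\psi_N h_0+h_1\varphi_M,\ \varphi_N h_1+h_0\psi_M)$ with $h_0:M_0\to N_1$, $h_1:M_1\to N_0$. The translation is $M[1]=(M_1\xrightarrow{-\psi}M_0\xrightarrow{-\varphi}M_1)$, and the distinguished triangles are those isomorphic to a cone triangle $M\xrightarrow{f}N\to\mathrm{cone}(f)\to M[1]$. **Forms.** Put $M^*=(M_1^*\xrightarrow{-{}^t\varphi}M_0^*\xrightarrow{-{}^t\psi}M_1^*)$ and $M^T=(M_0^*\xrightarrow{{}^t\psi}M_1^*\xrightarrow{{}^t\varphi}M_0^*)$.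 An orthogonal ($\epsilon=+1$) or symplectic ($\epsilon=-1$) form on $M$ is an isomorphism of factorizations (before passing to homotopy) $b=(b_0,b_1):M\to M^*$ with ${}^tb_0=-\epsilon b_1$. A twisted form of sign $\epsilon$ is an isomorphism $q=(q_0,q_1):M\to M^T$ with ${}^tq_i=\epsilon q_i$. The category $\mathrm{MF}^{\pm}(w)$ (resp. $\mathrm{MF}^{\omega,\pm}(w)$) has as objects the factorizations with a form (resp. twisted form) of sign $\pm1$, and as morphisms those of the underlying objects of $\mathrm{MF}(w)$. A translation on $\mathrm{MF}^{\pm}(w)$ is given by $(b_0,b_1)[1]=(b_1,b_0)$, and a triangle of $\mathrm{MF}^\pm(w)$ is called distinguished if it is so in $\mathrm{MF}(w)$. A morphism $f:(M,b)\to(M',b')$ has the adjoint $f^{\mathrm{adj}}=b^{-1}\,{}^tf\,b'$; it is an isometry if $f^{\mathrm{adj}}=f^{-1}$ in $\mathrm{MF}(w)$. **The Faltings–Knörrer functor.** $\theta:\mathrm{MF}(\pi)\to\mathrm{MF}(xy-\pi)$, with target over $A[[x,y]]$, sends $(P,Q)$ to $$\varphi=\begin{pmatrix}x&P\\Q&y\end{pmatrix},\qquad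 \psi=\begin{pmatrix}y&-P\\-Q&x\end{pmatrix}$$ (on $M_1\oplus M_0$ in both degrees) and $(S,T)$ to $T\oplus S$ in both degrees. It extends to $\mathrm{MF}^{\pm}(\pi)\to\mathrm{MF}^{\omega,\mp}(xy-\pi)$ by $q_0=q_1=\begin{pmatrix}0&b_0\\b_1&0\end{pmatrix}$, and to $\mathrm{MF}^{\omega,\pm}(\pi)\to\mathrm{MF}^{\pm}(xy-\pi)$ by $b_0=q_1\oplus q_0$, $b_1=-(q_1\oplus q_0)$. Its square $\theta\theta$ (second step with new variables $u,v$, over $A[[x,y]][[u,v]]$) has values in factorizations of $uv-(xy-\pi)$. Changing the sign of the potential $xy-\pi$ between the two steps by $(\varphi,\psi)\mapsto(\varphi,-\psi)$ (and $(q_0,q_1)\mapsto(q_0,-q_1)$ on twisted forms) gives a functor, written $\theta\nu\theta$, with values in factorizations of $xy+uv-\pi$. **Theorem.** The functors $\theta\theta$ and $\theta\nu\theta$ are equivalences of triangulated categories $$\mathrm{MF}(\pi)\simeq\mathrm{MF}(uv-xy+\pi),\qquad \mathrm{MF}(\pi)\simeq\mathrm{MF}(xy+uv-\pi),$$ that is,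 additive equivalences which commute with the translations up to a natural isomorphism through which they preserve and reflect distinguished triangles. They exchange orthogonal and symplectic forms, and for each sign they define equivalences $$\mathrm{MF}^{\pm}(\pi)\simeq\mathrm{MF}^{\mp}(uv-xy+\pi),\qquad \mathrm{MF}^{\pm}(\pi)\simeq\mathrm{MF}^{\mp}(xy+uv-\pi)$$ which are additive, commute with the translations, preserve and reflect distinguished triangles in the same sense, commute with $f\mapsto f^{\mathrm{adj}}$, and are such that every object of the target is isometric to the image of an object of the source. Moreover $\theta\theta\theta\theta$ (with eight new variables in all) defines, in the same sense, an equivalence from $\mathrm{MF}^{\pm}(\pi)$ to the category $\mathrm{MF}^{\pm}$ of its target potential (periodicity of order four). -/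

import Mathlib

open CategoryTheory

universe u v v' u'

/-! ### Block matrix identities -/

namespace BlockAux

set_option linter.unusedSectionVars false

variable {B : Type u} [CommRing B] {m₀ m₁ n₀ n₁ : Type}
  [Fintype m₀] [Fintype m₁] [Fintype n₀] [Fintype n₁]
  [DecidableEq m₀] [DecidableEq m₁] [DecidableEq n₀] [DecidableEq n₁]

theorem neg_mul_neg' {l m n : Type} [Fintype m] (P : Matrix l m B) (Q : Matrix m n B) :
    -P * -Q = P * Q := by
  rw [Matrix.neg_mul, Matrix.mul_neg, neg_neg]

theorem cone_mul {w : B} {P : Matrix n₁ n₀ B} {Q : Matrix n₀ n₁ B} {P' : Matrix m₁ m₀ B}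
    {Q' : Matrix m₀ m₁ B} {S : Matrix n₀ m₀ B} {T : Matrix n₁ m₁ B} (h : P * Q = w • 1)
    (h' : Q' * P' = w • 1) (hST : P * S = T * P') :
    Matrix.fromBlocks P T 0 (-Q') * Matrix.fromBlocks Q S 0 (-P') = w • 1 := by
  rw [Matrix.fromBlocks_multiply, ← Matrix.fromBlocks_one, Matrix.fromBlocks_smul]
  simp [h, h', hST]

/-- The matrix of the inclusion of the first summand. -/
def inl (B : Type u) [CommRing B] (m n : Type) [DecidableEq m] : Matrix (m ⊕ n) m B :=
  Matrix.fromRows (1 : Matrix m m B) (0 : Matrix n m B)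

/-- The matrix of the projection to the second summand. -/
def snd (B : Type u) [CommRing B] (m n : Type) [DecidableEq n] : Matrix n (m ⊕ n) B :=
  Matrix.fromCols (0 : Matrix n m B) (1 : Matrix n n B)

theorem inl_comm (P : Matrix n₁ n₀ B) (T : Matrix n₁ m₁ B) (Q' : Matrix m₀ m₁ B) :
    Matrix.fromBlocks P T 0 Q' * inl B n₀ m₁ = inl B n₁ m₀ * P := by
  unfold inl
  rw [Matrix.fromBlocks_mul_fromRows, Matrix.fromRows_mul]
  simp

theorem snd_comm (P : Matrix n₁ n₀ B) (T : Matrix n₁ m₁ B) (Q' : Matrix m₀ m₁ B) :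
    Q' * snd B n₀ m₁ = snd B n₁ m₀ * Matrix.fromBlocks P T 0 Q' := by
  unfold snd
  rw [Matrix.fromCols_mul_fromBlocks, Matrix.mul_fromCols]
  simp

theorem theta_mul {w p x y : B} {P : Matrix m₁ m₀ B} {Q : Matrix m₀ m₁ B} (hw : w = x * y - p)
    (h : P * Q = p • 1) (h' : Q * P = p • 1) :
    Matrix.fromBlocks (x • 1) P Q (y • 1) * Matrix.fromBlocks (y • 1) (-P) (-Q) (x • 1) =
      w • 1 := by
  rw [Matrix.fromBlocks_multiply, ← Matrix.fromBlocks_one, Matrix.fromBlocks_smul]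
  simp [h, h', hw, sub_smul, smul_smul, mul_comm, ← sub_eq_add_neg, neg_add_eq_sub]

theorem theta_mul' {w p x y : B} {P : Matrix m₁ m₀ B} {Q : Matrix m₀ m₁ B} (hw : w = x * y - p)
    (h : P * Q = p • 1) (h' : Q * P = p • 1) :
    Matrix.fromBlocks (y • 1) (-P) (-Q) (x • 1) * Matrix.fromBlocks (x • 1) P Q (y • 1) =
      w • 1 := by
  rw [Matrix.fromBlocks_multiply, ← Matrix.fromBlocks_one, Matrix.fromBlocks_smul]
  simp [h, h', hw, sub_smul, smul_smul, mul_comm, ← sub_eq_add_neg, neg_add_eq_sub]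

theorem theta_comm (x y : B) {P : Matrix m₁ m₀ B} {Q : Matrix m₀ m₁ B} {P' : Matrix n₁ n₀ B}
    {Q' : Matrix n₀ n₁ B} {S : Matrix n₀ m₀ B} {T : Matrix n₁ m₁ B} (h : P' * S = T * P)
    (h' : Q' * T = S * Q) :
    Matrix.fromBlocks (x • 1) P' Q' (y • 1) * Matrix.fromBlocks T 0 0 S =
      Matrix.fromBlocks T 0 0 S * Matrix.fromBlocks (x • 1) P Q (y • 1) := by
  simp [Matrix.fromBlocks_multiply, h, h']

theorem theta_homotopy (x y : B) {P : Matrix m₁ m₀ B} {Q : Matrix m₀ m₁ B} {P' : Matrix n₁ n₀ B}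
    {Q' : Matrix n₀ n₁ B} {S S' : Matrix n₀ m₀ B} {T T' : Matrix n₁ m₁ B} {h₀ : Matrix n₁ m₀ B}
    {h₁ : Matrix n₀ m₁ B} (e₀ : S = S' + (Q' * h₀ + h₁ * P)) (e₁ : T = T' + (P' * h₁ + h₀ * Q)) :
    Matrix.fromBlocks T 0 0 S = Matrix.fromBlocks T' 0 0 S' +
      (Matrix.fromBlocks (y • 1) (-P') (-Q') (x • 1) * -Matrix.fromBlocks 0 h₀ h₁ 0 +
        Matrix.fromBlocks 0 h₀ h₁ 0 * Matrix.fromBlocks (x • 1) P Q (y • 1)) := by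
  simp [Matrix.fromBlocks_multiply, Matrix.fromBlocks_add, Matrix.fromBlocks_neg, e₀, e₁]

theorem theta_homotopy' (x y : B) {P : Matrix m₁ m₀ B} {Q : Matrix m₀ m₁ B} {P' : Matrix n₁ n₀ B}
    {Q' : Matrix n₀ n₁ B} {S S' : Matrix n₀ m₀ B} {T T' : Matrix n₁ m₁ B} {h₀ : Matrix n₁ m₀ B}
    {h₁ : Matrix n₀ m₁ B} (e₀ : S = S' + (Q' * h₀ + h₁ * P)) (e₁ : T = T' + (P' * h₁ + h₀ * Q)) :
    Matrix.fromBlocks T 0 0 S = Matrix.fromBlocks T' 0 0 S' +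
      (Matrix.fromBlocks (x • 1) P' Q' (y • 1) * Matrix.fromBlocks 0 h₀ h₁ 0 +
        -Matrix.fromBlocks 0 h₀ h₁ 0 * Matrix.fromBlocks (y • 1) (-P) (-Q) (x • 1)) := by
  simp [Matrix.fromBlocks_multiply, Matrix.fromBlocks_add, Matrix.fromBlocks_neg, e₀, e₁]

/-- The block exchange matrix. -/
def swap (B : Type u) [CommRing B] (m n : Type) [DecidableEq m] [DecidableEq n] :
    Matrix (m ⊕ n) (n ⊕ m) B :=
  Matrix.fromBlocks (0 : Matrix m n B) (1 : Matrix m m B) (1 : Matrix n n B) (0 : Matrix n m B)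

theorem swap_mul_swap : swap B m₀ m₁ * swap B m₁ m₀ = 1 := by
  unfold swap
  rw [Matrix.fromBlocks_multiply]
  simp

theorem swap_comm (x y : B) {P : Matrix m₁ m₀ B} {Q : Matrix m₀ m₁ B} {P' : Matrix m₀ m₁ B}
    {Q' : Matrix m₁ m₀ B} (h : P' = -P.transpose) (h' : Q' = -Q.transpose) :
    (Matrix.fromBlocks (y • 1) (-P) (-Q) (x • 1)).transpose * swap B m₁ m₀ =
      swap B m₁ m₀ * Matrix.fromBlocks (x • 1) P' Q' (y • 1) := by
  unfold swap
  rw [Matrix.fromBlocks_transpose, Matrix.fromBlocks_multiply, Matrix.fromBlocks_multiply]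
  simp [h, h']

theorem swap_comm' (x y : B) {P : Matrix m₁ m₀ B} {Q : Matrix m₀ m₁ B} {P' : Matrix m₀ m₁ B}
    {Q' : Matrix m₁ m₀ B} (h : P' = -P.transpose) (h' : Q' = -Q.transpose) :
    (Matrix.fromBlocks (x • 1) P Q (y • 1)).transpose * swap B m₁ m₀ =
      swap B m₁ m₀ * Matrix.fromBlocks (y • 1) (-P') (-Q') (x • 1) := by
  unfold swap
  rw [Matrix.fromBlocks_transpose, Matrix.fromBlocks_multiply, Matrix.fromBlocks_multiply]
  simp [h, h']

theorem swap_mul_symm (z : ℤ) {b₀ : Matrix m₁ m₀ B} {b₁ : Matrix m₀ m₁ B}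
    (h : b₀.transpose = z • b₁) (h' : b₁.transpose = z • b₀) :
    Matrix.transpose (swap B m₁ m₀ * Matrix.fromBlocks b₁ 0 0 b₀ :
        Matrix (m₁ ⊕ m₀) (m₁ ⊕ m₀) B) =
      z • (swap B m₁ m₀ * Matrix.fromBlocks b₁ 0 0 b₀ : Matrix (m₁ ⊕ m₀) (m₁ ⊕ m₀) B) := by
  unfold swap
  rw [Matrix.fromBlocks_multiply, Matrix.fromBlocks_transpose, Matrix.fromBlocks_smul]
  simp only [Matrix.zero_mul, Matrix.one_mul, zero_add, add_zero, Matrix.transpose_zero, h, h',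
    smul_zero]

theorem neg_one_mul_neg_one (m : Type) [Fintype m] [DecidableEq m] :
    (-1 : Matrix m m B) * (-1 : Matrix m m B) = 1 := by simp

theorem transpose_comm (x y : B) (P : Matrix m₁ m₀ B) (Q : Matrix m₀ m₁ B) :
    -(Matrix.fromBlocks (x • 1) P Q (y • 1)).transpose * (1 : Matrix (m₁ ⊕ m₀) (m₁ ⊕ m₀) B) =
      (-1 : Matrix (m₁ ⊕ m₀) (m₁ ⊕ m₀) B) *
        Matrix.fromBlocks (x • 1) Q.transpose P.transpose (y • 1) := by
  rw [Matrix.fromBlocks_transpose]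
  simp

theorem transpose_comm' (x y : B) (P : Matrix m₁ m₀ B) (Q : Matrix m₀ m₁ B) :
    -(Matrix.fromBlocks (y • 1) (-P) (-Q) (x • 1)).transpose *
        (-1 : Matrix (m₁ ⊕ m₀) (m₁ ⊕ m₀) B) =
      (1 : Matrix (m₁ ⊕ m₀) (m₁ ⊕ m₀) B) *
        Matrix.fromBlocks (y • 1) (-Q.transpose) (-P.transpose) (x • 1) := by
  rw [Matrix.fromBlocks_transpose]
  simp

theorem diag_symm (ε : ℤˣ) {q₀ : Matrix m₀ m₀ B} {q₁ : Matrix m₁ m₁ B}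
    (h : q₀.transpose = (ε : ℤ) • q₀) (h' : q₁.transpose = (ε : ℤ) • q₁) :
    (-1 : Matrix (m₁ ⊕ m₀) (m₁ ⊕ m₀) B) * Matrix.fromBlocks q₁ 0 0 q₀ =
      -((ε : ℤ) • Matrix.transpose ((1 : Matrix (m₁ ⊕ m₀) (m₁ ⊕ m₀) B) *
        Matrix.fromBlocks q₁ 0 0 q₀)) := by
  rw [Matrix.neg_mul, Matrix.one_mul, Matrix.fromBlocks_transpose, h, h']
  rcases Int.units_eq_one_or ε with rfl | rfl <;> simp [Matrix.fromBlocks_neg]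

theorem one_comm {P Q : Matrix m₀ m₁ B} (h : P = Q) :
    P * (1 : Matrix m₁ m₁ B) = (1 : Matrix m₀ m₀ B) * Q := by
  rw [Matrix.mul_one, Matrix.one_mul, h]

theorem neg_one_comm (P : Matrix m₀ m₁ B) :
    (-P).transpose * (1 : Matrix m₀ m₀ B) = (-1 : Matrix m₁ m₁ B) * P.transpose := by
  rw [Matrix.transpose_neg, Matrix.mul_one, Matrix.neg_mul, Matrix.one_mul]

theorem neg_one_comm' (P : Matrix m₀ m₁ B) :
    P.transpose * (-1 : Matrix m₀ m₀ B) = (1 : Matrix m₁ m₁ B) * -P.transpose := by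
  rw [Matrix.mul_neg, Matrix.mul_one, Matrix.one_mul]

theorem one_mul_symm (z : ℤ) {q : Matrix m₀ m₀ B} (h : q.transpose = z • q) :
    Matrix.transpose ((1 : Matrix m₀ m₀ B) * q) = z • ((1 : Matrix m₀ m₀ B) * q) := by
  rw [Matrix.one_mul, h]

theorem neg_one_mul_symm (z : ℤ) {q : Matrix m₀ m₀ B} (h : q.transpose = z • q) :
    Matrix.transpose ((-1 : Matrix m₀ m₀ B) * q) = z • ((-1 : Matrix m₀ m₀ B) * q) := by
  rw [Matrix.neg_mul, Matrix.one_mul, Matrix.transpose_neg, h, smul_neg]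

end BlockAux

/-! ### Matrix factorizations, strict morphisms -/

/-- A matrix factorization of `w` over `B`: a `ℤ/2`-graded free module `M₀ ⊕ M₁` of finite rank
(with bases indexed by `ι₀`, `ι₁`) and an odd operator with components `φ : M₀ → M₁`,
`ψ : M₁ → M₀` whose square is `w`. -/
structure MF {B : Type u} [CommRing B] (w : B) where
  ι₀ : Type
  ι₁ : Type
  [fintype₀ : Fintype ι₀]
  [fintype₁ : Fintype ι₁]
  [deceq₀ : DecidableEq ι₀]
  [deceq₁ : DecidableEq ι₁]
  φ : Matrix ι₁ ι₀ B
  ψ : Matrix ι₀ ι₁ B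
  φ_mul_ψ : φ * ψ = w • 1
  ψ_mul_φ : ψ * φ = w • 1

attribute [instance] MF.fintype₀ MF.fintype₁ MF.deceq₀ MF.deceq₁

namespace MF

variable {B : Type u} [CommRing B] {w : B}

/-- A closed degree zero morphism: `S : M₀ → N₀` and `T : M₁ → N₁` commuting with the
operators. -/
@[ext]
structure Hom (M N : MF w) where
  S : Matrix N.ι₀ M.ι₀ B
  T : Matrix N.ι₁ M.ι₁ B
  φ_comm : N.φ * S = T * M.φ
  ψ_comm : N.ψ * T = S * M.ψ

/-- The category of matrix factorizations and closed degree zero morphisms. -/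
instance : Category (MF w) where
  Hom M N := Hom M N
  id M := ⟨1, 1, by simp, by simp⟩
  comp f g := ⟨g.S * f.S, g.T * f.T,
    by rw [← Matrix.mul_assoc, g.φ_comm, Matrix.mul_assoc, f.φ_comm, Matrix.mul_assoc],
    by rw [← Matrix.mul_assoc, g.ψ_comm, Matrix.mul_assoc, f.ψ_comm, Matrix.mul_assoc]⟩
  id_comp f := Hom.ext (Matrix.mul_one _) (Matrix.mul_one _)
  comp_id f := Hom.ext (Matrix.one_mul _) (Matrix.one_mul _)
  assoc f g h := Hom.ext (Matrix.mul_assoc _ _ _).symm (Matrix.mul_assoc _ _ _).symm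

@[ext]
theorem hom_ext {M N : MF w} {f g : M ⟶ N} (h₀ : f.S = g.S) (h₁ : f.T = g.T) : f = g :=
  Hom.ext h₀ h₁

@[simp] theorem id_S (M : MF w) : (𝟙 M : M ⟶ M).S = 1 := rfl
@[simp] theorem id_T (M : MF w) : (𝟙 M : M ⟶ M).T = 1 := rfl
@[simp] theorem comp_S {M N P : MF w} (f : M ⟶ N) (g : N ⟶ P) : (f ≫ g).S = g.S * f.S := rfl
@[simp] theorem comp_T {M N P : MF w} (f : M ⟶ N) (g : N ⟶ P) : (f ≫ g).T = g.T * f.T := rfl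

/-- An isomorphism from a morphism with invertible components. -/
def isoMk {M N : MF w} (f : M ⟶ N) (S' : Matrix M.ι₀ N.ι₀ B) (T' : Matrix M.ι₁ N.ι₁ B)
    (hS : S' * f.S = 1) (hS' : f.S * S' = 1) (hT : T' * f.T = 1) (hT' : f.T * T' = 1) :
    M ≅ N where
  hom := f
  inv := ⟨S', T',
    by
      have h := congrArg (fun X => T' * (X * S')) f.φ_comm
      simp only [Matrix.mul_assoc, hS', Matrix.mul_one] at h
      rw [h, ← Matrix.mul_assoc, hT, Matrix.one_mul],
    by
      have h := congrArg (fun X => S' * (X * T')) f.ψ_comm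
      simp only [Matrix.mul_assoc, hT', Matrix.mul_one] at h
      rw [h, ← Matrix.mul_assoc, hS, Matrix.one_mul]⟩
  hom_inv_id := hom_ext hS hT
  inv_hom_id := hom_ext hS' hT'

section Additive

variable {M N : MF w}

instance : Zero (M ⟶ N) := ⟨⟨0, 0, by simp, by simp⟩⟩
instance : Add (M ⟶ N) := ⟨fun f g => ⟨f.S + g.S, f.T + g.T,
  by rw [Matrix.mul_add, Matrix.add_mul, f.φ_comm, g.φ_comm],
  by rw [Matrix.mul_add, Matrix.add_mul, f.ψ_comm, g.ψ_comm]⟩⟩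
instance : Neg (M ⟶ N) := ⟨fun f => ⟨-f.S, -f.T,
  by rw [Matrix.mul_neg, Matrix.neg_mul, f.φ_comm],
  by rw [Matrix.mul_neg, Matrix.neg_mul, f.ψ_comm]⟩⟩

@[simp] theorem zero_S : (0 : M ⟶ N).S = 0 := rfl
@[simp] theorem zero_T : (0 : M ⟶ N).T = 0 := rfl
@[simp] theorem add_S (f g : M ⟶ N) : (f + g).S = f.S + g.S := rfl
@[simp] theorem add_T (f g : M ⟶ N) : (f + g).T = f.T + g.T := rfl
@[simp] theorem neg_S (f : M ⟶ N) : (-f).S = -f.S := rfl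
@[simp] theorem neg_T (f : M ⟶ N) : (-f).T = -f.T := rfl

instance : AddCommGroup (M ⟶ N) where
  add_assoc _ _ _ := hom_ext (add_assoc _ _ _) (add_assoc _ _ _)
  zero_add _ := hom_ext (zero_add _) (zero_add _)
  add_zero _ := hom_ext (add_zero _) (add_zero _)
  add_comm _ _ := hom_ext (add_comm _ _) (add_comm _ _)
  neg_add_cancel _ := hom_ext (neg_add_cancel _) (neg_add_cancel _)
  nsmul := nsmulRec
  zsmul := zsmulRec

end Additive

theorem add_comp' {M N P : MF w} (f f' : M ⟶ N) (g : N ⟶ P) : (f + f') ≫ g = f ≫ g + f' ≫ g := by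
  apply hom_ext <;> simp [Matrix.mul_add]

theorem comp_add' {M N P : MF w} (f : M ⟶ N) (g g' : N ⟶ P) : f ≫ (g + g') = f ≫ g + f ≫ g' := by
  apply hom_ext <;> simp [Matrix.add_mul]

instance : Preadditive (MF w) where
  homGroup _ _ := inferInstance
  add_comp _ _ _ f f' g := add_comp' f f' g
  comp_add _ _ _ f g g' := comp_add' f g g'

/-! ### The homotopy category -/

/-- `f` and `g` differ by the boundary `D h = Q h + h Q` of an odd map `h`, with components
`h₀ : M₀ → N₁` and `h₁ : M₁ → N₀`. -/
def Homotopic : HomRel (MF w) := fun M N f g =>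
  ∃ (h₀ : Matrix N.ι₁ M.ι₀ B) (h₁ : Matrix N.ι₀ M.ι₁ B),
    f.S = g.S + (N.ψ * h₀ + h₁ * M.φ) ∧ f.T = g.T + (N.φ * h₁ + h₀ * M.ψ)

theorem Homotopic.add {M N : MF w} {f f' g g' : M ⟶ N} (hf : Homotopic f f')
    (hg : Homotopic g g') : Homotopic (f + g) (f' + g') := by
  obtain ⟨h₀, h₁, e₀, e₁⟩ := hf
  obtain ⟨k₀, k₁, d₀, d₁⟩ := hg
  refine ⟨h₀ + k₀, h₁ + k₁, ?_, ?_⟩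
  · simp only [add_S, e₀, d₀, Matrix.mul_add, Matrix.add_mul]; abel
  · simp only [add_T, e₁, d₁, Matrix.mul_add, Matrix.add_mul]; abel

instance : Congruence (Homotopic (w := w)) where
  equivalence :=
    { refl := fun f => ⟨0, 0, by simp, by simp⟩
      symm := by
        rintro f g ⟨h₀, h₁, e₀, e₁⟩
        refine ⟨-h₀, -h₁, ?_, ?_⟩
        · rw [e₀, Matrix.mul_neg, Matrix.neg_mul]; abel
        · rw [e₁, Matrix.mul_neg, Matrix.neg_mul]; abel
      trans := by
        rintro f g k ⟨h₀, h₁, e₀, e₁⟩ ⟨k₀, k₁, d₀, d₁⟩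
        refine ⟨h₀ + k₀, h₁ + k₁, ?_, ?_⟩
        · rw [e₀, d₀, Matrix.mul_add, Matrix.add_mul]; abel
        · rw [e₁, d₁, Matrix.mul_add, Matrix.add_mul]; abel }
  comp_left := by
    rintro M N P f g g' ⟨h₀, h₁, e₀, e₁⟩
    refine ⟨h₀ * f.S, h₁ * f.T, ?_, ?_⟩
    · simp only [comp_S, e₀, Matrix.add_mul, Matrix.mul_assoc, f.φ_comm]
    · simp only [comp_T, e₁, Matrix.add_mul, Matrix.mul_assoc, f.ψ_comm]
  comp_right := by
    rintro M N P f f' g ⟨h₀, h₁, e₀, e₁⟩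
    refine ⟨g.T * h₀, g.S * h₁, ?_, ?_⟩
    · simp only [comp_S, e₀, Matrix.mul_add, ← Matrix.mul_assoc, g.ψ_comm]
    · simp only [comp_T, e₁, Matrix.mul_add, ← Matrix.mul_assoc, g.φ_comm]

end MF

/-- The homotopy category of matrix factorizations of `w`: its morphisms `M ⟶ N` are the
elements of `Ext⁰(M, N)`, closed degree zero morphisms modulo boundaries. -/
abbrev HMF {B : Type u} [CommRing B] (w : B) := CategoryTheory.Quotient (MF.Homotopic (w := w))

namespace HMF

variable {B : Type u} [CommRing B] {w : B} {B' : Type u} [CommRing B'] {w' : B'}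

/-- The projection of the strict category onto the homotopy category. -/
abbrev proj (w : B) : MF w ⥤ HMF w := CategoryTheory.Quotient.functor _

instance : Preadditive (HMF w) :=
  CategoryTheory.Quotient.preadditive _ fun _ _ _ _ _ _ h h' => MF.Homotopic.add h h'

/-- A functor that preserves homotopies descends to homotopy categories. -/
def lift (F : MF w ⥤ MF w')
    (hF : ∀ (M N : MF w) (f g : M ⟶ N), MF.Homotopic f g → MF.Homotopic (F.map f) (F.map g)) :
    HMF w ⥤ HMF w' :=
  CategoryTheory.Quotient.lift _ (F ⋙ proj w') fun M N f g h => CategoryTheory.Quotient.sound _ (hF M N f g h)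

end HMF

/-! ### Translation and cones -/

namespace MF

variable {B : Type u} [CommRing B] {w : B}

/-- The translate `M[1] = (M₁ → M₀ → M₁)`, with operators `-ψ` and `-φ`. -/
abbrev shiftObj (M : MF w) : MF w where
  ι₀ := M.ι₁
  ι₁ := M.ι₀
  φ := -M.ψ
  ψ := -M.φ
  φ_mul_ψ := (BlockAux.neg_mul_neg' _ _).trans M.ψ_mul_φ
  ψ_mul_φ := (BlockAux.neg_mul_neg' _ _).trans M.φ_mul_ψ

/-- The translation functor, `(S, T) ↦ (T, S)` on morphisms. -/
def shift : MF w ⥤ MF w where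
  obj M := M.shiftObj
  map {M N} f :=
    { S := f.T
      T := f.S
      φ_comm := by rw [Matrix.neg_mul, Matrix.mul_neg, f.ψ_comm]
      ψ_comm := by rw [Matrix.neg_mul, Matrix.mul_neg, f.φ_comm] }
  map_id _ := rfl
  map_comp _ _ := rfl

theorem shift_homotopic (M N : MF w) (f g : M ⟶ N) (h : Homotopic f g) :
    Homotopic (shift.map f) (shift.map g) := by
  obtain ⟨h₀, h₁, e₀, e₁⟩ := h
  refine ⟨-h₁, -h₀, ?_, ?_⟩
  · change f.T = g.T + ((-N.φ) * (-h₁) + (-h₀) * (-M.ψ))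
    rw [e₁, BlockAux.neg_mul_neg', BlockAux.neg_mul_neg']
  · change f.S = g.S + ((-N.ψ) * (-h₀) + (-h₁) * (-M.φ))
    rw [e₀, BlockAux.neg_mul_neg', BlockAux.neg_mul_neg']

/-- The cone `N ⊕ M[1]` of `f : M ⟶ N`, with operator `Q_N + f + Q_{M[1]}`. -/
abbrev cone {M N : MF w} (f : M ⟶ N) : MF w where
  ι₀ := N.ι₀ ⊕ M.ι₁
  ι₁ := N.ι₁ ⊕ M.ι₀
  φ := Matrix.fromBlocks N.φ f.T 0 (-M.ψ)
  ψ := Matrix.fromBlocks N.ψ f.S 0 (-M.φ)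
  φ_mul_ψ := BlockAux.cone_mul N.φ_mul_ψ M.ψ_mul_φ f.φ_comm
  ψ_mul_φ := BlockAux.cone_mul N.ψ_mul_φ M.φ_mul_ψ f.ψ_comm

/-- The inclusion `N ⟶ cone f`. -/
def coneInl {M N : MF w} (f : M ⟶ N) : N ⟶ cone f where
  S := BlockAux.inl B N.ι₀ M.ι₁
  T := BlockAux.inl B N.ι₁ M.ι₀
  φ_comm := BlockAux.inl_comm _ _ _
  ψ_comm := BlockAux.inl_comm _ _ _

/-- The projection `cone f ⟶ M[1]`. -/
def coneSnd {M N : MF w} (f : M ⟶ N) : cone f ⟶ shift.obj M where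
  S := BlockAux.snd B N.ι₀ M.ι₁
  T := BlockAux.snd B N.ι₁ M.ι₀
  φ_comm := BlockAux.snd_comm _ _ _
  ψ_comm := BlockAux.snd_comm _ _ _

end MF

/-! ### Triangles and triangulated equivalences -/

/-- A triangle `X₁ ⟶ X₂ ⟶ X₃ ⟶ X₁[1]` in a category with translation functor `T`. -/
structure Tri {C : Type u} [Category.{v} C] (T : C ⥤ C) where
  obj₁ : C
  obj₂ : C
  obj₃ : C
  mor₁ : obj₁ ⟶ obj₂
  mor₂ : obj₂ ⟶ obj₃
  mor₃ : obj₃ ⟶ T.obj obj₁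

/-- The image of a triangle under a functor that commutes with the translations. -/
def Tri.map {C : Type u} [Category.{v} C] {T : C ⥤ C} {D : Type u'} [Category.{v'} D] {T' : D ⥤ D}
    (F : C ⥤ D) (η : T ⋙ F ≅ F ⋙ T') (t : Tri T) : Tri T' where
  obj₁ := F.obj t.obj₁
  obj₂ := F.obj t.obj₂
  obj₃ := F.obj t.obj₃
  mor₁ := F.map t.mor₁
  mor₂ := F.map t.mor₂
  mor₃ := F.map t.mor₃ ≫ η.hom.app t.obj₁

/-- `F` is an additive equivalence which, for a suitable isomorphism `F(X[1]) ≅ F(X)[1]`,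
preserves and reflects distinguished triangles. -/
def IsTriangleEquivalence {C : Type u} [Category.{v} C] [Preadditive C] {T : C ⥤ C}
    (dist : Set (Tri T)) {D : Type u'} [Category.{v'} D] [Preadditive D] {T' : D ⥤ D}
    (dist' : Set (Tri T')) (F : C ⥤ D) : Prop :=
  F.IsEquivalence ∧ F.Additive ∧
    ∃ η : T ⋙ F ≅ F ⋙ T', ∀ t : Tri T, Tri.map F η t ∈ dist' ↔ t ∈ dist

namespace HMF

variable {B : Type u} [CommRing B] {w : B}

/-- The translation functor on the homotopy category. -/
def shift (w : B) : HMF w ⥤ HMF w := lift MF.shift MF.shift_homotopic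

/-- The projection `cone f ⟶ M[1]` in the homotopy category. -/
def projConeSnd {M N : MF w} (f : M ⟶ N) :
    (proj w).obj (MF.cone f) ⟶ (shift w).obj ((proj w).obj M) :=
  (proj w).map (MF.coneSnd f)

/-- The distinguished triangles: those isomorphic to a cone triangle
`M ⟶ N ⟶ cone f ⟶ M[1]`. -/
def distTriangles (w : B) : Set (Tri (shift w)) :=
  {t | ∃ (M N : MF w) (f : M ⟶ N) (e₁ : t.obj₁ ≅ (proj w).obj M) (e₂ : t.obj₂ ≅ (proj w).obj N)
    (e₃ : t.obj₃ ≅ (proj w).obj (MF.cone f)),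
    t.mor₁ ≫ e₂.hom = e₁.hom ≫ (proj w).map f ∧
    t.mor₂ ≫ e₃.hom = e₂.hom ≫ (proj w).map (MF.coneInl f) ∧
    t.mor₃ ≫ (shift w).map e₁.hom = e₃.hom ≫ projConeSnd f}

end HMF

/-! ### Duality and (twisted) orthogonal and symplectic forms -/

namespace MF

variable {B : Type u} [CommRing B] {w : B}

/-- `Mᵀ = (M₀* → M₁* → M₀*)`, with operators `ᵗψ`, `ᵗφ`. -/
abbrev transpose (M : MF w) : MF w where
  ι₀ := M.ι₀
  ι₁ := M.ι₁
  φ := M.ψ.transpose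
  ψ := M.φ.transpose
  φ_mul_ψ := by rw [← Matrix.transpose_mul, M.φ_mul_ψ]; simp
  ψ_mul_φ := by rw [← Matrix.transpose_mul, M.ψ_mul_φ]; simp

/-- `M* = (M₁* → M₀* → M₁*)`, with operators `-ᵗφ`, `-ᵗψ`. -/
abbrev dual (M : MF w) : MF w where
  ι₀ := M.ι₁
  ι₁ := M.ι₀
  φ := -M.φ.transpose
  ψ := -M.ψ.transpose
  φ_mul_ψ := by rw [BlockAux.neg_mul_neg', ← Matrix.transpose_mul, M.ψ_mul_φ]; simp
  ψ_mul_φ := by rw [BlockAux.neg_mul_neg', ← Matrix.transpose_mul, M.φ_mul_ψ]; simp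

/-- The canonical isomorphism `(M*)[1] ≅ (M[1])*`, with identity components. -/
def shiftDual (M : MF w) : shift.obj M.dual ≅ M.shiftObj.dual :=
  isoMk (M := M.dual.shiftObj) (N := M.shiftObj.dual)
    ⟨(1 : Matrix M.ι₀ M.ι₀ B), (1 : Matrix M.ι₁ M.ι₁ B),
      BlockAux.one_comm (congrArg Neg.neg (Matrix.transpose_neg M.ψ)),
      BlockAux.one_comm (congrArg Neg.neg (Matrix.transpose_neg M.φ))⟩
    (1 : Matrix M.ι₀ M.ι₀ B) (1 : Matrix M.ι₁ M.ι₁ B)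
    (Matrix.one_mul _) (Matrix.one_mul _) (Matrix.one_mul _) (Matrix.one_mul _)

/-- The transpose `ᵗf : N* ⟶ M*` of a morphism `f : M ⟶ N`. -/
def dualMap {M N : MF w} (f : M ⟶ N) : dual N ⟶ dual M where
  S := f.T.transpose
  T := f.S.transpose
  φ_comm := by
    change -M.φ.transpose * f.T.transpose = f.S.transpose * -N.φ.transpose
    rw [Matrix.neg_mul, Matrix.mul_neg, ← Matrix.transpose_mul, ← Matrix.transpose_mul, f.φ_comm]
  ψ_comm := by
    change -M.ψ.transpose * f.S.transpose = f.T.transpose * -N.ψ.transpose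
    rw [Matrix.neg_mul, Matrix.mul_neg, ← Matrix.transpose_mul, ← Matrix.transpose_mul, f.ψ_comm]

theorem dualMap_homotopic {M N : MF w} {f g : M ⟶ N} (h : Homotopic f g) :
    Homotopic (dualMap f) (dualMap g) := by
  obtain ⟨h₀, h₁, e₀, e₁⟩ := h
  refine ⟨-h₀.transpose, -h₁.transpose, ?_, ?_⟩
  · change f.T.transpose = g.T.transpose +
      ((-M.ψ.transpose) * (-h₀.transpose) + (-h₁.transpose) * (-N.φ.transpose))
    rw [e₁]
    simp only [Matrix.transpose_add, Matrix.transpose_mul, BlockAux.neg_mul_neg', add_comm]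
  · change f.S.transpose = g.S.transpose +
      ((-M.φ.transpose) * (-h₁.transpose) + (-h₀.transpose) * (-N.ψ.transpose))
    rw [e₀]
    simp only [Matrix.transpose_add, Matrix.transpose_mul, BlockAux.neg_mul_neg', add_comm]

end MF

/-- A matrix factorization with an orthogonal (`ε = 1`) or symplectic (`ε = -1`) form: an
isomorphism `b : M ≅ M*` whose components `b₀ : M₀ → M₁*`, `b₁ : M₁ → M₀*` satisfy
`b₁ = -ε ᵗb₀`. -/
structure FormMF (ε : ℤˣ) {B : Type u} [CommRing B] (w : B) where
  toMF : MF w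
  b : toMF ≅ toMF.dual
  symm : b.hom.T = -((ε : ℤ) • b.hom.S.transpose)

/-- A matrix factorization with a twisted orthogonal (`ε = 1`) or twisted symplectic (`ε = -1`)
form: an isomorphism `q : M ≅ Mᵀ` whose components `q₀ : M₀ → M₀*`, `q₁ : M₁ → M₁*` satisfy
`ᵗqᵢ = ε qᵢ`. -/
structure TwistedFormMF (ε : ℤˣ) {B : Type u} [CommRing B] (w : B) where
  toMF : MF w
  q : toMF ≅ toMF.transpose
  symm₀ : q.hom.S.transpose = (ε : ℤ) • q.hom.S
  symm₁ : q.hom.T.transpose = (ε : ℤ) • q.hom.T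

/-- The category `MF^±(w)`: objects carry an orthogonal (`ε = 1`) or symplectic (`ε = -1`) form,
morphisms are those of the underlying objects of the homotopy category. -/
abbrev FormHMF (ε : ℤˣ) {B : Type u} [CommRing B] (w : B) :=
  InducedCategory (HMF w) (fun X : FormMF ε w => (HMF.proj w).obj X.toMF)

/-- The category `MF^{ω,±}(w)`: objects carry a twisted form of sign `ε`, morphisms are those of
the underlying objects of the homotopy category. -/
abbrev TwistedFormHMF (ε : ℤˣ) {B : Type u} [CommRing B] (w : B) :=
  InducedCategory (HMF w) (fun X : TwistedFormMF ε w => (HMF.proj w).obj X.toMF)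

namespace FormMF

variable {ε : ℤˣ} {B : Type u} [CommRing B] {w : B}

/-- The translate of a matrix factorization with form: `b[1]` has components
`b₁ : M₁ → M₀*` and `b₀ : M₀ → M₁*`. -/
def shift (X : FormMF ε w) : FormMF ε w where
  toMF := X.toMF.shiftObj
  b := MF.shift.mapIso X.b ≪≫ MF.shiftDual X.toMF
  symm := by
    have key : ∀ {m n : Type} [Fintype m] [Fintype n] [DecidableEq m] [DecidableEq n]
        (S : Matrix m n B) (T : Matrix n m B), T = -((ε : ℤ) • S.transpose) →
        (1 : Matrix m m B) * S = -((ε : ℤ) • ((1 : Matrix n n B) * T).transpose) := by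
      intro m n _ _ _ _ S T h
      rw [h]
      rcases Int.units_eq_one_or ε with rfl | rfl <;> simp
    exact key _ _ X.symm

/-- The adjoint `b⁻¹ ᵗf b'` of a strict morphism `f : (M, b) ⟶ (M', b')`. -/
def adj {X Y : FormMF ε w} (f : X.toMF ⟶ Y.toMF) : Y.toMF ⟶ X.toMF :=
  Y.b.hom ≫ MF.dualMap f ≫ X.b.inv

theorem adj_homotopic {X Y : FormMF ε w} {f g : X.toMF ⟶ Y.toMF} (h : MF.Homotopic f g) :
    MF.Homotopic (adj f) (adj g) := by
  exact HomRel.comp_left _ (HomRel.comp_right _ (MF.dualMap_homotopic h))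

end FormMF

namespace FormHMF

variable {ε : ℤˣ} {B : Type u} [CommRing B] {w : B}

/-- The translation functor on `MF^±(w)`. -/
def shift (ε : ℤˣ) (w : B) : FormHMF ε w ⥤ FormHMF ε w where
  obj X := FormMF.shift X
  map {X Y} f := InducedCategory.homMk (X := FormMF.shift X) (Y := FormMF.shift Y)
    ((HMF.shift w).map f.hom)
  map_id _ := InducedCategory.hom_ext ((HMF.shift w).map_id _)
  map_comp _ _ := InducedCategory.hom_ext ((HMF.shift w).map_comp _ _)

/-- The forgetful functor to the homotopy category. -/
abbrev forget (ε : ℤˣ) (w : B) : FormHMF ε w ⥤ HMF w := inducedFunctor _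

/-- The forgetful functor commutes with the translations (by definition). -/
def forgetShift (ε : ℤˣ) (w : B) : shift ε w ⋙ forget ε w ≅ forget ε w ⋙ HMF.shift w :=
  NatIso.ofComponents (fun X => Iso.refl ((HMF.shift w).obj ((HMF.proj w).obj X.toMF)))
    (fun _ => (Category.comp_id _).trans (Category.id_comp _).symm)

/-- The distinguished triangles of `MF^±(w)`: those whose underlying triangle in the homotopy
category is distinguished. -/
def distTriangles (ε : ℤˣ) (w : B) : Set (Tri (shift ε w)) :=
  {t | Tri.map (forget ε w) (forgetShift ε w) t ∈ HMF.distTriangles w}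

/-- The adjoint of a morphism of `MF^±(w)`, as an operation on homotopy classes. -/
def adj {X Y : FormHMF ε w} (f : X ⟶ Y) : Y ⟶ X :=
  InducedCategory.homMk <|
    Quot.map (FormMF.adj (X := X) (Y := Y))
      (fun _ _ h => HomRel.CompClosure.of
        (FormMF.adj_homotopic ((HomRel.compClosure_iff_self _ _ _).1 h))) f.hom

/-- `f : (M, b) ⟶ (M', b')` is an isometry: it is invertible, with inverse its adjoint. -/
def IsIsometry {X Y : FormHMF ε w} (f : X ⟶ Y) : Prop :=
  f ≫ adj f = 𝟙 X ∧ adj f ≫ f = 𝟙 Y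

end FormHMF

/-- `F` is an equivalence of the categories with translation, distinguished triangles and forms:
it is a triangle equivalence, it commutes with adjunction, and every object of the target is
isometric to an object of its image. -/
def IsFormEquivalence {ε δ : ℤˣ} {B : Type u} [CommRing B] {w : B} {B' : Type u'} [CommRing B']
    {w' : B'} (F : FormHMF ε w ⥤ FormHMF δ w') : Prop :=
  IsTriangleEquivalence (FormHMF.distTriangles ε w) (FormHMF.distTriangles δ w') F ∧
  (∀ (X Y : FormHMF ε w) (f : X ⟶ Y), F.map (FormHMF.adj f) = FormHMF.adj (F.map f)) ∧
  ∀ Y : FormHMF δ w', ∃ (X : FormHMF ε w) (f : F.obj X ⟶ Y), FormHMF.IsIsometry f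

noncomputable section Theta

/-! ### The Faltings–Knörrer functor -/

/-- Formal power series in two variables `X 0`, `X 1`. -/
abbrev PS₂ (A : Type u) := MvPowerSeries (Fin 2) A

open MvPowerSeries

variable {A : Type u} [CommRing A] {p : A} {w : PS₂ A}

namespace MF

/-- A matrix over `A` viewed over `A[[x, y]]`. -/
def ext₂ {m n : Type} (P : Matrix m n A) : Matrix m n (PS₂ A) := P.map (C (σ := Fin 2) (R := A))

theorem ext₂_mul {l m n : Type} [Fintype m] (P : Matrix l m A) (Q : Matrix m n A) :
    ext₂ (P * Q) = ext₂ P * ext₂ Q := Matrix.map_mul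

@[simp] theorem ext₂_one {n : Type} [DecidableEq n] : ext₂ (1 : Matrix n n A) = 1 :=
  Matrix.map_one _ (map_zero _) (map_one _)

@[simp] theorem ext₂_add {m n : Type} (P Q : Matrix m n A) : ext₂ (P + Q) = ext₂ P + ext₂ Q :=
  Matrix.map_add _ (map_add _) _ _

@[simp] theorem ext₂_neg {m n : Type} (P : Matrix m n A) : ext₂ (-P) = -ext₂ P := by
  ext1; simp [ext₂]

theorem ext₂_smul_one {n : Type} [DecidableEq n] (a : A) :
    ext₂ (a • (1 : Matrix n n A)) = (C (σ := Fin 2) a) • 1 := by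
  ext1 i j; by_cases h : i = j <;> simp [ext₂, h]

theorem ext₂_transpose {m n : Type} (P : Matrix m n A) :
    ext₂ P.transpose = (ext₂ P).transpose := rfl

theorem ext₂_zsmul {m n : Type} (z : ℤ) (P : Matrix m n A) : ext₂ (z • P) = z • ext₂ P := by
  ext1; simp [ext₂]

theorem ext₂_mul_eq {m n : Type} [Fintype n] [DecidableEq m] {P : Matrix m n A} {Q : Matrix n m A}
    (h : P * Q = p • 1) : ext₂ P * ext₂ Q = (C (σ := Fin 2) p) • 1 := by
  rw [← ext₂_mul, h, ext₂_smul_one]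

theorem ext₂_comm {m n k l : Type} [Fintype n] [Fintype k] {P : Matrix m n A} {S : Matrix n l A}
    {T : Matrix m k A} {Q : Matrix k l A} (h : P * S = T * Q) :
    ext₂ P * ext₂ S = ext₂ T * ext₂ Q := by
  rw [← ext₂_mul, h, ext₂_mul]

theorem ext₂_comm_neg {m n k l : Type} [Fintype n] [Fintype k] {P : Matrix m n A}
    {S : Matrix n l A} {T : Matrix m k A} {Q : Matrix k l A} (h : P * S = T * Q) :
    -ext₂ P * ext₂ S = ext₂ T * -ext₂ Q := by
  rw [Matrix.neg_mul, Matrix.mul_neg, ext₂_comm h]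

theorem ext₂_diag_one (m n : Type) [DecidableEq m] [DecidableEq n] :
    Matrix.fromBlocks (ext₂ (1 : Matrix m m A)) 0 0 (ext₂ (1 : Matrix n n A)) = 1 := by
  rw [ext₂_one, ext₂_one, Matrix.fromBlocks_one]

theorem ext₂_diag_mul {m₀ m₁ n₀ n₁ l₀ l₁ : Type} [Fintype m₀] [Fintype m₁] (P : Matrix l₀ m₀ A)
    (P' : Matrix l₁ m₁ A) (Q : Matrix m₀ n₀ A) (Q' : Matrix m₁ n₁ A) :
    Matrix.fromBlocks (ext₂ (P * Q)) 0 0 (ext₂ (P' * Q')) =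
      Matrix.fromBlocks (ext₂ P) 0 0 (ext₂ P') * Matrix.fromBlocks (ext₂ Q) 0 0 (ext₂ Q') := by
  rw [Matrix.fromBlocks_multiply]
  simp [ext₂_mul]

theorem ext₂_homotopy {m n k l : Type} [Fintype k] [Fintype l] {S S' : Matrix m n A}
    {Q : Matrix m k A} {h : Matrix k n A} {h' : Matrix m l A} {P : Matrix l n A}
    (e : S = S' + (Q * h + h' * P)) :
    ext₂ S = ext₂ S' + (ext₂ Q * ext₂ h + ext₂ h' * ext₂ P) := by
  rw [e, ext₂_add, ext₂_add, ext₂_mul, ext₂_mul]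

theorem ext₂_symm {m n : Type} {ε δ : ℤˣ} (hδ : δ = -ε) {S : Matrix m n A} {T : Matrix n m A}
    (h : T = -((ε : ℤ) • S.transpose)) : (ext₂ S).transpose = (δ : ℤ) • ext₂ T := by
  rw [hδ, h, ext₂_neg, ext₂_zsmul, ext₂_transpose]
  rcases Int.units_eq_one_or ε with rfl | rfl <;> simp

theorem ext₂_symm' {m n : Type} {ε δ : ℤˣ} (hδ : δ = -ε) {S : Matrix m n A} {T : Matrix n m A}
    (h : T = -((ε : ℤ) • S.transpose)) : (ext₂ T).transpose = (δ : ℤ) • ext₂ S := by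
  rw [hδ, h, ext₂_neg, ext₂_zsmul, ext₂_transpose]
  rcases Int.units_eq_one_or ε with rfl | rfl <;> simp

theorem ext₂_transpose_eq {m : Type} {z : ℤ} {S : Matrix m m A} (h : S.transpose = z • S) :
    (ext₂ S).transpose = z • ext₂ S := by
  rw [← ext₂_transpose, h, ext₂_zsmul]

/-- `(P, Q)` with `P Q = Q P = p` is sent to the factorization of `x y - p` over `A[[x, y]]` with
operators `φ = (x, P; Q, y)` and `ψ = (y, -P; -Q, x)`. -/
abbrev thetaObj (hw : w = X 0 * X 1 - C p) (M : MF p) : MF w where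
  ι₀ := M.ι₁ ⊕ M.ι₀
  ι₁ := M.ι₁ ⊕ M.ι₀
  φ := Matrix.fromBlocks ((X 0 : PS₂ A) • 1) (ext₂ M.φ) (ext₂ M.ψ) ((X 1 : PS₂ A) • 1)
  ψ := Matrix.fromBlocks ((X 1 : PS₂ A) • 1) (-ext₂ M.φ) (-ext₂ M.ψ) ((X 0 : PS₂ A) • 1)
  φ_mul_ψ := BlockAux.theta_mul hw (ext₂_mul_eq M.φ_mul_ψ) (ext₂_mul_eq M.ψ_mul_φ)
  ψ_mul_φ := BlockAux.theta_mul' hw (ext₂_mul_eq M.φ_mul_ψ) (ext₂_mul_eq M.ψ_mul_φ)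

/-- The Faltings–Knörrer functor `θ`; a morphism `(S, T)` is sent to `T ⊕ S` in both degrees. -/
def theta (hw : w = X 0 * X 1 - C p) : MF p ⥤ MF w where
  obj M := thetaObj hw M
  map {M N} f :=
    { S := Matrix.fromBlocks (ext₂ f.T) 0 0 (ext₂ f.S)
      T := Matrix.fromBlocks (ext₂ f.T) 0 0 (ext₂ f.S)
      φ_comm := BlockAux.theta_comm _ _ (ext₂_comm f.φ_comm) (ext₂_comm f.ψ_comm)
      ψ_comm := BlockAux.theta_comm _ _ (ext₂_comm_neg f.φ_comm) (ext₂_comm_neg f.ψ_comm) }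
  map_id _ := hom_ext (ext₂_diag_one _ _) (ext₂_diag_one _ _)
  map_comp _ _ := hom_ext (ext₂_diag_mul _ _ _ _) (ext₂_diag_mul _ _ _ _)

theorem theta_homotopic (hw : w = X 0 * X 1 - C p) (M N : MF p) (f g : M ⟶ N)
    (h : Homotopic f g) : Homotopic ((theta hw).map f) ((theta hw).map g) := by
  obtain ⟨h₀, h₁, e₀, e₁⟩ := h
  exact ⟨-Matrix.fromBlocks 0 (ext₂ h₀) (ext₂ h₁) 0, Matrix.fromBlocks 0 (ext₂ h₀) (ext₂ h₁) 0,
    BlockAux.theta_homotopy (X 0 : PS₂ A) (X 1) (ext₂_homotopy e₀) (ext₂_homotopy e₁),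
    BlockAux.theta_homotopy' (X 0 : PS₂ A) (X 1) (ext₂_homotopy e₀) (ext₂_homotopy e₁)⟩

/-- The canonical isomorphism `θ(M*) ≅ θ(M)ᵀ`, exchanging the two summands. -/
def thetaDual (hw : w = X 0 * X 1 - C p) (M : MF p) :
    (theta hw).obj M.dual ≅ (thetaObj hw M).transpose :=
  isoMk (M := thetaObj hw M.dual) (N := (thetaObj hw M).transpose)
    ⟨BlockAux.swap (PS₂ A) M.ι₁ M.ι₀, BlockAux.swap (PS₂ A) M.ι₁ M.ι₀,
      BlockAux.swap_comm (X 0 : PS₂ A) (X 1) (ext₂_neg M.φ.transpose) (ext₂_neg M.ψ.transpose),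
      BlockAux.swap_comm' (X 0 : PS₂ A) (X 1) (ext₂_neg M.φ.transpose)
        (ext₂_neg M.ψ.transpose)⟩
    (BlockAux.swap (PS₂ A) M.ι₀ M.ι₁) (BlockAux.swap (PS₂ A) M.ι₀ M.ι₁)
    BlockAux.swap_mul_swap BlockAux.swap_mul_swap BlockAux.swap_mul_swap BlockAux.swap_mul_swap

/-- The canonical isomorphism `θ(Mᵀ) ≅ θ(M)*`, with components `1` and `-1`. -/
def thetaTranspose (hw : w = X 0 * X 1 - C p) (M : MF p) :
    (theta hw).obj M.transpose ≅ (thetaObj hw M).dual :=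
  isoMk (M := thetaObj hw M.transpose) (N := (thetaObj hw M).dual)
    ⟨(1 : Matrix (M.ι₁ ⊕ M.ι₀) (M.ι₁ ⊕ M.ι₀) (PS₂ A)),
      (-1 : Matrix (M.ι₁ ⊕ M.ι₀) (M.ι₁ ⊕ M.ι₀) (PS₂ A)),
      BlockAux.transpose_comm (X 0 : PS₂ A) (X 1) (ext₂ M.φ) (ext₂ M.ψ),
      BlockAux.transpose_comm' (X 0 : PS₂ A) (X 1) (ext₂ M.φ) (ext₂ M.ψ)⟩
    (1 : Matrix (M.ι₁ ⊕ M.ι₀) (M.ι₁ ⊕ M.ι₀) (PS₂ A))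
    (-1 : Matrix (M.ι₁ ⊕ M.ι₀) (M.ι₁ ⊕ M.ι₀) (PS₂ A))
    (Matrix.one_mul _) (Matrix.one_mul _)
    (BlockAux.neg_one_mul_neg_one _) (BlockAux.neg_one_mul_neg_one _)

end MF

/-- The functor `θ` on homotopy categories. -/
def HMF.theta (hw : w = X 0 * X 1 - C p) : HMF p ⥤ HMF w :=
  HMF.lift (MF.theta hw) (MF.theta_homotopic hw)

/-- `θ` on objects with a form: `b` of sign `ε` is sent to the twisted form of sign `δ = -ε` given, in
both degrees, by `M₁ ⊕ M₀ → M₁* ⊕ M₀*`, `(m₁, m₀) ↦ (b₀ m₀, b₁ m₁)`. -/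
def FormMF.theta {ε δ : ℤˣ} (hδ : δ = -ε) (hw : w = X 0 * X 1 - C p) (Y : FormMF ε p) :
    TwistedFormMF δ w where
  toMF := MF.thetaObj hw Y.toMF
  q := (MF.theta hw).mapIso Y.b ≪≫ MF.thetaDual hw Y.toMF
  symm₀ := BlockAux.swap_mul_symm _ (MF.ext₂_symm hδ Y.symm) (MF.ext₂_symm' hδ Y.symm)
  symm₁ := BlockAux.swap_mul_symm _ (MF.ext₂_symm hδ Y.symm) (MF.ext₂_symm' hδ Y.symm)

/-- `θ` on objects with a twisted form: `q` of sign `ε` is sent to the form of the same sign with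
components `b₀ = q₁ ⊕ q₀` and `b₁ = -(q₁ ⊕ q₀)`. -/
def TwistedFormMF.theta {ε : ℤˣ} (hw : w = X 0 * X 1 - C p) (Y : TwistedFormMF ε p) :
    FormMF ε w where
  toMF := MF.thetaObj hw Y.toMF
  b := (MF.theta hw).mapIso Y.q ≪≫ MF.thetaTranspose hw Y.toMF
  symm := BlockAux.diag_symm _ (MF.ext₂_transpose_eq Y.symm₀) (MF.ext₂_transpose_eq Y.symm₁)

/-- The functor `θ : MF^±(p) ⥤ MF^{ω,∓}(x y - p)`. -/
def FormHMF.theta {ε δ : ℤˣ} (hδ : δ = -ε) (hw : w = X 0 * X 1 - C p) :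
    FormHMF ε p ⥤ TwistedFormHMF δ w where
  obj Y := FormMF.theta hδ hw Y
  map {Y Z} f := InducedCategory.homMk (X := FormMF.theta hδ hw Y) (Y := FormMF.theta hδ hw Z)
    ((HMF.theta hw).map f.hom)
  map_id _ := InducedCategory.hom_ext ((HMF.theta hw).map_id _)
  map_comp _ _ := InducedCategory.hom_ext ((HMF.theta hw).map_comp _ _)

/-- The functor `θ : MF^{ω,±}(p) ⥤ MF^±(x y - p)`. -/
def TwistedFormHMF.theta (ε : ℤˣ) (hw : w = X 0 * X 1 - C p) :
    TwistedFormHMF ε p ⥤ FormHMF ε w where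
  obj Y := TwistedFormMF.theta hw Y
  map {Y Z} f := InducedCategory.homMk (X := TwistedFormMF.theta hw Y)
    (Y := TwistedFormMF.theta hw Z) ((HMF.theta hw).map f.hom)
  map_id _ := InducedCategory.hom_ext ((HMF.theta hw).map_id _)
  map_comp _ _ := InducedCategory.hom_ext ((HMF.theta hw).map_comp _ _)

end Theta

/-! ### Changing the sign of the potential -/

section Sign

variable {B : Type u} [CommRing B] {w w' : B}

namespace MF

/-- `(φ, ψ) ↦ (φ, -ψ)`, a factorization of `-w`. -/
abbrev signObj (hw : w' = -w) (M : MF w) : MF w' where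
  ι₀ := M.ι₀
  ι₁ := M.ι₁
  φ := M.φ
  ψ := -M.ψ
  φ_mul_ψ := by rw [Matrix.mul_neg, M.φ_mul_ψ, hw, neg_smul]
  ψ_mul_φ := by rw [Matrix.neg_mul, M.ψ_mul_φ, hw, neg_smul]

/-- The isomorphism of categories `(φ, ψ) ↦ (φ, -ψ)`, the identity on the components of
morphisms. -/
def sign (hw : w' = -w) : MF w ⥤ MF w' where
  obj M := signObj hw M
  map f :=
    { S := f.S
      T := f.T
      φ_comm := f.φ_comm
      ψ_comm := by rw [Matrix.neg_mul, Matrix.mul_neg, f.ψ_comm] }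
  map_id _ := rfl
  map_comp _ _ := rfl

theorem sign_homotopic (hw : w' = -w) (M N : MF w) (f g : M ⟶ N) (h : Homotopic f g) :
    Homotopic ((sign hw).map f) ((sign hw).map g) := by
  obtain ⟨h₀, h₁, e₀, e₁⟩ := h
  refine ⟨-h₀, h₁, ?_, ?_⟩
  · change f.S = g.S + ((-N.ψ) * (-h₀) + h₁ * M.φ)
    rw [e₀, BlockAux.neg_mul_neg']
  · change f.T = g.T + (N.φ * h₁ + (-h₀) * (-M.ψ))
    rw [e₁, BlockAux.neg_mul_neg']

/-- The canonical isomorphism between the sign change of `Mᵀ` and the transpose of the sign change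
of `M`, with components `1` and `-1`. -/
def signTranspose (hw : w' = -w) (M : MF w) :
    (sign hw).obj M.transpose ≅ (signObj hw M).transpose :=
  isoMk (M := signObj hw M.transpose) (N := (signObj hw M).transpose)
    ⟨(1 : Matrix M.ι₀ M.ι₀ B), (-1 : Matrix M.ι₁ M.ι₁ B),
      BlockAux.neg_one_comm M.ψ, BlockAux.neg_one_comm' M.φ⟩
    (1 : Matrix M.ι₀ M.ι₀ B) (-1 : Matrix M.ι₁ M.ι₁ B)
    (Matrix.one_mul _) (Matrix.one_mul _)
    (BlockAux.neg_one_mul_neg_one _) (BlockAux.neg_one_mul_neg_one _)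

end MF

/-- The sign change on homotopy categories. -/
def HMF.sign (hw : w' = -w) : HMF w ⥤ HMF w' :=
  HMF.lift (MF.sign hw) (MF.sign_homotopic hw)

/-- The sign change on objects with a twisted form: `(q₀, q₁)` is sent to `(q₀, -q₁)`. -/
def TwistedFormMF.sign {ε : ℤˣ} (hw : w' = -w) (Y : TwistedFormMF ε w) : TwistedFormMF ε w' where
  toMF := MF.signObj hw Y.toMF
  q := (MF.sign hw).mapIso Y.q ≪≫ MF.signTranspose hw Y.toMF
  symm₀ := BlockAux.one_mul_symm _ Y.symm₀
  symm₁ := BlockAux.neg_one_mul_symm _ Y.symm₁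

/-- The sign change `MF^{ω,±}(w) ⥤ MF^{ω,±}(-w)`. -/
def TwistedFormHMF.sign (ε : ℤˣ) (hw : w' = -w) : TwistedFormHMF ε w ⥤ TwistedFormHMF ε w' where
  obj Y := TwistedFormMF.sign hw Y
  map {Y Z} f := InducedCategory.homMk (X := TwistedFormMF.sign hw Y)
    (Y := TwistedFormMF.sign hw Z) ((HMF.sign hw).map f.hom)
  map_id _ := InducedCategory.hom_ext ((HMF.sign hw).map_id _)
  map_comp _ _ := InducedCategory.hom_ext ((HMF.sign hw).map_comp _ _)

end Sign

/-! ### The square of the Faltings–Knörrer functor -/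

noncomputable section Square

open MvPowerSeries

variable {A : Type u} [CommRing A]

/-- `x y - p` in `A[[x, y]]`. -/
abbrev knorrer (p : A) : PS₂ A := X 0 * X 1 - C p

/-- `x y + u v - p` in `A[[x, y]][[u, v]]`, where `u`, `v` are the outer variables. -/
abbrev doubleKnorrer (p : A) : PS₂ (PS₂ A) := C (X 0 * X 1) + X 0 * X 1 - C (C p)

/-- `θθ : MF(p) ⥤ MF(u v - (x y - p))`. -/
def HMF.thetaSq (p : A) : HMF p ⥤ HMF (knorrer (knorrer p)) :=
  HMF.theta rfl ⋙ HMF.theta rfl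

/-- `θθ : MF^±(p) ⥤ MF^∓(u v - (x y - p))`, where `ε = ±1` and `δ = -ε`. -/
def FormHMF.thetaSq {ε δ : ℤˣ} (hδ : δ = -ε) (p : A) :
    FormHMF ε p ⥤ FormHMF δ (knorrer (knorrer p)) :=
  FormHMF.theta hδ rfl ⋙ TwistedFormHMF.theta δ rfl

theorem doubleKnorrer_eq (p : A) : doubleKnorrer p = X 0 * X 1 - C (-knorrer p) := by
  simp only [doubleKnorrer, knorrer, map_neg, map_sub]; ring

/-- `MF(p) ⥤ MF(x y + u v - p)`: the square of `θ`, with the sign of the potential `x y - p`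
changed in between. -/
def HMF.thetaSqSign (p : A) : HMF p ⥤ HMF (doubleKnorrer p) :=
  HMF.theta (w := knorrer p) rfl ⋙ HMF.sign rfl ⋙ HMF.theta (doubleKnorrer_eq p)

/-- `MF^±(p) ⥤ MF^∓(x y + u v - p)`, where `ε = ±1` and `δ = -ε`: the square of `θ`, with the sign
of the potential `x y - p` changed in between. -/
def FormHMF.thetaSqSign {ε δ : ℤˣ} (hδ : δ = -ε) (p : A) :
    FormHMF ε p ⥤ FormHMF δ (doubleKnorrer p) :=
  FormHMF.theta (w := knorrer p) hδ rfl ⋙ TwistedFormHMF.sign δ rfl ⋙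
    TwistedFormHMF.theta δ (doubleKnorrer_eq p)

end Square

/-! ### Morphisms in the homotopy category -/

/-! Everything rests on a single application of θ. Over any commutative ring θ is fully faithful up
to homotopy. If θ(f) is null-homotopic, the off-diagonal blocks of the constant terms of the
homotopy form, up to sign, a homotopy for f (`MF.null_of_null_theta`). If (F, G) is a morphism θ(M)
→ θ(N), comparing constant and linear coefficients in the commutation relations shows that its
constant term is homotopic to some T ⊕ S (`MF.exists_homotopic_constantCoeff`). What remains has
entries in (x, y). As x, y is a regular sequence and both act as zero up to homotopy on θ(N), this
remainder is null-homotopic (`MF.null_of_regular`).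

For essential surjectivity, differentiate ψφ = φψ = xy - p with respect to y: multiplication by x is
null-homotopic on every factorization Y of xy - p (`MF.null_scal_X_zero`). Hence Y is a retract of
the Knörrer object built from its reduction modulo x (`MF.nonempty_retract_thetaGen`). The same
lemma, applied to this reduction with the pair (y, 0), makes it a retract of the cone of y on a
factorization L with coefficients in A. After θ the map y becomes null-homotopic, so that cone
becomes the cone of a zero morphism, which is the image of a cone over A
(`MF.exists_retract_theta`). A fully faithful functor whose source is idempotent complete and whose
image has every object as a retract is an equivalence.

Over a complete local ring the homotopy category is idempotent complete
(`HMF.isIdempotentComplete`). On a minimal factorization null-homotopic maps vanish modulo the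
maximal ideal, so a homotopy idempotent is idempotent modulo that ideal. Newton's iteration lifts it
to a strict idempotent, conjugate to the given one up to homotopy, and strict idempotents split
because projective modules over a local ring are free. For later potentials idempotent completeness
is transported along the equivalences already obtained.

Triangles are handled on strict categories. θ and the sign change commute with translations and
cones by explicit signed permutations (`MF.ConeCompat`), and a fully faithful functor preserving
cone triangles also reflects distinguished ones, because a cone triangle is determined up to
isomorphism by its first morphism (`Tri.map_equiv_iff`).

For forms, θθ and θνθ commute with duality and anticommute with transposition of pairings
(`MF.DualCompat`), which exchanges the two signs. To lift a form, replace the preimage of the object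
by a minimal model, transport the pairing to it up to homotopy, and symmetrize using 1/2. The
resulting homotopy equivalence between minimal factorizations is a strict isomorphism
(`MF.exists_form`), hence a form. -/

theorem isIso_of_comp_isIso {C : Type*} [Category C] {X Y : C} (f : X ⟶ Y) (g : Y ⟶ X)
    [IsIso (f ≫ g)] [IsIso (g ≫ f)] : IsIso f := by
  have : Mono f := mono_of_mono f g
  have : IsSplitEpi f := IsSplitEpi.mk' ⟨inv (g ≫ f) ≫ g, by simp⟩
  exact isIso_of_mono_of_isSplitEpi f

namespace HMF

variable {B : Type u} [CommRing B] {w : B}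

theorem proj_map_eq_iff {M N : MF w} (f g : M ⟶ N) :
    (proj w).map f = (proj w).map g ↔ MF.Homotopic f g :=
  Quotient.functor_map_eq_iff _ f g

theorem exists_proj_map {M N : MF w} (f : (proj w).obj M ⟶ (proj w).obj N) :
    ∃ f₀ : M ⟶ N, (proj w).map f₀ = f :=
  (proj w).map_surjective f

instance : (proj w).Additive := ⟨rfl⟩

end HMF

namespace BlockAux

variable {B : Type u} [CommRing B] {m n m' n' l k : Type} [Fintype n] [Fintype m']
  [Fintype n'] [DecidableEq n]

theorem snd_mul_fromBlocks [DecidableEq n'] (P : Matrix m' m B) (T : Matrix m' n B) (Q : Matrix n'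
    n B) :
    snd B m' n' * Matrix.fromBlocks P T 0 Q = Q * snd B m n := by
  unfold snd
  rw [Matrix.fromCols_mul_fromBlocks, Matrix.mul_fromCols]; simp

/-- The homotopy (h, h') of the restriction to the first summand is extended by zero to the second;
subtracting its boundary kills the first column and changes the second by h'T. -/
theorem fromCols_factor_snd [Fintype k] {p : Matrix l k B} {h : Matrix k m B} {h' : Matrix l m' B}
    {P : Matrix m' m B} {T : Matrix m' n B} {Q : Matrix n' n B} {g₁ : Matrix l m B}
    {g₂ : Matrix l n B} (e : g₁ = p * h + h' * P) :
    Matrix.fromCols g₁ g₂ = (g₂ - h' * T) * snd B m n + (p * Matrix.fromCols h (0 : Matrix k n B) +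
      Matrix.fromCols h' (0 : Matrix l n' B) * Matrix.fromBlocks P T 0 Q) := by
  unfold snd
  rw [Matrix.mul_fromCols, Matrix.fromCols_mul_fromBlocks, Matrix.mul_fromCols, e]
  ext i (j | j) <;> simp

end BlockAux

namespace MF

variable {B : Type u} [CommRing B] {w : B}

@[simp] theorem sub_S {M N : MF w} (f g : M ⟶ N) : (f - g).S = f.S - g.S := by
  rw [sub_eq_add_neg, add_S, neg_S, sub_eq_add_neg]
@[simp] theorem sub_T {M N : MF w} (f g : M ⟶ N) : (f - g).T = f.T - g.T := by
  rw [sub_eq_add_neg, add_T, neg_T, sub_eq_add_neg]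

/-- Null-homotopy of a strict morphism. -/
def Null {M N : MF w} (f : M ⟶ N) : Prop :=
  ∃ (h₀ : Matrix N.ι₁ M.ι₀ B) (h₁ : Matrix N.ι₀ M.ι₁ B),
    f.S = N.ψ * h₀ + h₁ * M.φ ∧ f.T = N.φ * h₁ + h₀ * M.ψ

theorem homotopic_iff_null {M N : MF w} (f g : M ⟶ N) : Homotopic f g ↔ Null (f - g) := by
  simp only [Homotopic, Null, sub_S, sub_T, sub_eq_iff_eq_add']

theorem proj_map_eq_zero_iff {M N : MF w} (f : M ⟶ N) :
    (HMF.proj w).map f = 0 ↔ Null f := by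
  rw [← (HMF.proj w).map_zero, HMF.proj_map_eq_iff, homotopic_iff_null, sub_zero]

/-! ### Morphisms of cones -/

/-- The morphism of cones attached to a square that commutes up to a given homotopy. -/
def coneMap {M N M' N' : MF w} {f : M ⟶ N} {f' : M' ⟶ N'} (a : M ⟶ M') (b : N ⟶ N')
    (h₀ : Matrix N'.ι₁ M.ι₀ B) (h₁ : Matrix N'.ι₀ M.ι₁ B)
    (e₀ : (f ≫ b).S = (a ≫ f').S + (N'.ψ * h₀ + h₁ * M.φ))
    (e₁ : (f ≫ b).T = (a ≫ f').T + (N'.φ * h₁ + h₀ * M.ψ)) : cone f ⟶ cone f' where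
  S := Matrix.fromBlocks b.S h₁ 0 a.T
  T := Matrix.fromBlocks b.T h₀ 0 a.S
  φ_comm := by
    simp only [comp_S, comp_T] at e₀ e₁
    change Matrix.fromBlocks N'.φ f'.T 0 (-M'.ψ) * Matrix.fromBlocks b.S h₁ 0 a.T =
      Matrix.fromBlocks b.T h₀ 0 a.S * Matrix.fromBlocks N.φ f.T 0 (-M.ψ)
    simp only [Matrix.fromBlocks_multiply, Matrix.mul_zero, Matrix.zero_mul, add_zero, zero_add,
      b.φ_comm, e₁, Matrix.neg_mul, Matrix.mul_neg, a.ψ_comm]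
    congr 1; abel
  ψ_comm := by
    simp only [comp_S, comp_T] at e₀ e₁
    change Matrix.fromBlocks N'.ψ f'.S 0 (-M'.φ) * Matrix.fromBlocks b.T h₀ 0 a.S =
      Matrix.fromBlocks b.S h₁ 0 a.T * Matrix.fromBlocks N.ψ f.S 0 (-M.φ)
    simp only [Matrix.fromBlocks_multiply, Matrix.mul_zero, Matrix.zero_mul, add_zero, zero_add,
      b.ψ_comm, e₀, Matrix.neg_mul, Matrix.mul_neg, a.φ_comm]
    congr 1; abel

section

variable {M N M' N' : MF w} {f : M ⟶ N} {f' : M' ⟶ N'} (a : M ⟶ M') (b : N ⟶ N')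
    (h₀ : Matrix N'.ι₁ M.ι₀ B) (h₁ : Matrix N'.ι₀ M.ι₁ B)
    (e₀ : (f ≫ b).S = (a ≫ f').S + (N'.ψ * h₀ + h₁ * M.φ))
    (e₁ : (f ≫ b).T = (a ≫ f').T + (N'.φ * h₁ + h₀ * M.ψ))

theorem coneInl_coneMap : coneInl f ≫ coneMap a b h₀ h₁ e₀ e₁ = b ≫ coneInl f' := by
  apply hom_ext
  · change Matrix.fromBlocks b.S h₁ 0 a.T * Matrix.fromRows 1 0 = Matrix.fromRows 1 0 * b.S
    rw [Matrix.fromBlocks_mul_fromRows, Matrix.fromRows_mul]; simp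
  · change Matrix.fromBlocks b.T h₀ 0 a.S * Matrix.fromRows 1 0 = Matrix.fromRows 1 0 * b.T
    rw [Matrix.fromBlocks_mul_fromRows, Matrix.fromRows_mul]; simp

theorem coneMap_coneSnd :
    coneMap a b h₀ h₁ e₀ e₁ ≫ coneSnd f' = coneSnd f ≫ shift.map a :=
  hom_ext (BlockAux.snd_mul_fromBlocks _ _ _) (BlockAux.snd_mul_fromBlocks _ _ _)

end

/-- A morphism out of a cone that vanishes on the first summand up to homotopy factors through the
projection to the second. -/
theorem exists_factor_coneSnd {M N X : MF w} {f : M ⟶ N} (g : cone f ⟶ X)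
    (hg : Null (coneInl f ≫ g)) : ∃ v : shift.obj M ⟶ X, Homotopic g (coneSnd f ≫ v) := by
  obtain ⟨h₀, h₁, e₀, e₁⟩ := hg
  obtain ⟨g₁, g₂, hS⟩ : ∃ (g₁ : Matrix X.ι₀ N.ι₀ B) (g₂ : Matrix X.ι₀ M.ι₁ B),
    g.S = Matrix.fromCols g₁ g₂ := ⟨_, _, (Matrix.fromCols_toCols g.S).symm⟩
  obtain ⟨k₁, k₂, hT⟩ : ∃ (k₁ : Matrix X.ι₁ N.ι₁ B) (k₂ : Matrix X.ι₁ M.ι₀ B),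
    g.T = Matrix.fromCols k₁ k₂ := ⟨_, _, (Matrix.fromCols_toCols g.T).symm⟩
  have e₀' : g₁ = X.ψ * h₀ + h₁ * N.φ := by
    rw [← e₀]
    change g₁ = g.S * Matrix.fromRows 1 0
    rw [hS, Matrix.fromCols_mul_fromRows]; simp
  have e₁' : k₁ = X.φ * h₁ + h₀ * N.ψ := by
    rw [← e₁]
    change k₁ = g.T * Matrix.fromRows 1 0
    rw [hT, Matrix.fromCols_mul_fromRows]; simp
  have hφ : X.φ * g.S = g.T * Matrix.fromBlocks N.φ f.T 0 (-M.ψ) := g.φ_comm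
  have hψ : X.ψ * g.T = g.S * Matrix.fromBlocks N.ψ f.S 0 (-M.φ) := g.ψ_comm
  rw [hS, hT, Matrix.mul_fromCols, Matrix.fromCols_mul_fromBlocks] at hφ hψ
  obtain ⟨-, hφ⟩ := Matrix.fromCols_inj hφ
  obtain ⟨-, hψ⟩ := Matrix.fromCols_inj hψ
  -- The homotopy on N, extended by zero to M[1], is subtracted from g; what is left lives on M[1]
  -- only.
  refine ⟨⟨g₂ - h₁ * f.T, k₂ - h₀ * f.S, ?_, ?_⟩, Matrix.fromCols h₀ 0, Matrix.fromCols h₁ 0,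
    ?_, ?_⟩
  · change X.φ * (g₂ - h₁ * f.T) = (k₂ - h₀ * f.S) * -M.ψ
    rw [Matrix.mul_sub, hφ, e₁', Matrix.sub_mul, Matrix.mul_neg, Matrix.mul_neg,
        Matrix.mul_assoc h₀,
      ← f.ψ_comm, Matrix.add_mul, Matrix.mul_assoc, Matrix.mul_assoc]
    abel
  · change X.ψ * (k₂ - h₀ * f.S) = (g₂ - h₁ * f.T) * -M.φ
    rw [Matrix.mul_sub, hψ, e₀', Matrix.sub_mul, Matrix.mul_neg, Matrix.mul_neg,
        Matrix.mul_assoc h₁,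
      ← f.φ_comm, Matrix.add_mul, Matrix.mul_assoc, Matrix.mul_assoc]
    abel
  · exact hS.trans (BlockAux.fromCols_factor_snd e₀')
  · exact hT.trans (BlockAux.fromCols_factor_snd e₁')

end MF

namespace HMF

variable {B : Type u} [CommRing B] {w : B}

/-- c - 1 kills the inclusion, so it factors through the projection, and composing c - 1 with the
projection gives zero. Thus c - 1 has square zero and c is unipotent. This replaces the five lemma.
-/
theorem isIso_cone_endo {M N : MF w} {f : M ⟶ N} (c : MF.cone f ⟶ MF.cone f)
    (h : (proj w).map (MF.coneInl f ≫ c) = (proj w).map (MF.coneInl f))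
    (h' : (proj w).map (c ≫ MF.coneSnd f) = (proj w).map (MF.coneSnd f)) :
    IsIso ((proj w).map c) := by
  obtain ⟨v, hv⟩ := MF.exists_factor_coneSnd (c - 𝟙 _) (f := f) <| by
    rw [← MF.proj_map_eq_zero_iff, Preadditive.comp_sub, Category.comp_id, Functor.map_sub, h,
      sub_self]
  rw [← proj_map_eq_iff] at hv
  have hsq : (proj w).map (c - 𝟙 _) ≫ (proj w).map (c - 𝟙 _) = 0 := by
    nth_rw 2 [hv]
    rw [Functor.map_comp, ← Category.assoc, ← Functor.map_comp, Preadditive.sub_comp,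
      Functor.map_sub, Category.id_comp, h', sub_self, Limits.zero_comp]
  set n := (proj w).map (c - 𝟙 _) with hn
  have hc : (proj w).map c = 𝟙 _ + n := by
    rw [hn, Functor.map_sub, (proj w).map_id]; abel
  -- Since n² = 0, the inverse of 1 + n is 1 - n.
  refine ⟨𝟙 _ - n, ?_, ?_⟩ <;> rw [hc] <;>
    simp [Preadditive.add_comp, Preadditive.sub_comp, Preadditive.comp_sub, Preadditive.comp_add,
      hsq]

/-- The homotopy that makes the square commute supplies the off-diagonal block; the two
compatibilities then hold strictly. -/
theorem exists_coneMap {M N M' N' : MF w} {f : M ⟶ N} {f' : M' ⟶ N'} (a : M ⟶ M') (b : N ⟶ N')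
    (h : (proj w).map (f ≫ b) = (proj w).map (a ≫ f')) :
    ∃ c : MF.cone f ⟶ MF.cone f', MF.coneInl f ≫ c = b ≫ MF.coneInl f' ∧
      c ≫ MF.coneSnd f' = MF.coneSnd f ≫ MF.shift.map a := by
  obtain ⟨h₀, h₁, e₀, e₁⟩ := (proj_map_eq_iff _ _).1 h
  exact ⟨MF.coneMap a b h₀ h₁ e₀ e₁, MF.coneInl_coneMap .., MF.coneMap_coneSnd ..⟩

/-- Isomorphic morphisms in the homotopy category have isomorphic cone triangles. -/
theorem exists_cone_iso {M N M' N' : MF w} {f : M ⟶ N} {f' : M' ⟶ N'}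
    (a : (proj w).obj M ≅ (proj w).obj M') (b : (proj w).obj N ≅ (proj w).obj N')
    (h : (proj w).map f ≫ b.hom = a.hom ≫ (proj w).map f') :
    ∃ c : (proj w).obj (MF.cone f) ≅ (proj w).obj (MF.cone f'),
      (proj w).map (MF.coneInl f) ≫ c.hom = b.hom ≫ (proj w).map (MF.coneInl f') ∧
      c.hom ≫ projConeSnd f' = projConeSnd f ≫ (shift w).map a.hom := by
  obtain ⟨a₀, ha⟩ := exists_proj_map a.hom
  obtain ⟨b₀, hb⟩ := exists_proj_map b.hom
  obtain ⟨a₁, ha'⟩ := exists_proj_map a.inv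
  obtain ⟨b₁, hb'⟩ := exists_proj_map b.inv
  have h' : (proj w).map f' ≫ b.inv = a.inv ≫ (proj w).map f := by
    rw [Iso.comp_inv_eq, Category.assoc, h, Iso.inv_hom_id_assoc]
  obtain ⟨c, hc₁, hc₂⟩ := exists_coneMap a₀ b₀ (f := f) (f' := f')
    (by rw [Functor.map_comp, Functor.map_comp, ha, hb, h])
  obtain ⟨c', hc₁', hc₂'⟩ := exists_coneMap a₁ b₁ (f := f') (f' := f)
    (by rw [Functor.map_comp, Functor.map_comp, ha', hb', h'])
  have hs : (proj w).map (MF.shift.map a₀ ≫ MF.shift.map a₁) = 𝟙 _ :=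
    (congrArg (shift w).map (show (proj w).map (a₀ ≫ a₁) = 𝟙 _ by
      rw [Functor.map_comp, ha, ha', Iso.hom_inv_id])).trans ((shift w).map_id _)
  have hs' : (proj w).map (MF.shift.map a₁ ≫ MF.shift.map a₀) = 𝟙 _ :=
    (congrArg (shift w).map (show (proj w).map (a₁ ≫ a₀) = 𝟙 _ by
      rw [Functor.map_comp, ha, ha', Iso.inv_hom_id])).trans ((shift w).map_id _)
  -- c and c' need not be mutually inverse, but both composites induce the identity on the two outer
  -- terms, so they are isomorphisms.
  have i₁ : IsIso ((proj w).map c ≫ (proj w).map c') := by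
    rw [← Functor.map_comp]
    apply isIso_cone_endo
    · rw [← Category.assoc, hc₁, Category.assoc, hc₁', Functor.map_comp, Functor.map_comp, hb, hb',
        Iso.hom_inv_id_assoc]
    · rw [Category.assoc, hc₂', ← Category.assoc, hc₂, Category.assoc, Functor.map_comp, hs,
        Category.comp_id]
  have i₂ : IsIso ((proj w).map c' ≫ (proj w).map c) := by
    rw [← Functor.map_comp]
    apply isIso_cone_endo
    · rw [← Category.assoc, hc₁', Category.assoc, hc₁, Functor.map_comp, Functor.map_comp, hb, hb',
        Iso.inv_hom_id_assoc]
    · rw [Category.assoc, hc₂, ← Category.assoc, hc₂',  Category.assoc, Functor.map_comp,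
        hs', Category.comp_id]
  have := isIso_of_comp_isIso ((proj w).map c) ((proj w).map c')
  refine ⟨asIso ((proj w).map c), ?_, ?_⟩
  · rw [asIso_hom, ← hb, ← Functor.map_comp, ← Functor.map_comp, hc₁]
  · rw [asIso_hom, ← ha]
    exact congrArg (proj w).map hc₂

end HMF

/-! ### Isomorphic triangles -/

namespace Tri

variable {C : Type*} [Category C] {T : C ⥤ C} {D : Type*} [Category D] {T' : D ⥤ D}

/-- Isomorphism of triangles. -/
def Equiv (t t' : Tri T) : Prop :=
  ∃ (e₁ : t.obj₁ ≅ t'.obj₁) (e₂ : t.obj₂ ≅ t'.obj₂) (e₃ : t.obj₃ ≅ t'.obj₃),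
    t.mor₁ ≫ e₂.hom = e₁.hom ≫ t'.mor₁ ∧ t.mor₂ ≫ e₃.hom = e₂.hom ≫ t'.mor₂ ∧
    t.mor₃ ≫ T.map e₁.hom = e₃.hom ≫ t'.mor₃

theorem Equiv.symm {t t' : Tri T} (h : t.Equiv t') : t'.Equiv t := by
  obtain ⟨e₁, e₂, e₃, h₁, h₂, h₃⟩ := h
  refine ⟨e₁.symm, e₂.symm, e₃.symm, ?_, ?_, ?_⟩
  · rw [Iso.symm_hom, Iso.symm_hom, Iso.comp_inv_eq, Category.assoc, h₁, Iso.inv_hom_id_assoc]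
  · rw [Iso.symm_hom, Iso.symm_hom, Iso.comp_inv_eq, Category.assoc, h₂, Iso.inv_hom_id_assoc]
  · rw [Iso.symm_hom, Iso.symm_hom, Iso.eq_inv_comp, ← Category.assoc, ← h₃, Category.assoc,
      ← T.map_comp, Iso.hom_inv_id, T.map_id, Category.comp_id]

theorem Equiv.trans {t t' t'' : Tri T} (h : t.Equiv t') (h' : t'.Equiv t'') : t.Equiv t'' := by
  obtain ⟨e₁, e₂, e₃, h₁, h₂, h₃⟩ := h
  obtain ⟨d₁, d₂, d₃, k₁, k₂, k₃⟩ := h'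
  refine ⟨e₁ ≪≫ d₁, e₂ ≪≫ d₂, e₃ ≪≫ d₃, ?_, ?_, ?_⟩
  · rw [Iso.trans_hom, Iso.trans_hom, reassoc_of% h₁, k₁, Category.assoc]
  · rw [Iso.trans_hom, Iso.trans_hom, reassoc_of% h₂, k₂, Category.assoc]
  · rw [Iso.trans_hom, Iso.trans_hom, T.map_comp, reassoc_of% h₃, k₃, Category.assoc]

theorem Equiv.map {t t' : Tri T} (h : t.Equiv t') (F : C ⥤ D) (η : T ⋙ F ≅ F ⋙ T') :
    (t.map F η).Equiv (t'.map F η) := by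
  obtain ⟨e₁, e₂, e₃, h₁, h₂, h₃⟩ := h
  refine ⟨F.mapIso e₁, F.mapIso e₂, F.mapIso e₃, ?_, ?_, ?_⟩
  · exact (F.map_comp _ _).symm.trans ((congrArg F.map h₁).trans (F.map_comp _ _))
  · exact (F.map_comp _ _).symm.trans ((congrArg F.map h₂).trans (F.map_comp _ _))
  · have n := η.hom.naturality e₁.hom
    simp only [Functor.comp_map] at n
    simp only [Tri.map, Functor.mapIso_hom, Category.assoc]
    rw [← n, ← F.map_comp_assoc, h₃, F.map_comp_assoc]

/-- A fully faithful functor that preserves a class of standard triangles reflects triangles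
isomorphic to standard ones, provided that standard triangles are determined by their first
morphism. -/
theorem map_equiv_iff (F : C ⥤ D) [F.Full] [F.Faithful] (η : T ⋙ F ≅ F ⋙ T') {K : Set (Tri T)}
    {K' : Set (Tri T')} (hex : ∀ (X Y : C) (f : X ⟶ Y), ∃ Z g h, Tri.mk X Y Z f g h ∈ K)
    (hF : ∀ s ∈ K, ∃ s' ∈ K', (s.map F η).Equiv s')
    (huniq : ∀ s ∈ K', ∀ s' ∈ K', ∀ (e₁ : s.obj₁ ≅ s'.obj₁) (e₂ : s.obj₂ ≅ s'.obj₂),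
      s.mor₁ ≫ e₂.hom = e₁.hom ≫ s'.mor₁ → ∃ e₃ : s.obj₃ ≅ s'.obj₃,
        s.mor₂ ≫ e₃.hom = e₂.hom ≫ s'.mor₂ ∧ s.mor₃ ≫ T'.map e₁.hom = e₃.hom ≫ s'.mor₃)
    (t : Tri T) : (∃ s' ∈ K', (t.map F η).Equiv s') ↔ ∃ s ∈ K, t.Equiv s := by
  constructor
  · rintro ⟨s', hs', h⟩
    obtain ⟨X, Y, Z, f, g, k⟩ := t
    -- The first morphism of t is completed to a standard triangle; its image and the image of t are
    -- then two triangles on the same first morphism, each isomorphic to a standard one, and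
    -- uniqueness compares them.
    obtain ⟨Z', g', k', hs⟩ := hex X Y f
    obtain ⟨s, hsK, d₁, d₂, d₃, k₁, k₂, k₃⟩ := hF _ hs
    obtain ⟨e₁, e₂, e₃, h₁, h₂, h₃⟩ := h
    simp only [Tri.map] at d₁ d₂ d₃ k₁ k₂ k₃ e₁ e₂ e₃ h₁ h₂ h₃
    obtain ⟨c, hc, hc'⟩ := huniq s hsK s' hs' (d₁.symm ≪≫ e₁) (d₂.symm ≪≫ e₂) (by
      simp only [Iso.trans_hom, Iso.symm_hom, Category.assoc]
      rw [Iso.eq_inv_comp, ← reassoc_of% k₁, Iso.hom_inv_id_assoc, h₁])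
    simp only [Iso.trans_hom, Iso.symm_hom, Functor.map_comp] at hc hc'
    refine ⟨_, hs, Equiv.symm ⟨Iso.refl _, Iso.refl _, F.preimageIso (d₃ ≪≫ c ≪≫ e₃.symm), ?_, ?_,
      ?_⟩⟩
    · simp
    · apply F.map_injective
      simp only [Functor.map_comp, Functor.preimageIso_hom, Functor.map_preimage, Iso.trans_hom,
        Iso.symm_hom, Iso.refl_hom, Category.id_comp]
      rw [reassoc_of% k₂, reassoc_of% hc, ← reassoc_of% h₂, Iso.hom_inv_id_assoc,
        Iso.hom_inv_id, Category.comp_id]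
    · apply F.map_injective
      -- Composing with these two isomorphisms turns the goal into the third commuting squares,
      -- which are only known after η and the translate of e₁.
      rw [← cancel_mono (η.hom.app X), ← cancel_mono (T'.map e₁.hom)]
      simp only [Functor.map_comp, Functor.preimageIso_hom, Functor.map_preimage, Iso.trans_hom,
        Iso.symm_hom, Iso.refl_hom, T.map_id, F.map_id, Category.id_comp, Category.assoc]
      simp only [Category.assoc] at h₃ k₃
      rw [h₃, Iso.inv_hom_id_assoc, ← hc', ← reassoc_of% k₃, ← T'.map_comp_assoc, Iso.hom_inv_id,
        T'.map_id, Category.id_comp]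
  · rintro ⟨s, hs, h⟩
    obtain ⟨s', hs', h'⟩ := hF s hs
    exact ⟨s', hs', (h.map F η).trans h'⟩

end Tri

/-! ### Functors compatible with cones -/

namespace MF

variable {B : Type u} [CommRing B] {w : B} {B' : Type u} [CommRing B'] {w' : B'}
  {B'' : Type u} [CommRing B''] {w'' : B''}

/-- Compatibility of a functor between strict categories with translations and cone triangles. -/
structure ConeCompat (F : MF w ⥤ MF w') where
  /-- the comparison of translations -/
  σ : ∀ M : MF w, F.obj (shift.obj M) ≅ shift.obj (F.obj M)
  σ_naturality : ∀ {M N : MF w} (f : M ⟶ N),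
    F.map (shift.map f) ≫ (σ N).hom = (σ M).hom ≫ shift.map (F.map f)
  /-- the comparison of cones -/
  κ : ∀ {M N : MF w} (f : M ⟶ N), F.obj (cone f) ≅ cone (F.map f)
  inl_κ : ∀ {M N : MF w} (f : M ⟶ N), F.map (coneInl f) ≫ (κ f).hom = coneInl (F.map f)
  κ_snd : ∀ {M N : MF w} (f : M ⟶ N),
    (κ f).hom ≫ coneSnd (F.map f) = F.map (coneSnd f) ≫ (σ M).hom

/-- Compatibility with cones is stable under composition. -/
def ConeCompat.comp {F : MF w ⥤ MF w'} {G : MF w' ⥤ MF w''} (hF : ConeCompat F)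
    (hG : ConeCompat G) : ConeCompat (F ⋙ G) where
  σ M := G.mapIso (hF.σ M) ≪≫ hG.σ (F.obj M)
  σ_naturality f := by
    change G.map (F.map (shift.map f)) ≫ G.map _ ≫ _ = (G.map _ ≫ _) ≫ shift.map (G.map (F.map f))
    rw [← Category.assoc, ← G.map_comp, hF.σ_naturality, G.map_comp, Category.assoc,
      hG.σ_naturality, Category.assoc]
  κ f := G.mapIso (hF.κ f) ≪≫ hG.κ (F.map f)
  inl_κ f := by
    change G.map (F.map (coneInl f)) ≫ G.map _ ≫ _ = coneInl (G.map (F.map f))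
    rw [← Category.assoc, ← G.map_comp, hF.inl_κ, hG.inl_κ]
  κ_snd {M N} f := by
    change (G.map _ ≫ _) ≫ coneSnd (G.map (F.map f)) = G.map (F.map (coneSnd f)) ≫ G.map _ ≫ _
    rw [Category.assoc, hG.κ_snd, ← Category.assoc, ← Category.assoc, ← G.map_comp, hF.κ_snd,
      G.map_comp]

end MF

namespace HMF

variable {B : Type u} [CommRing B] {w : B} {B' : Type u} [CommRing B'] {w' : B'}

theorem lift_proj_map (F : MF w ⥤ MF w')
    (hF : ∀ (M N : MF w) (f g : M ⟶ N), MF.Homotopic f g → MF.Homotopic (F.map f) (F.map g))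
    {M N : MF w} (f : M ⟶ N) : (lift F hF).map ((proj w).map f) = (proj w').map (F.map f) := rfl

theorem lift_additive (F : MF w ⥤ MF w') [F.Additive]
    (hF : ∀ (M N : MF w) (f g : M ⟶ N), MF.Homotopic f g → MF.Homotopic (F.map f) (F.map g)) :
    (lift F hF).Additive where
  map_add {X Y f g} := by
    obtain ⟨f, rfl⟩ := exists_proj_map f
    obtain ⟨g, rfl⟩ := exists_proj_map g
    rw [← Functor.map_add, lift_proj_map, F.map_add]
    rfl

/-- The comparison of translations in the homotopy categories. -/
def shiftComm {F : MF w ⥤ MF w'} (h : MF.ConeCompat F)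
    (hF : ∀ (M N : MF w) (f g : M ⟶ N), MF.Homotopic f g → MF.Homotopic (F.map f) (F.map g)) :
    shift w ⋙ lift F hF ≅ lift F hF ⋙ shift w' :=
  NatIso.ofComponents (fun X => (proj w').mapIso (h.σ X.as)) (by
    intro X Y f
    obtain ⟨f, rfl⟩ := exists_proj_map f
    exact congrArg (proj w').map (h.σ_naturality f))

/-- The triangle `M ⟶ N ⟶ cone f ⟶ M[1]`. -/
def coneTri {M N : MF w} (f : M ⟶ N) : Tri (shift w) where
  obj₁ := (proj w).obj M
  obj₂ := (proj w).obj N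
  obj₃ := (proj w).obj (MF.cone f)
  mor₁ := (proj w).map f
  mor₂ := (proj w).map (MF.coneInl f)
  mor₃ := projConeSnd f

/-- Puts distinguished triangles in the shape required by `Tri.map_equiv_iff`, with the cone
triangles as standard class. -/
theorem mem_distTriangles_iff (t : Tri (shift w)) :
    t ∈ distTriangles w ↔ ∃ s ∈ {s | ∃ (M N : MF w) (f : M ⟶ N), s = coneTri f}, t.Equiv s := by
  constructor
  · rintro ⟨M, N, f, h⟩
    exact ⟨_, ⟨M, N, f, rfl⟩, h⟩
  · rintro ⟨_, ⟨M, N, f, rfl⟩, h⟩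
    exact ⟨M, N, f, h⟩

theorem coneTri_map_equiv {F : MF w ⥤ MF w'}
    (hF : ∀ (M N : MF w) (f g : M ⟶ N), MF.Homotopic f g → MF.Homotopic (F.map f) (F.map g))
    (h : MF.ConeCompat F) {M N : MF w} (f : M ⟶ N) :
    ((coneTri f).map (lift F hF) (shiftComm h hF)).Equiv (coneTri (F.map f)) := by
  refine ⟨Iso.refl _, Iso.refl _, (proj w').mapIso (h.κ f), ?_, ?_, ?_⟩
  · exact (Category.comp_id _).trans (Category.id_comp _).symm
  · exact (congrArg (proj w').map (h.inl_κ f)).trans (Category.id_comp _).symm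
  · exact ((congrArg _ ((shift w').map_id _)).trans (Category.comp_id _)).trans
      (congrArg (proj w').map (h.κ_snd f).symm)

/-- Only cone triangles have to be compared: preservation comes from `MF.ConeCompat`, and uniqueness
of the cone in the target from `exists_cone_iso`. -/
theorem isTriangleEquivalence_lift (F : MF w ⥤ MF w') [F.Additive]
    (hF : ∀ (M N : MF w) (f g : M ⟶ N), MF.Homotopic f g → MF.Homotopic (F.map f) (F.map g))
    (h : MF.ConeCompat F) (hE : (lift F hF).IsEquivalence) :
    IsTriangleEquivalence (distTriangles w) (distTriangles w') (lift F hF) := by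
  refine ⟨hE, lift_additive F hF, shiftComm h hF, fun t => ?_⟩
  rw [mem_distTriangles_iff, mem_distTriangles_iff]
  apply Tri.map_equiv_iff
  · intro X Y f
    obtain ⟨f, rfl⟩ := exists_proj_map (M := X.as) (N := Y.as) f
    exact ⟨_, _, _, X.as, Y.as, f, rfl⟩
  · rintro _ ⟨M, N, f, rfl⟩
    exact ⟨_, ⟨_, _, F.map f, rfl⟩, coneTri_map_equiv hF h f⟩
  · rintro _ ⟨M, N, f, rfl⟩ _ ⟨M', N', f', rfl⟩ e₁ e₂ h
    obtain ⟨c, hc, hc'⟩ := exists_cone_iso e₁ e₂ h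
    exact ⟨c, hc, hc'.symm⟩

end HMF

/-! ### Composition of triangle equivalences. -/

section Composition

variable {C : Type*} [Category C] [Preadditive C] {T : C ⥤ C} {dist : Set (Tri T)}
  {D : Type*} [Category D] [Preadditive D] {T' : D ⥤ D} {dist' : Set (Tri T')}
  {E : Type*} [Category E] [Preadditive E] {T'' : E ⥤ E} {dist'' : Set (Tri T'')}

/-- Triangle equivalences compose. -/
theorem IsTriangleEquivalence.comp {F : C ⥤ D} {G : D ⥤ E} (hF : IsTriangleEquivalence dist dist' F)
    (hG : IsTriangleEquivalence dist' dist'' G) : IsTriangleEquivalence dist dist'' (F ⋙ G) := by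
  obtain ⟨e₁, a₁, η₁, h₁⟩ := hF
  obtain ⟨e₂, a₂, η₂, h₂⟩ := hG
  let η : T ⋙ F ⋙ G ≅ (F ⋙ G) ⋙ T'' := NatIso.ofComponents
    (fun X => G.mapIso (η₁.app X) ≪≫ η₂.app (F.obj X)) (by
      intro X Y f
      have n₁ := η₁.hom.naturality f
      have n₂ := η₂.hom.naturality (F.map f)
      simp only [Functor.comp_map] at n₁ n₂
      simp only [Functor.comp_map, Iso.trans_hom, Functor.mapIso_hom, Iso.app_hom]
      rw [← Category.assoc, ← G.map_comp, n₁, G.map_comp, Category.assoc, n₂, Category.assoc])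
  refine ⟨inferInstance, inferInstance, η, fun t => ?_⟩
  rw [← h₁, ← h₂]
  have : Tri.map (F ⋙ G) η t = Tri.map G η₂ (Tri.map F η₁ t) := by
    simp only [Tri.map, Functor.comp_map, Functor.map_comp, η, NatIso.ofComponents_hom_app,
      Iso.trans_hom, Functor.mapIso_hom, Iso.app_hom, Category.assoc]
    rfl
  rw [this]

end Composition

/-! ### Base change -/

namespace MF

variable {A : Type u} [CommRing A] {p : A} {B : Type u} [CommRing B] {w : B}

/-- Base change of a matrix factorization along a ring homomorphism. -/
abbrev baseChangeObj (π : A →+* B) (h : w = π p) (M : MF p) : MF w where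
  ι₀ := M.ι₀
  ι₁ := M.ι₁
  φ := M.φ.map π
  ψ := M.ψ.map π
  φ_mul_ψ := by
    rw [← Matrix.map_mul, M.φ_mul_ψ, h]
    ext i j; by_cases e : i = j <;> simp [e]
  ψ_mul_φ := by
    rw [← Matrix.map_mul, M.ψ_mul_φ, h]
    ext i j; by_cases e : i = j <;> simp [e]

/-- Base change along a ring homomorphism. -/
def baseChange (π : A →+* B) (h : w = π p) : MF p ⥤ MF w where
  obj M := baseChangeObj π h M
  map f :=
    { S := f.S.map π
      T := f.T.map π
      φ_comm := by rw [← Matrix.map_mul, f.φ_comm, Matrix.map_mul]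
      ψ_comm := by rw [← Matrix.map_mul, f.ψ_comm, Matrix.map_mul] }
  map_id M := hom_ext (Matrix.map_one _ (map_zero _) (map_one _))
    (Matrix.map_one _ (map_zero _) (map_one _))
  map_comp _ _ := hom_ext Matrix.map_mul Matrix.map_mul

instance (π : A →+* B) (h : w = π p) : (baseChange π h).Additive where
  map_add {_ _ _ _} := hom_ext (Matrix.map_add _ (map_add _) _ _) (Matrix.map_add _ (map_add _) _ _)

theorem map_neg_ringHom (π : A →+* B) {m n : Type} (P : Matrix m n A) :
    (-P).map π = -P.map π := by
  ext; simp

theorem map_fromBlocks_cone (π : A →+* B) {m n m' n' : Type} (P : Matrix m m' A) (T : Matrix m n' A)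
    (Q : Matrix n n' A) : (Matrix.fromBlocks P T 0 (-Q)).map π =
      Matrix.fromBlocks (P.map π) (T.map π) 0 (-Q.map π) := by
  rw [Matrix.fromBlocks_map, map_neg_ringHom, Matrix.map_zero _ (map_zero _)]

/-- The factor 1 is the comparison of cones for base change, which has identity components. -/
theorem map_inl (π : A →+* B) {m n : Type} [DecidableEq m] [Fintype m] [Fintype n] [DecidableEq n] :
    (1 : Matrix (m ⊕ n) (m ⊕ n) B) * (BlockAux.inl A m n).map π = BlockAux.inl B m n := by
  rw [Matrix.one_mul]
  ext (i | i) j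
  · by_cases e : i = j <;> simp [BlockAux.inl, e]
  · simp [BlockAux.inl]

theorem map_snd (π : A →+* B) {m n : Type} [DecidableEq m] [Fintype m] [Fintype n] [DecidableEq n] :
    BlockAux.snd B m n * (1 : Matrix (m ⊕ n) (m ⊕ n) B) =
      (1 : Matrix n n B) * (BlockAux.snd A m n).map π := by
  rw [Matrix.one_mul, Matrix.mul_one]
  ext i (j | j)
  · simp [BlockAux.snd]
  · by_cases e : i = j <;> simp [BlockAux.snd, e]

/-- Base change is compatible with cones. -/
def baseChangeCone (π : A →+* B) (h : w = π p) : ConeCompat (baseChange π h) where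
  σ M := isoMk (M := baseChangeObj π h M.shiftObj) (N := (baseChangeObj π h M).shiftObj)
    ⟨(1 : Matrix M.ι₁ M.ι₁ B), (1 : Matrix M.ι₀ M.ι₀ B),
      BlockAux.one_comm (map_neg_ringHom π M.ψ).symm,
      BlockAux.one_comm (map_neg_ringHom π M.φ).symm⟩
    (1 : Matrix M.ι₁ M.ι₁ B) (1 : Matrix M.ι₀ M.ι₀ B)
    (Matrix.one_mul _) (Matrix.one_mul _) (Matrix.one_mul _) (Matrix.one_mul _)
  σ_naturality _ := hom_ext ((Matrix.one_mul _).trans (Matrix.mul_one _).symm)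
    ((Matrix.one_mul _).trans (Matrix.mul_one _).symm)
  κ {M N} f := isoMk (M := baseChangeObj π h (cone f)) (N := cone ((baseChange π h).map f))
    ⟨(1 : Matrix (N.ι₀ ⊕ M.ι₁) (N.ι₀ ⊕ M.ι₁) B), (1 : Matrix (N.ι₁ ⊕ M.ι₀) (N.ι₁ ⊕ M.ι₀) B),
      BlockAux.one_comm (map_fromBlocks_cone π N.φ f.T M.ψ).symm,
      BlockAux.one_comm (map_fromBlocks_cone π N.ψ f.S M.φ).symm⟩
    (1 : Matrix (N.ι₀ ⊕ M.ι₁) (N.ι₀ ⊕ M.ι₁) B) (1 : Matrix (N.ι₁ ⊕ M.ι₀) (N.ι₁ ⊕ M.ι₀) B)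
    (Matrix.one_mul _) (Matrix.one_mul _) (Matrix.one_mul _) (Matrix.one_mul _)
  inl_κ _ := hom_ext (map_inl π) (map_inl π)
  κ_snd _ := hom_ext (map_snd π) (map_snd π)

/-! ### The Faltings–Knörrer functor over a fixed ring -/

section ThetaGen

variable {p x y w : B}

/-- `(P, Q) ↦ (x, P; Q, y)` over a fixed ring. -/
abbrev thetaGenObj (hw : w = x * y - p) (M : MF p) : MF w where
  ι₀ := M.ι₁ ⊕ M.ι₀
  ι₁ := M.ι₁ ⊕ M.ι₀
  φ := Matrix.fromBlocks (x • 1) M.φ M.ψ (y • 1)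
  ψ := Matrix.fromBlocks (y • 1) (-M.φ) (-M.ψ) (x • 1)
  φ_mul_ψ := BlockAux.theta_mul hw M.φ_mul_ψ M.ψ_mul_φ
  ψ_mul_φ := BlockAux.theta_mul' hw M.φ_mul_ψ M.ψ_mul_φ

theorem neg_comm {m n k l : Type} [Fintype n] [Fintype k] {P : Matrix m n B} {S : Matrix n l B}
    {T : Matrix m k B} {Q : Matrix k l B} (h : P * S = T * Q) : -P * S = T * -Q := by
  rw [Matrix.neg_mul, Matrix.mul_neg, h]

/-- The Faltings–Knörrer functor over a fixed ring. -/
def thetaGen (hw : w = x * y - p) : MF p ⥤ MF w where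
  obj M := thetaGenObj hw M
  map {M N} f :=
    { S := Matrix.fromBlocks f.T 0 0 f.S
      T := Matrix.fromBlocks f.T 0 0 f.S
      φ_comm := BlockAux.theta_comm _ _ f.φ_comm f.ψ_comm
      ψ_comm := BlockAux.theta_comm _ _ (neg_comm f.φ_comm) (neg_comm f.ψ_comm) }
  map_id _ := hom_ext Matrix.fromBlocks_one Matrix.fromBlocks_one
  map_comp _ _ := by
    apply hom_ext <;> simp [Matrix.fromBlocks_multiply]

instance (hw : w = x * y - p) : (thetaGen hw).Additive where
  map_add {M N f g} := by
    have key : ∀ (S S' : Matrix N.ι₀ M.ι₀ B) (T T' : Matrix N.ι₁ M.ι₁ B),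
        Matrix.fromBlocks (T + T') 0 0 (S + S') =
          Matrix.fromBlocks T 0 0 S + Matrix.fromBlocks T' 0 0 S' := by
      intros; simp [Matrix.fromBlocks_add]
    exact hom_ext (key _ _ _ _) (key _ _ _ _)

end ThetaGen

end MF

namespace BlockAux

variable {B : Type u} [CommRing B] {m₀ m₁ n₀ n₁ : Type}
  [Fintype m₀] [Fintype m₁] [Fintype n₀] [Fintype n₁]
  [DecidableEq m₀] [DecidableEq m₁] [DecidableEq n₀] [DecidableEq n₁]

/-- Translation replaces (φ, ψ) by (-ψ, -φ). The exchange of blocks puts x and y back in their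
places, and the sign is absorbed by using -`swap` in odd degree. -/
theorem theta_shift_comm (x y : B) (P : Matrix m₁ m₀ B) (Q : Matrix m₀ m₁ B) :
    -Matrix.fromBlocks (y • 1) (-P) (-Q) (x • 1) * swap B m₁ m₀ =
      -swap B m₁ m₀ * Matrix.fromBlocks (x • 1) (-Q) (-P) (y • 1) := by
  unfold swap
  rw [Matrix.neg_mul, Matrix.neg_mul, Matrix.fromBlocks_multiply, Matrix.fromBlocks_multiply]
  simp

theorem theta_shift_comm' (x y : B) (P : Matrix m₁ m₀ B) (Q : Matrix m₀ m₁ B) :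
    -Matrix.fromBlocks (x • 1) P Q (y • 1) * -swap B m₁ m₀ =
      swap B m₁ m₀ * Matrix.fromBlocks (y • 1) (- -Q) (- -P) (x • 1) := by
  unfold swap
  rw [neg_mul_neg', Matrix.fromBlocks_multiply, Matrix.fromBlocks_multiply]
  simp

theorem neg_swap_mul_neg_swap : -swap B m₀ m₁ * -swap B m₁ m₀ = 1 := by
  rw [neg_mul_neg', swap_mul_swap]

theorem swap_diag (S : Matrix n₀ m₀ B) (T : Matrix n₁ m₁ B) :
    swap B n₁ n₀ * Matrix.fromBlocks S 0 0 T = Matrix.fromBlocks T 0 0 S * swap B m₁ m₀ := by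
  unfold swap
  rw [Matrix.fromBlocks_multiply, Matrix.fromBlocks_multiply]
  simp

theorem neg_swap_diag (S : Matrix n₀ m₀ B) (T : Matrix n₁ m₁ B) :
    -swap B n₁ n₀ * Matrix.fromBlocks S 0 0 T = Matrix.fromBlocks T 0 0 S * -swap B m₁ m₀ := by
  rw [Matrix.neg_mul, Matrix.mul_neg, swap_diag]

variable (B m₀ m₁ n₀ n₁) in
/-- The permutation matrix `(n₁ ⊕ m₀) ⊕ (n₀ ⊕ m₁) → (n₁ ⊕ n₀) ⊕ (m₁ ⊕ m₀)`, with a sign on the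
second summand of the target. -/
def shuffle (s : ℤˣ) : Matrix ((n₁ ⊕ n₀) ⊕ (m₁ ⊕ m₀)) ((n₁ ⊕ m₀) ⊕ (n₀ ⊕ m₁)) B :=
  Matrix.fromBlocks (Matrix.fromBlocks 1 0 0 0) (Matrix.fromBlocks 0 0 1 0)
    (Matrix.fromBlocks 0 0 0 ((s : ℤ) • 1)) (Matrix.fromBlocks 0 ((s : ℤ) • 1) 0 0)

theorem shuffle_mul_transpose (s : ℤˣ) :
    shuffle B m₀ m₁ n₀ n₁ s * (shuffle B m₀ m₁ n₀ n₁ s).transpose = 1 := by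
  rcases Int.units_eq_one_or s with rfl | rfl <;>
  simp [shuffle, Matrix.fromBlocks_multiply, Matrix.fromBlocks_transpose, Matrix.fromBlocks_add]

theorem shuffle_transpose_mul (s : ℤˣ) :
    (shuffle B m₀ m₁ n₀ n₁ s).transpose * shuffle B m₀ m₁ n₀ n₁ s = 1 := by
  rcases Int.units_eq_one_or s with rfl | rfl <;>
  simp [shuffle, Matrix.fromBlocks_multiply, Matrix.fromBlocks_transpose, Matrix.fromBlocks_add]

/-- The two permutations differ by a sign on the summand M[1], in accordance with the pair (`swap`,
-`swap`) which compares the translations. -/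
theorem shuffle_comm (x y : B) (P : Matrix n₁ n₀ B) (Q : Matrix n₀ n₁ B) (P' : Matrix m₁ m₀ B)
    (Q' : Matrix m₀ m₁ B) (S : Matrix n₀ m₀ B) (T : Matrix n₁ m₁ B) :
    Matrix.fromBlocks (Matrix.fromBlocks (x • 1) P Q (y • 1)) (Matrix.fromBlocks T 0 0 S) 0
        (-Matrix.fromBlocks (y • 1) (-P') (-Q') (x • 1)) * shuffle B m₀ m₁ n₀ n₁ 1 =
      shuffle B m₀ m₁ n₀ n₁ (-1) * Matrix.fromBlocks (x • 1) (Matrix.fromBlocks P T 0 (-Q'))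
        (Matrix.fromBlocks Q S 0 (-P')) (y • 1) := by
  simp only [shuffle, ← Matrix.fromBlocks_one (l := n₁) (m := m₀),
    ← Matrix.fromBlocks_one (l := n₀) (m := m₁), Matrix.fromBlocks_smul]
  simp [Matrix.fromBlocks_multiply, Matrix.fromBlocks_add, Matrix.fromBlocks_neg]

theorem shuffle_comm' (x y : B) (P : Matrix n₁ n₀ B) (Q : Matrix n₀ n₁ B) (P' : Matrix m₁ m₀ B)
    (Q' : Matrix m₀ m₁ B) (S : Matrix n₀ m₀ B) (T : Matrix n₁ m₁ B) :
    Matrix.fromBlocks (Matrix.fromBlocks (y • 1) (-P) (-Q) (x • 1)) (Matrix.fromBlocks T 0 0 S) 0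
        (-Matrix.fromBlocks (x • 1) P' Q' (y • 1)) * shuffle B m₀ m₁ n₀ n₁ (-1) =
      shuffle B m₀ m₁ n₀ n₁ 1 * Matrix.fromBlocks (y • 1) (-Matrix.fromBlocks P T 0 (-Q'))
        (-Matrix.fromBlocks Q S 0 (-P')) (x • 1) := by
  simp only [shuffle, ← Matrix.fromBlocks_one (l := n₁) (m := m₀),
    ← Matrix.fromBlocks_one (l := n₀) (m := m₁), Matrix.fromBlocks_smul]
  simp [Matrix.fromBlocks_multiply, Matrix.fromBlocks_add, Matrix.fromBlocks_neg]

theorem shuffle_inl (s : ℤˣ) : shuffle B m₀ m₁ n₀ n₁ s *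
    Matrix.fromBlocks (inl B n₁ m₀) 0 0 (inl B n₀ m₁) = inl B (n₁ ⊕ n₀) (m₁ ⊕ m₀) := by
  have h : inl B (n₁ ⊕ n₀) (m₁ ⊕ m₀) =
    Matrix.fromRows (Matrix.fromBlocks 1 0 0 1) (Matrix.fromBlocks 0 0 0 0) := by simp [inl]
  have h' : Matrix.fromBlocks (inl B n₁ m₀) 0 0 (inl B n₀ m₁) =
    Matrix.fromRows (Matrix.fromBlocks 1 0 0 0) (Matrix.fromBlocks 0 1 0 0) := by
    ext ((i | i) | (i | i)) (j | j) <;> simp [inl]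
  rw [h, h', shuffle, Matrix.fromBlocks_mul_fromRows]
  simp [Matrix.fromBlocks_multiply, Matrix.fromBlocks_add]

/-- The third square of the cone comparison: on M[1] the shuffle restricts to the comparison of
translations, in even degree here and with the opposite sign in odd degree below. -/
theorem snd_shuffle : snd B (n₁ ⊕ n₀) (m₁ ⊕ m₀) * shuffle B m₀ m₁ n₀ n₁ 1 =
    swap B m₁ m₀ * Matrix.fromBlocks (snd B n₁ m₀) 0 0 (snd B n₀ m₁) := by
  rw [snd, shuffle, Matrix.fromCols_mul_fromBlocks, swap, Matrix.fromBlocks_multiply]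
  ext (i | i) ((j | j) | (j | j)) <;> simp [snd]

theorem snd_shuffle' : snd B (n₁ ⊕ n₀) (m₁ ⊕ m₀) * shuffle B m₀ m₁ n₀ n₁ (-1) =
    -swap B m₁ m₀ * Matrix.fromBlocks (snd B n₁ m₀) 0 0 (snd B n₀ m₁) := by
  rw [snd, shuffle, Matrix.fromCols_mul_fromBlocks, swap, Matrix.neg_mul,
    Matrix.fromBlocks_multiply]
  ext (i | i) ((j | j) | (j | j)) <;> simp [snd]

end BlockAux

namespace MF

variable {B : Type u} [CommRing B] {p x y w : B}

/-- The Faltings–Knörrer functor over a fixed ring is compatible with cones. -/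
def thetaGenCone (hw : w = x * y - p) : ConeCompat (thetaGen hw) where
  σ M := isoMk (M := thetaGenObj hw M.shiftObj) (N := (thetaGenObj hw M).shiftObj)
    ⟨BlockAux.swap B M.ι₁ M.ι₀, -BlockAux.swap B M.ι₁ M.ι₀,
      BlockAux.theta_shift_comm x y M.φ M.ψ, BlockAux.theta_shift_comm' x y M.φ M.ψ⟩
    (BlockAux.swap B M.ι₀ M.ι₁) (-BlockAux.swap B M.ι₀ M.ι₁)
    BlockAux.swap_mul_swap BlockAux.swap_mul_swap
    BlockAux.neg_swap_mul_neg_swap BlockAux.neg_swap_mul_neg_swap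
  σ_naturality f := hom_ext (BlockAux.swap_diag f.S f.T) (BlockAux.neg_swap_diag f.S f.T)
  κ {M N} f := isoMk (M := thetaGenObj hw (cone f)) (N := cone ((thetaGen hw).map f))
    ⟨BlockAux.shuffle B M.ι₀ M.ι₁ N.ι₀ N.ι₁ 1, BlockAux.shuffle B M.ι₀ M.ι₁ N.ι₀ N.ι₁ (-1),
      BlockAux.shuffle_comm x y N.φ N.ψ M.φ M.ψ f.S f.T,
      BlockAux.shuffle_comm' x y N.φ N.ψ M.φ M.ψ f.S f.T⟩
    (BlockAux.shuffle B M.ι₀ M.ι₁ N.ι₀ N.ι₁ 1).transpose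
    (BlockAux.shuffle B M.ι₀ M.ι₁ N.ι₀ N.ι₁ (-1)).transpose
    (BlockAux.shuffle_transpose_mul 1) (BlockAux.shuffle_mul_transpose 1)
    (BlockAux.shuffle_transpose_mul (-1)) (BlockAux.shuffle_mul_transpose (-1))
  inl_κ _ := hom_ext (BlockAux.shuffle_inl 1) (BlockAux.shuffle_inl (-1))
  κ_snd _ := hom_ext BlockAux.snd_shuffle BlockAux.snd_shuffle'

end MF

noncomputable section

open MvPowerSeries

/-- The Faltings–Knörrer functor is compatible with cones. -/
def MF.thetaCone {A : Type u} [CommRing A] {p : A} {w : PS₂ A} (hw : w = X 0 * X 1 - C p) :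
    MF.ConeCompat (MF.theta hw) :=
  -- θ is by definition base change to A[[x, y]] followed by `thetaGen`, so the two compatibilities
  -- compose.
  (MF.baseChangeCone (C (σ := Fin 2) (R := A)) rfl).comp (MF.thetaGenCone hw)

instance {A : Type u} [CommRing A] {p : A} {w : PS₂ A} (hw : w = X 0 * X 1 - C p) :
    (MF.theta hw).Additive :=
  inferInstanceAs (MF.baseChange (C (σ := Fin 2) (R := A)) rfl ⋙ MF.thetaGen hw).Additive

end

/-! ### Null-homotopies -/

namespace MF

variable {B : Type u} [CommRing B] {w : B}

/-- The boundary of an odd map. -/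
def bdry {M N : MF w} (h₀ : Matrix N.ι₁ M.ι₀ B) (h₁ : Matrix N.ι₀ M.ι₁ B) : M ⟶ N where
  S := N.ψ * h₀ + h₁ * M.φ
  T := N.φ * h₁ + h₀ * M.ψ
  φ_comm := by
    rw [Matrix.mul_add, Matrix.add_mul, ← Matrix.mul_assoc, N.φ_mul_ψ, Matrix.mul_assoc h₀,
        M.ψ_mul_φ,
      Matrix.smul_mul, Matrix.mul_smul, Matrix.one_mul, Matrix.mul_one, Matrix.mul_assoc, add_comm]
  ψ_comm := by
    rw [Matrix.mul_add, Matrix.add_mul, ← Matrix.mul_assoc, N.ψ_mul_φ, Matrix.mul_assoc h₁,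
        M.φ_mul_ψ,
      Matrix.smul_mul, Matrix.mul_smul, Matrix.one_mul, Matrix.mul_one, Matrix.mul_assoc, add_comm]

theorem null_bdry {M N : MF w} (h₀ : Matrix N.ι₁ M.ι₀ B) (h₁ : Matrix N.ι₀ M.ι₁ B) :
    Null (bdry h₀ h₁) := ⟨h₀, h₁, rfl, rfl⟩

theorem Null.add {M N : MF w} {f g : M ⟶ N} (hf : Null f) (hg : Null g) : Null (f + g) := by
  rw [← proj_map_eq_zero_iff] at *
  rw [Functor.map_add, hf, hg, add_zero]

theorem Null.of_sub {M N : MF w} {f g : M ⟶ N} (hf : Null (f - g)) (hg : Null g) : Null f := by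
  simpa using hf.add hg

/-- Multiplication by a scalar. -/
def scal (b : B) (M : MF w) : M ⟶ M where
  S := b • 1
  T := b • 1
  φ_comm := by simp
  ψ_comm := by simp

theorem exists_smul_of_dvd {x : B} {m n : Type} (P : Matrix m n B) (h : ∀ i j, x ∣ P i j) :
    ∃ Q : Matrix m n B, P = x • Q := by
  choose Q hQ using h
  exact ⟨Q, Matrix.ext hQ⟩

/-- A closed morphism with coefficients in the ideal `(x, y)` is null-homotopic if multiplication by
`x` and `y` on the target is, and `x, y` is a regular sequence. -/
theorem null_of_regular {x y : B} (hx : ∀ a b, x * a = x * b → a = b)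
    (hxy : ∀ z d, y * z = x * d → x ∣ z) {M N : MF w} (hNx : Null (scal x N))
    (hNy : Null (scal y N)) (f : M ⟶ N) (a₀ b₀ : Matrix N.ι₀ M.ι₀ B) (a₁ b₁ : Matrix N.ι₁ M.ι₁ B)
    (hS : f.S = x • a₀ + y • b₀) (hT : f.T = x • a₁ + y • b₁) : Null f := by
  obtain ⟨l₀, l₁, hl₀, hl₁⟩ := hNx
  obtain ⟨k₀, k₁, hk₀, hk₁⟩ := hNy
  have hl₀ : N.ψ * l₀ + l₁ * N.φ = x • 1 := hl₀.symm
  have hl₁ : N.φ * l₁ + l₀ * N.ψ = x • 1 := hl₁.symm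
  have hk₀ : N.ψ * k₀ + k₁ * N.φ = y • 1 := hk₀.symm
  have hk₁ : N.φ * k₁ + k₀ * N.ψ = y • 1 := hk₁.symm
  have hφ := f.φ_comm
  have hψ := f.ψ_comm
  rw [hS, hT] at hφ hψ
  simp only [Matrix.mul_add, Matrix.add_mul, Matrix.mul_smul, Matrix.smul_mul] at hφ hψ
  -- Closedness of f says that y times the failure of b to be closed is a multiple of x; regularity
  -- then makes that failure itself a multiple of x.
  obtain ⟨c₀, hc₀⟩ : ∃ c, N.φ * b₀ - b₁ * M.φ = x • c := by
    apply exists_smul_of_dvd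
    intro i j
    apply hxy _ ((a₁ * M.φ - N.φ * a₀) i j)
    have h := congrFun (congrFun hφ i) j
    simp only [Matrix.add_apply, Matrix.smul_apply, smul_eq_mul, Matrix.sub_apply] at h ⊢
    linear_combination h
  obtain ⟨c₁, hc₁⟩ : ∃ c, N.ψ * b₁ - b₀ * M.ψ = x • c := by
    apply exists_smul_of_dvd
    intro i j
    apply hxy _ ((a₀ * M.ψ - N.ψ * a₁) i j)
    have h := congrFun (congrFun hψ i) j
    simp only [Matrix.add_apply, Matrix.smul_apply, smul_eq_mul, Matrix.sub_apply] at h ⊢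
    linear_combination h
  have cancel : ∀ {m n : Type} {P Q : Matrix m n B}, x • P = x • Q → P = Q := fun h =>
    Matrix.ext fun i j => hx _ _ (congrFun (congrFun h i) j)
  -- The homotopy k for y, applied to b, has boundary yb up to a multiple of x. Subtracting it
  -- leaves a morphism divisible by x.
  have gS : (f - bdry (k₀ * b₀) (k₁ * b₁)).S = x • (a₀ + k₁ * c₀) := by
    have : N.ψ * (k₀ * b₀) + k₁ * b₁ * M.φ = y • b₀ - x • (k₁ * c₀) := by
      rw [← Matrix.mul_smul, ← hc₀, Matrix.mul_sub, ← Matrix.mul_assoc, ← Matrix.mul_assoc k₁ N.φ,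
        eq_sub_of_add_eq hk₀, Matrix.sub_mul, Matrix.smul_mul, Matrix.one_mul,
            Matrix.mul_assoc k₁ b₁]
      abel
    rw [sub_S, hS, smul_add]
    change _ - (N.ψ * (k₀ * b₀) + k₁ * b₁ * M.φ) = _
    rw [this]; abel
  have gT : (f - bdry (k₀ * b₀) (k₁ * b₁)).T = x • (a₁ + k₀ * c₁) := by
    have : N.φ * (k₁ * b₁) + k₀ * b₀ * M.ψ = y • b₁ - x • (k₀ * c₁) := by
      rw [← Matrix.mul_smul, ← hc₁, Matrix.mul_sub, ← Matrix.mul_assoc, ← Matrix.mul_assoc k₀ N.ψ,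
        eq_sub_of_add_eq hk₁, Matrix.sub_mul, Matrix.smul_mul, Matrix.one_mul,
            Matrix.mul_assoc k₀ b₀]
      abel
    rw [sub_T, hT, smul_add]
    change _ - (N.φ * (k₁ * b₁) + k₀ * b₀ * M.ψ) = _
    rw [this]; abel
  refine Null.of_sub (g := bdry (k₀ * b₀) (k₁ * b₁)) ?_ (null_bdry _ _)
  set g := f - bdry (k₀ * b₀) (k₁ * b₁)
  set g₀ := a₀ + k₁ * c₀
  set g₁ := a₁ + k₀ * c₁
  -- As x is regular, the quotient by x is again closed.
  have gφ : N.φ * g₀ = g₁ * M.φ := cancel <| by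
    rw [← Matrix.mul_smul, ← Matrix.smul_mul, ← gS, ← gT, g.φ_comm]
  have gψ : N.ψ * g₁ = g₀ * M.ψ := cancel <| by
    rw [← Matrix.mul_smul, ← Matrix.smul_mul, ← gS, ← gT, g.ψ_comm]
  -- x times a closed morphism is the boundary of the homotopy l for x followed after it.
  refine ⟨l₀ * g₀, l₁ * g₁, ?_, ?_⟩
  · rw [gS, Matrix.mul_assoc l₁, ← gφ, ← Matrix.mul_assoc, ← Matrix.mul_assoc, ← Matrix.add_mul,
        hl₀,
      Matrix.smul_mul, Matrix.one_mul]
  · rw [gT, Matrix.mul_assoc l₀, ← gψ, ← Matrix.mul_assoc, ← Matrix.mul_assoc, ← Matrix.add_mul,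
        hl₁,
      Matrix.smul_mul, Matrix.one_mul]

theorem smul_one_eq_fromBlocks (b : B) {m n : Type} [DecidableEq m] [DecidableEq n] :
    b • (1 : Matrix (m ⊕ n) (m ⊕ n) B) = Matrix.fromBlocks (b • 1) 0 0 (b • 1) := by
  rw [← Matrix.fromBlocks_one, Matrix.fromBlocks_smul, smul_zero, smul_zero]

/-- Multiplication by `x` is null-homotopic on `(x, P; Q, y)`. -/
theorem null_scal_thetaGen_left {p x y w : B} (hw : w = x * y - p) (M : MF p) :
    Null (scal x (thetaGenObj hw M)) := by
  -- These are the formal derivatives of φ and ψ with respect to y.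
  refine ⟨Matrix.fromBlocks 0 0 0 1, Matrix.fromBlocks 1 0 0 0, ?_, ?_⟩
  · change x • (1 : Matrix (M.ι₁ ⊕ M.ι₀) (M.ι₁ ⊕ M.ι₀) B) =
        Matrix.fromBlocks (y • 1) (-M.φ) (-M.ψ) (x • 1) * Matrix.fromBlocks 0 0 0 1 +
      Matrix.fromBlocks 1 0 0 0 * Matrix.fromBlocks (x • 1) M.φ M.ψ (y • 1)
    rw [smul_one_eq_fromBlocks]
    simp [Matrix.fromBlocks_multiply, Matrix.fromBlocks_add]
  · change x • (1 : Matrix (M.ι₁ ⊕ M.ι₀) (M.ι₁ ⊕ M.ι₀) B) =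
        Matrix.fromBlocks (x • 1) M.φ M.ψ (y • 1) * Matrix.fromBlocks 1 0 0 0 +
      Matrix.fromBlocks 0 0 0 1 * Matrix.fromBlocks (y • 1) (-M.φ) (-M.ψ) (x • 1)
    rw [smul_one_eq_fromBlocks]
    simp [Matrix.fromBlocks_multiply, Matrix.fromBlocks_add]

/-- Multiplication by `y` is null-homotopic on `(x, P; Q, y)`. -/
theorem null_scal_thetaGen_right {p x y w : B} (hw : w = x * y - p) (M : MF p) :
    Null (scal y (thetaGenObj hw M)) := by
  -- These are the formal derivatives of φ and ψ with respect to x.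
  refine ⟨Matrix.fromBlocks 1 0 0 0, Matrix.fromBlocks 0 0 0 1, ?_, ?_⟩
  · change y • (1 : Matrix (M.ι₁ ⊕ M.ι₀) (M.ι₁ ⊕ M.ι₀) B) =
        Matrix.fromBlocks (y • 1) (-M.φ) (-M.ψ) (x • 1) * Matrix.fromBlocks 1 0 0 0 +
      Matrix.fromBlocks 0 0 0 1 * Matrix.fromBlocks (x • 1) M.φ M.ψ (y • 1)
    rw [smul_one_eq_fromBlocks]
    simp [Matrix.fromBlocks_multiply, Matrix.fromBlocks_add]
  · change y • (1 : Matrix (M.ι₁ ⊕ M.ι₀) (M.ι₁ ⊕ M.ι₀) B) =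
        Matrix.fromBlocks (x • 1) M.φ M.ψ (y • 1) * Matrix.fromBlocks 0 0 0 1 +
      Matrix.fromBlocks 1 0 0 0 * Matrix.fromBlocks (y • 1) (-M.φ) (-M.ψ) (x • 1)
    rw [smul_one_eq_fromBlocks]
    simp [Matrix.fromBlocks_multiply, Matrix.fromBlocks_add]

end MF

/-! ### Power series in two variables -/

noncomputable section

open MvPowerSeries

namespace PS₂

variable {A : Type u} [CommRing A]

theorem X_mul_cancel (i : Fin 2) {a b : PS₂ A} (h : X i * a = X i * b) : a = b := by
  ext n
  have := congrArg (coeff (Finsupp.single i 1 + n)) h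
  simpa [X, coeff_add_monomial_mul] using this

/-- Regularity of the sequence x, y: an x-free monomial of z remains x-free after multiplication by
y, so its coefficient vanishes. -/
theorem X_zero_dvd_of_X_one_mul {z d : PS₂ A} (h : X 1 * z = X 0 * d) : (X 0 : PS₂ A) ∣ z := by
  rw [X_dvd_iff]
  intro n hn
  have h₁ := congrArg (coeff (Finsupp.single 1 1 + n)) h
  rw [X, coeff_add_monomial_mul, one_mul] at h₁
  rw [h₁]
  apply X_dvd_iff.1 (dvd_mul_right _ _)
  simp [hn]

/-- Rescaling x by 0 keeps exactly the x-free monomials; here this realizes reduction modulo x as an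
endomorphism of A[[x, y]]. -/
theorem X_zero_dvd_sub_rescale (f : PS₂ A) : (X 0 : PS₂ A) ∣ f - rescale ![0, 1] f := by
  rw [X_dvd_iff]
  intro n hn
  rw [map_sub, coeff_rescale, Finsupp.prod_fintype _ _ (by simp)]
  simp [hn]

theorem X_one_dvd_rescale_sub (f : PS₂ A) :
    (X 1 : PS₂ A) ∣ rescale ![0, 1] f - C (constantCoeff f) := by
  classical
  rw [X_dvd_iff]
  intro n hn
  rw [map_sub, coeff_rescale, Finsupp.prod_fintype _ _ (by simp), coeff_C]
  by_cases h : n 0 = 0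
  · have : n = 0 := by ext i; fin_cases i <;> simp [h, hn]
    subst this
    simp
  · have : n ≠ 0 := by rintro rfl; exact h rfl
    simp [this, h]

theorem exists_eq_of_constantCoeff (f : PS₂ A) (h : constantCoeff f = 0) :
    ∃ a b : PS₂ A, f = X 0 * a + X 1 * b := by
  obtain ⟨a, ha⟩ := X_zero_dvd_sub_rescale f
  obtain ⟨b, hb⟩ := X_one_dvd_rescale_sub f
  refine ⟨a, b, ?_⟩
  rw [h, map_zero, sub_zero] at hb
  rw [← ha, ← hb]; ring

theorem exists_matrix_of_constantCoeff {m n : Type} (P : Matrix m n (PS₂ A))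
    (h : P.map constantCoeff = 0) :
    ∃ a b : Matrix m n (PS₂ A), P = (X 0 : PS₂ A) • a + (X 1 : PS₂ A) • b := by
  choose a b hab using fun i j => exists_eq_of_constantCoeff (P i j) (congrFun (congrFun h i) j)
  exact ⟨a, b, Matrix.ext hab⟩

/-- The coefficient of `X i`. -/
def linCoeff (i : Fin 2) : PS₂ A →+ A := (coeff (Finsupp.single i 1) : PS₂ A →ₗ[A] A).toAddMonoidHom

/-- Leibniz rule at the origin; with it, matrix identities over A[[x, y]] yield their first-order
parts over A. -/
theorem linCoeff_mul (i : Fin 2) (a b : PS₂ A) : linCoeff i (a * b) =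
    linCoeff i a * constantCoeff b + constantCoeff a * linCoeff i b := by
  classical
  simp only [linCoeff, LinearMap.toAddMonoidHom_coe, coeff_mul]
  rw [Finsupp.antidiagonal_single, Finset.sum_map]
  simp [Finset.Nat.antidiagonal_succ]
  ring

theorem matrix_linCoeff_mul (i : Fin 2) {l m n : Type} [Fintype m] (P : Matrix l m (PS₂ A))
    (Q : Matrix m n (PS₂ A)) : (P * Q).map (linCoeff i) =
    P.map (linCoeff i) * Q.map constantCoeff + P.map constantCoeff * Q.map (linCoeff i) := by
  ext a b
  simp [Matrix.mul_apply, linCoeff_mul, Finset.sum_add_distrib]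

end PS₂

end

noncomputable section

open MvPowerSeries

/-! ### The Faltings–Knörrer functor is fully faithful -/

namespace MF

variable {A : Type u} [CommRing A] {p : A} {w : PS₂ A}

theorem ext₂_map_constantCoeff {m n : Type} (P : Matrix m n A) :
    (ext₂ P).map constantCoeff = P := by
  ext; simp [ext₂]

theorem ext₂_map_linCoeff (i : Fin 2) {m n : Type} (P : Matrix m n A) :
    (ext₂ P).map (PS₂.linCoeff i) = 0 := by
  ext a b
  simp [ext₂, PS₂.linCoeff, coeff_C]

theorem smul_one_map_constantCoeff (i : Fin 2) {m : Type} [DecidableEq m] :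
    ((X i : PS₂ A) • (1 : Matrix m m (PS₂ A))).map constantCoeff = 0 := by
  ext a b
  by_cases h : a = b <;> simp [h]

theorem smul_one_map_linCoeff (i : Fin 2) {m : Type} [DecidableEq m] :
    ((X i : PS₂ A) • (1 : Matrix m m (PS₂ A))).map (PS₂.linCoeff i) = 1 := by
  ext a b
  by_cases h : a = b
  · subst h
    simp [PS₂.linCoeff, coeff_X]
  · simp [h]

theorem smul_one_map_linCoeff_of_ne {i j : Fin 2} (hij : i ≠ j) {m : Type} [DecidableEq m] :
    ((X j : PS₂ A) • (1 : Matrix m m (PS₂ A))).map (PS₂.linCoeff i) = 0 := by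
  ext a b
  by_cases h : a = b
  · subst h
    simp [PS₂.linCoeff, coeff_X, Finsupp.single_left_inj, hij]
  · simp [h]

/-! ### Constant and linear parts of the operators of θ(M). -/

section

variable (M : MF p)

theorem thetaObj_φ_constantCoeff :
    (Matrix.fromBlocks ((X 0 : PS₂ A) • (1 : Matrix M.ι₁ M.ι₁ (PS₂ A))) (ext₂ M.φ) (ext₂ M.ψ)
      ((X 1 : PS₂ A) • (1 : Matrix M.ι₀ M.ι₀ (PS₂ A)))).map constantCoeff =
          Matrix.fromBlocks 0 M.φ M.ψ 0 := by
  simp only [Matrix.fromBlocks_map, smul_one_map_constantCoeff, ext₂_map_constantCoeff]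

theorem thetaObj_ψ_constantCoeff :
    (Matrix.fromBlocks ((X 1 : PS₂ A) • (1 : Matrix M.ι₁ M.ι₁ (PS₂ A))) (-ext₂ M.φ) (-ext₂ M.ψ)
      ((X 0 : PS₂ A) • (1 : Matrix M.ι₀ M.ι₀ (PS₂ A)))).map constantCoeff =
          Matrix.fromBlocks 0 (-M.φ) (-M.ψ) 0 := by
  simp only [Matrix.fromBlocks_map, smul_one_map_constantCoeff, map_neg_ringHom,
    ext₂_map_constantCoeff]

theorem thetaObj_φ_linCoeff_zero :
    (Matrix.fromBlocks ((X 0 : PS₂ A) • (1 : Matrix M.ι₁ M.ι₁ (PS₂ A))) (ext₂ M.φ) (ext₂ M.ψ)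
      ((X 1 : PS₂ A) • (1 : Matrix M.ι₀ M.ι₀ (PS₂ A)))).map (PS₂.linCoeff 0) =
          Matrix.fromBlocks 1 0 0 0 := by
  simp only [Matrix.fromBlocks_map, smul_one_map_linCoeff, ext₂_map_linCoeff,
    smul_one_map_linCoeff_of_ne (zero_ne_one)]

theorem thetaObj_φ_linCoeff_one :
    (Matrix.fromBlocks ((X 0 : PS₂ A) • (1 : Matrix M.ι₁ M.ι₁ (PS₂ A))) (ext₂ M.φ) (ext₂ M.ψ)
      ((X 1 : PS₂ A) • (1 : Matrix M.ι₀ M.ι₀ (PS₂ A)))).map (PS₂.linCoeff 1) =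
          Matrix.fromBlocks 0 0 0 1 := by
  simp only [Matrix.fromBlocks_map, smul_one_map_linCoeff, ext₂_map_linCoeff,
    smul_one_map_linCoeff_of_ne (one_ne_zero)]

theorem thetaObj_ψ_linCoeff_zero :
    (Matrix.fromBlocks ((X 1 : PS₂ A) • (1 : Matrix M.ι₁ M.ι₁ (PS₂ A))) (-ext₂ M.φ) (-ext₂ M.ψ)
      ((X 0 : PS₂ A) • (1 : Matrix M.ι₀ M.ι₀ (PS₂ A)))).map (PS₂.linCoeff 0) =
          Matrix.fromBlocks 0 0 0 1 := by
  simp only [Matrix.fromBlocks_map, smul_one_map_linCoeff, ← ext₂_neg, ext₂_map_linCoeff,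
    smul_one_map_linCoeff_of_ne (zero_ne_one)]

theorem thetaObj_ψ_linCoeff_one :
    (Matrix.fromBlocks ((X 1 : PS₂ A) • (1 : Matrix M.ι₁ M.ι₁ (PS₂ A))) (-ext₂ M.φ) (-ext₂ M.ψ)
      ((X 0 : PS₂ A) • (1 : Matrix M.ι₀ M.ι₀ (PS₂ A)))).map (PS₂.linCoeff 1) =
          Matrix.fromBlocks 1 0 0 0 := by
  simp only [Matrix.fromBlocks_map, smul_one_map_linCoeff, ← ext₂_neg, ext₂_map_linCoeff,
    smul_one_map_linCoeff_of_ne (one_ne_zero)]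

end

/-- Modulo (x, y) the operators of θ(M) have only the off-diagonal blocks P and Q up to sign, so the
diagonal blocks of the homotopy relation are precisely a homotopy relation over A. -/
theorem null_of_null_theta (hw : w = X 0 * X 1 - C p) {M N : MF p} {f : M ⟶ N}
    (h : Null ((theta hw).map f)) : Null f := by
  obtain ⟨H₀, H₁, e₀, e₁⟩ : ∃ (H₀ H₁ : Matrix (N.ι₁ ⊕ N.ι₀) (M.ι₁ ⊕ M.ι₀) (PS₂ A)),
      Matrix.fromBlocks (ext₂ f.T) 0 0 (ext₂ f.S) =
        (thetaObj hw N).ψ * H₀ + H₁ * (thetaObj hw M).φ ∧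
      Matrix.fromBlocks (ext₂ f.T) 0 0 (ext₂ f.S) =
        (thetaObj hw N).φ * H₁ + H₀ * (thetaObj hw M).ψ := h
  have e₀' := congrArg (fun P => P.map constantCoeff) e₀
  have e₁' := congrArg (fun P => P.map constantCoeff) e₁
  simp only at e₀' e₁'
  rw [Matrix.map_add _ (map_add _), Matrix.map_mul, Matrix.map_mul, thetaObj_φ_constantCoeff,
    thetaObj_ψ_constantCoeff, Matrix.fromBlocks_map, ext₂_map_constantCoeff,
    ext₂_map_constantCoeff] at e₀' e₁'
  obtain ⟨a, b, c, d, hH₀⟩ : ∃ a b c d, H₀.map constantCoeff = Matrix.fromBlocks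
    (a : Matrix N.ι₁ M.ι₁ A) (b : Matrix N.ι₁ M.ι₀ A) c d :=
    ⟨_, _, _, _, (Matrix.fromBlocks_toBlocks _).symm⟩
  obtain ⟨a', b', c', d', hH₁⟩ : ∃ a b c d, H₁.map constantCoeff = Matrix.fromBlocks
    (a : Matrix N.ι₁ M.ι₁ A) (b : Matrix N.ι₁ M.ι₀ A) c d :=
    ⟨_, _, _, _, (Matrix.fromBlocks_toBlocks _).symm⟩
  rw [hH₀, hH₁, Matrix.fromBlocks_multiply, Matrix.fromBlocks_multiply, Matrix.fromBlocks_add,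
    Matrix.fromBlocks_inj] at e₀' e₁'
  -- The even relation is the lower right block of the second equation and the odd one the upper
  -- left block of the first; the sign on c comes from the minus signs in ψ.
  refine ⟨b', -c, ?_, ?_⟩
  · rw [e₁'.2.2.2]; simp
  · rw [e₀'.1]; simp

/-- The reduction of a morphism between objects in the image of the functor is homotopic to that of
a morphism in the image. -/
theorem exists_homotopic_constantCoeff {m₀ m₁ n₀ n₁ : Type} [Fintype m₀] [Fintype m₁] [Fintype n₀]
    [Fintype n₁] [DecidableEq m₀] [DecidableEq m₁] [DecidableEq n₀] [DecidableEq n₁]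
    {P : Matrix m₁ m₀ A} {Q : Matrix m₀ m₁ A} {P' : Matrix n₁ n₀ A} {Q' : Matrix n₀ n₁ A}
    {F F₀ F₁ G G₀ G₁ : Matrix (n₁ ⊕ n₀) (m₁ ⊕ m₀) A}
    (hφ : Matrix.fromBlocks 0 P' Q' 0 * F = G * Matrix.fromBlocks 0 P Q 0)
    (hψ : Matrix.fromBlocks 0 (-P') (-Q') 0 * G = F * Matrix.fromBlocks 0 (-P) (-Q) 0)
    (hφ₀ : (Matrix.fromBlocks 1 0 0 0 : Matrix (n₁ ⊕ n₀) (n₁ ⊕ n₀) A) * F +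
        Matrix.fromBlocks 0 P' Q' 0 * F₀ =
      G₀ * Matrix.fromBlocks 0 P Q 0 + G *
          (Matrix.fromBlocks 1 0 0 0 : Matrix (m₁ ⊕ m₀) (m₁ ⊕ m₀) A))
    (hφ₁ : (Matrix.fromBlocks 0 0 0 1 : Matrix (n₁ ⊕ n₀) (n₁ ⊕ n₀) A) * F +
        Matrix.fromBlocks 0 P' Q' 0 * F₁ =
      G₁ * Matrix.fromBlocks 0 P Q 0 + G *
          (Matrix.fromBlocks 0 0 0 1 : Matrix (m₁ ⊕ m₀) (m₁ ⊕ m₀) A))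
    (hψ₀ : (Matrix.fromBlocks 0 0 0 1 : Matrix (n₁ ⊕ n₀) (n₁ ⊕ n₀) A) * G +
        Matrix.fromBlocks 0 (-P') (-Q') 0 * G₀ =
      F₀ * Matrix.fromBlocks 0 (-P) (-Q) 0 + F *
          (Matrix.fromBlocks 0 0 0 1 : Matrix (m₁ ⊕ m₀) (m₁ ⊕ m₀) A))
    (hψ₁ : (Matrix.fromBlocks 1 0 0 0 : Matrix (n₁ ⊕ n₀) (n₁ ⊕ n₀) A) * G +
        Matrix.fromBlocks 0 (-P') (-Q') 0 * G₁ =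
      F₁ * Matrix.fromBlocks 0 (-P) (-Q) 0 + F *
          (Matrix.fromBlocks 1 0 0 0 : Matrix (m₁ ⊕ m₀) (m₁ ⊕ m₀) A)) :
    ∃ (S : Matrix n₀ m₀ A) (T : Matrix n₁ m₁ A) (H₀ H₁ : Matrix (n₁ ⊕ n₀) (m₁ ⊕ m₀) A),
      P' * S = T * P ∧ Q' * T = S * Q ∧
      F = Matrix.fromBlocks T 0 0 S + (Matrix.fromBlocks 0 (-P') (-Q') 0 * H₀ +
        H₁ * Matrix.fromBlocks 0 P Q 0) ∧
      G = Matrix.fromBlocks T 0 0 S + (Matrix.fromBlocks 0 P' Q' 0 * H₁ +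
        H₀ * Matrix.fromBlocks 0 (-P) (-Q) 0) := by
  obtain ⟨F11, F12, F21, F22, rfl⟩ : ∃ a b c d, F = Matrix.fromBlocks a b c d :=
    ⟨_, _, _, _, (Matrix.fromBlocks_toBlocks F).symm⟩
  obtain ⟨G11, G12, G21, G22, rfl⟩ : ∃ a b c d, G = Matrix.fromBlocks a b c d :=
    ⟨_, _, _, _, (Matrix.fromBlocks_toBlocks G).symm⟩
  obtain ⟨x11, x12, x21, x22, rfl⟩ : ∃ a b c d, F₀ = Matrix.fromBlocks a b c d :=
    ⟨_, _, _, _, (Matrix.fromBlocks_toBlocks F₀).symm⟩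
  obtain ⟨y11, y12, y21, y22, rfl⟩ : ∃ a b c d, F₁ = Matrix.fromBlocks a b c d :=
    ⟨_, _, _, _, (Matrix.fromBlocks_toBlocks F₁).symm⟩
  obtain ⟨s11, s12, s21, s22, rfl⟩ : ∃ a b c d, G₀ = Matrix.fromBlocks a b c d :=
    ⟨_, _, _, _, (Matrix.fromBlocks_toBlocks G₀).symm⟩
  obtain ⟨t11, t12, t21, t22, rfl⟩ : ∃ a b c d, G₁ = Matrix.fromBlocks a b c d :=
    ⟨_, _, _, _, (Matrix.fromBlocks_toBlocks G₁).symm⟩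
  simp only [Matrix.fromBlocks_multiply, Matrix.fromBlocks_add, Matrix.fromBlocks_inj,
    Matrix.zero_mul, Matrix.mul_zero, zero_add, add_zero, Matrix.one_mul, Matrix.mul_one,
    Matrix.neg_mul, Matrix.mul_neg, neg_inj] at hφ hψ hφ₀ hφ₁ hψ₀ hψ₁
  -- S and T are the blocks F22 and G11, which commute with the operators by the constant terms. The
  -- zero corners of the homotopies leave those two blocks uncorrected; all other blocks are solved
  -- for in the linear relations, where they occur with coefficient 1.
  refine ⟨F22, G11, Matrix.fromBlocks y11 0 x21 x22, Matrix.fromBlocks s11 s12 0 t22,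
    hφ.2.1, hψ.2.2.1, ?_, ?_⟩
  · simp only [Matrix.fromBlocks_multiply, Matrix.fromBlocks_add, Matrix.fromBlocks_inj,
      Matrix.zero_mul, Matrix.mul_zero, zero_add, add_zero, Matrix.neg_mul]
    refine ⟨?_, ?_, ?_, ?_⟩
    · rw [eq_sub_of_add_eq hφ₀.1]; abel
    · rw [eq_sub_of_add_eq hφ₀.2.1]; abel
    · rw [eq_sub_of_add_eq hφ₁.2.2.1]; abel
    · simp
  · simp only [Matrix.fromBlocks_multiply, Matrix.fromBlocks_add, Matrix.fromBlocks_inj,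
      Matrix.zero_mul, Matrix.mul_zero, zero_add, add_zero, Matrix.mul_neg]
    refine ⟨?_, ?_, ?_, ?_⟩
    · simp
    · rw [eq_sub_of_add_eq hψ₁.2.1]; abel
    · rw [eq_sub_of_add_eq hψ₀.2.2.1]; abel
    · rw [eq_sub_of_add_eq hψ₀.2.2.2]; abel

theorem sub_sub_S {B : Type u} [CommRing B] {w : B} {M N : MF w} (f g h : M ⟶ N) :
    (f - g - h).S = f.S - g.S - h.S := by rw [sub_S, sub_S]

theorem sub_sub_T {B : Type u} [CommRing B] {w : B} {M N : MF w} (f g h : M ⟶ N) :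
    (f - g - h).T = f.T - g.T - h.T := by rw [sub_T, sub_T]

/-- First the constant term is corrected by a homotopy with coefficients in A; the remainder lies in
(x, y), where `null_of_regular` applies. -/
theorem exists_null_sub_theta (hw : w = X 0 * X 1 - C p) {M N : MF p}
    (f : (theta hw).obj M ⟶ (theta hw).obj N) : ∃ g : M ⟶ N, Null (f - (theta hw).map g) := by
  obtain ⟨F, G, hφ, hψ, hf⟩ : ∃ (F G : Matrix (N.ι₁ ⊕ N.ι₀) (M.ι₁ ⊕ M.ι₀) (PS₂ A))
      (hφ : (thetaObj hw N).φ * F = G * (thetaObj hw M).φ)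
      (hψ : (thetaObj hw N).ψ * G = F * (thetaObj hw M).ψ), f = ⟨F, G, hφ, hψ⟩ :=
    ⟨f.S, f.T, f.φ_comm, f.ψ_comm, rfl⟩
  subst hf
  have c₀ := congrArg (fun P => P.map constantCoeff) hφ
  have d₀ := congrArg (fun P => P.map constantCoeff) hψ
  have φ₀ := congrArg (fun P => P.map (PS₂.linCoeff 0)) hφ
  have φ₁ := congrArg (fun P => P.map (PS₂.linCoeff 1)) hφ
  have ψ₀ := congrArg (fun P => P.map (PS₂.linCoeff 0)) hψ
  have ψ₁ := congrArg (fun P => P.map (PS₂.linCoeff 1)) hψ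
  simp only [PS₂.matrix_linCoeff_mul, Matrix.map_mul] at c₀ d₀ φ₀ φ₁ ψ₀ ψ₁
  rw [thetaObj_φ_constantCoeff, thetaObj_φ_constantCoeff] at c₀
  rw [thetaObj_ψ_constantCoeff, thetaObj_ψ_constantCoeff] at d₀
  rw [thetaObj_φ_constantCoeff, thetaObj_φ_constantCoeff, thetaObj_φ_linCoeff_zero,
    thetaObj_φ_linCoeff_zero] at φ₀
  rw [thetaObj_φ_constantCoeff, thetaObj_φ_constantCoeff, thetaObj_φ_linCoeff_one,
    thetaObj_φ_linCoeff_one] at φ₁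
  rw [thetaObj_ψ_constantCoeff, thetaObj_ψ_constantCoeff, thetaObj_ψ_linCoeff_zero,
    thetaObj_ψ_linCoeff_zero] at ψ₀
  rw [thetaObj_ψ_constantCoeff, thetaObj_ψ_constantCoeff, thetaObj_ψ_linCoeff_one,
    thetaObj_ψ_linCoeff_one] at ψ₁
  obtain ⟨S, T, H₀, H₁, hPS, hQT, e₀, e₁⟩ := exists_homotopic_constantCoeff c₀ d₀ φ₀ φ₁ ψ₀ ψ₁
  refine ⟨⟨S, T, hPS, hQT⟩, ?_⟩
  refine Null.of_sub (g := bdry (M := thetaObj hw M) (N := thetaObj hw N) (ext₂ H₀) (ext₂ H₁)) ?_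
    (null_bdry _ _)
  obtain ⟨a₀, b₀, h₀⟩ := PS₂.exists_matrix_of_constantCoeff
    (F - Matrix.fromBlocks (ext₂ T) 0 0 (ext₂ S) - ((thetaObj hw N).ψ * ext₂ H₀ +
      ext₂ H₁ * (thetaObj hw M).φ)) (by
    rw [Matrix.map_sub _ (map_sub _), Matrix.map_sub _ (map_sub _), Matrix.map_add _ (map_add _),
      Matrix.map_mul, Matrix.map_mul, thetaObj_ψ_constantCoeff, thetaObj_φ_constantCoeff,
      ext₂_map_constantCoeff, ext₂_map_constantCoeff, Matrix.fromBlocks_map,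
      ext₂_map_constantCoeff, ext₂_map_constantCoeff, e₀, Matrix.map_zero _ (map_zero _),
      Matrix.map_zero _ (map_zero _)]
    abel)
  obtain ⟨a₁, b₁, h₁⟩ := PS₂.exists_matrix_of_constantCoeff
    (G - Matrix.fromBlocks (ext₂ T) 0 0 (ext₂ S) - ((thetaObj hw N).φ * ext₂ H₁ +
      ext₂ H₀ * (thetaObj hw M).ψ)) (by
    rw [Matrix.map_sub _ (map_sub _), Matrix.map_sub _ (map_sub _), Matrix.map_add _ (map_add _),
      Matrix.map_mul, Matrix.map_mul, thetaObj_ψ_constantCoeff, thetaObj_φ_constantCoeff,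
      ext₂_map_constantCoeff, ext₂_map_constantCoeff, Matrix.fromBlocks_map,
      ext₂_map_constantCoeff, ext₂_map_constantCoeff, e₁, Matrix.map_zero _ (map_zero _),
      Matrix.map_zero _ (map_zero _)]
    abel)
  refine null_of_regular (x := (X 0 : PS₂ A)) (y := X 1) (fun _ _ => PS₂.X_mul_cancel 0)
    (fun _ _ => PS₂.X_zero_dvd_of_X_one_mul)
    -- θ(N) is `thetaGen` of the base change of N, on which x and y are null-homotopic.
    (null_scal_thetaGen_left hw ((baseChange (C (σ := Fin 2) (R := A)) rfl).obj N))
    (null_scal_thetaGen_right hw ((baseChange (C (σ := Fin 2) (R := A)) rfl).obj N)) _ a₀ b₀ a₁ b₁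
    ?_ ?_
  · exact (sub_sub_S (M := thetaObj hw M) (N := thetaObj hw N) _ _ _).trans h₀
  · exact (sub_sub_T (M := thetaObj hw M) (N := thetaObj hw N) _ _ _).trans h₁

end MF

namespace HMF

variable {A : Type u} [CommRing A] {p : A} {w : PS₂ A}

theorem theta_faithful (hw : w = X 0 * X 1 - C p) : (theta hw).Faithful where
  map_injective {M N f g} h := by
    obtain ⟨f, rfl⟩ := exists_proj_map (M := M.as) (N := N.as) f
    obtain ⟨g, rfl⟩ := exists_proj_map (M := M.as) (N := N.as) g
    have h' := (proj_map_eq_iff _ _).1 h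
    rw [MF.homotopic_iff_null, ← Functor.map_sub] at h'
    have := MF.null_of_null_theta hw h'
    rwa [← MF.homotopic_iff_null, ← proj_map_eq_iff] at this

theorem theta_full (hw : w = X 0 * X 1 - C p) : (theta hw).Full where
  map_surjective {M N} f := by
    obtain ⟨f, rfl⟩ := exists_proj_map (M := (MF.theta hw).obj M.as) (N := (MF.theta hw).obj N.as) f
    obtain ⟨g, hg⟩ := MF.exists_null_sub_theta hw f
    rw [← MF.homotopic_iff_null, ← proj_map_eq_iff] at hg
    exact ⟨(proj p).map g, hg.symm⟩

end HMF

/-! ### Changing the sign of the potential -/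

namespace MF

variable {B : Type u} [CommRing B] {w w' : B}

instance (hw : w' = -w) : (sign hw).Additive := ⟨rfl⟩

theorem sign_σ_comm {m n : Type} [Fintype m] [Fintype n] [DecidableEq m] [DecidableEq n]
    (P : Matrix m n B) : - -P * (1 : Matrix n n B) = (-1 : Matrix m m B) * -P := by
  simp

theorem sign_σ_comm' {m n : Type} [Fintype m] [Fintype n] [DecidableEq m] [DecidableEq n]
    (P : Matrix m n B) : -P * (-1 : Matrix n n B) = (1 : Matrix m m B) * - -P := by
  simp

end MF

namespace BlockAux

variable {B : Type u} [CommRing B] {m n m' n' : Type} [Fintype m] [Fintype n] [Fintype m']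
  [Fintype n'] [DecidableEq m] [DecidableEq n] [DecidableEq m'] [DecidableEq n']

variable (B m n) in
/-- The diagonal matrix with blocks `1` and `-1`. -/
def diagNeg : Matrix (m ⊕ n) (m ⊕ n) B := Matrix.fromBlocks 1 0 0 (-1)

theorem diagNeg_mul_diagNeg : diagNeg B m n * diagNeg B m n = 1 := by
  simp [diagNeg, Matrix.fromBlocks_multiply]

/-- The sign change negates ψ but not f, so the cones match only after a sign on the odd part of
M[1]; this is the role of `diagNeg`. -/
theorem sign_κ_comm (P : Matrix m m' B) (T : Matrix m n' B) (Q : Matrix n n' B) :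
    Matrix.fromBlocks P T 0 (- -Q) * (1 : Matrix (m' ⊕ n') (m' ⊕ n') B) =
      diagNeg B m n * Matrix.fromBlocks P T 0 (-Q) := by
  simp [diagNeg, Matrix.fromBlocks_multiply]

theorem sign_κ_comm' (P : Matrix m m' B) (T : Matrix m n' B) (Q : Matrix n n' B) :
    Matrix.fromBlocks (-P) T 0 (-Q) * diagNeg B m' n' =
      (1 : Matrix (m ⊕ n) (m ⊕ n) B) * -Matrix.fromBlocks P T 0 (-Q) := by
  simp [diagNeg, Matrix.fromBlocks_multiply, Matrix.fromBlocks_neg]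

theorem diagNeg_mul_inl : diagNeg B m n * inl B m n = inl B m n := by
  simp [diagNeg, inl, Matrix.fromBlocks_mul_fromRows]

theorem snd_mul_diagNeg : snd B m n * diagNeg B m n = (-1 : Matrix n n B) * snd B m n := by
  simp only [diagNeg, snd, Matrix.fromCols_mul_fromBlocks, Matrix.mul_fromCols]
  simp

end BlockAux

namespace MF

variable {B : Type u} [CommRing B] {w w' : B}

/-- The sign change is compatible with cones. -/
def signCone (hw : w' = -w) : ConeCompat (sign hw) where
  σ M := isoMk (M := signObj hw M.shiftObj) (N := (signObj hw M).shiftObj)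
    ⟨(1 : Matrix M.ι₁ M.ι₁ B), (-1 : Matrix M.ι₀ M.ι₀ B), sign_σ_comm M.ψ, sign_σ_comm' M.φ⟩
    (1 : Matrix M.ι₁ M.ι₁ B) (-1 : Matrix M.ι₀ M.ι₀ B)
    (Matrix.one_mul _) (Matrix.one_mul _)
    (BlockAux.neg_one_mul_neg_one _) (BlockAux.neg_one_mul_neg_one _)
  σ_naturality {M N} f := by
    have key : (-1 : Matrix N.ι₀ N.ι₀ B) * f.S = f.S * (-1 : Matrix M.ι₀ M.ι₀ B) := by simp
    exact hom_ext ((Matrix.one_mul _).trans (Matrix.mul_one _).symm) key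
  κ {M N} f := isoMk (M := signObj hw (cone f)) (N := cone ((sign hw).map f))
    ⟨(1 : Matrix (N.ι₀ ⊕ M.ι₁) (N.ι₀ ⊕ M.ι₁) B), BlockAux.diagNeg B N.ι₁ M.ι₀,
      BlockAux.sign_κ_comm N.φ f.T M.ψ, BlockAux.sign_κ_comm' N.ψ f.S M.φ⟩
    (1 : Matrix (N.ι₀ ⊕ M.ι₁) (N.ι₀ ⊕ M.ι₁) B) (BlockAux.diagNeg B N.ι₁ M.ι₀)
    (Matrix.one_mul _) (Matrix.one_mul _)
    BlockAux.diagNeg_mul_diagNeg BlockAux.diagNeg_mul_diagNeg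
  inl_κ _ := hom_ext (Matrix.one_mul _) BlockAux.diagNeg_mul_inl
  κ_snd _ := hom_ext ((Matrix.mul_one _).trans (Matrix.one_mul _).symm) BlockAux.snd_mul_diagNeg

end MF

theorem HMF.sign_isEquivalence {B : Type u} [CommRing B] {w w' : B} (hw : w' = -w) :
    (HMF.sign hw).IsEquivalence where
  faithful :=
    { map_injective {M N f g} h := by
        obtain ⟨f, rfl⟩ := exists_proj_map (M := M.as) (N := N.as) f
        obtain ⟨g, rfl⟩ := exists_proj_map (M := M.as) (N := N.as) g
        obtain ⟨h₀, h₁, e₀, e₁⟩ : ∃ (h₀ : Matrix N.as.ι₁ M.as.ι₀ B) (h₁ : Matrix N.as.ι₀ M.as.ι₁ B),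
          f.S = g.S + (-N.as.ψ * h₀ + h₁ * M.as.φ) ∧ f.T = g.T + (N.as.φ * h₁ + h₀ * -M.as.ψ) :=
          (proj_map_eq_iff _ _).1 h
        apply (proj_map_eq_iff _ _).2
        refine ⟨-h₀, h₁, ?_, ?_⟩
        · rw [e₀, Matrix.neg_mul, Matrix.mul_neg]
        · rw [e₁, Matrix.neg_mul, Matrix.mul_neg] }
  full :=
    { map_surjective {M N} f := by
        obtain ⟨f, rfl⟩ := exists_proj_map (M := (MF.sign hw).obj M.as)
          (N := (MF.sign hw).obj N.as) f
        obtain ⟨S, T, hφ, hψ, hf⟩ : ∃ (S : Matrix N.as.ι₀ M.as.ι₀ B) (T : Matrix N.as.ι₁ M.as.ι₁ B)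
            (hφ : N.as.φ * S = T * M.as.φ) (hψ : -N.as.ψ * T = S * -M.as.ψ),
            f = ⟨S, T, hφ, hψ⟩ := ⟨f.S, f.T, f.φ_comm, f.ψ_comm, rfl⟩
        rw [hf]
        refine ⟨(proj w).map ⟨S, T, hφ, ?_⟩, rfl⟩
        rwa [Matrix.neg_mul, Matrix.mul_neg, neg_inj] at hψ }
  essSurj :=
    { mem_essImage M := by
        have hw' : w = -w' := by rw [hw, neg_neg]
        refine ⟨(proj w).obj (MF.signObj hw' M.as), ⟨(proj w').mapIso (MF.isoMk
          (M := MF.signObj hw (MF.signObj hw' M.as)) (N := M.as)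
          ⟨(1 : Matrix M.as.ι₀ M.as.ι₀ B), (1 : Matrix M.as.ι₁ M.as.ι₁ B), ?_, ?_⟩
          (1 : Matrix M.as.ι₀ M.as.ι₀ B) (1 : Matrix M.as.ι₁ M.as.ι₁ B)
          (Matrix.one_mul _) (Matrix.one_mul _) (Matrix.one_mul _) (Matrix.one_mul _))⟩⟩
        · exact BlockAux.one_comm rfl
        · exact BlockAux.one_comm (neg_neg _).symm }

theorem HMF.sign_isTriangleEquivalence {B : Type u} [CommRing B] {w w' : B} (hw : w' = -w) :
    IsTriangleEquivalence (distTriangles w) (distTriangles w') (sign hw) :=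
  isTriangleEquivalence_lift _ _ (MF.signCone hw) (sign_isEquivalence hw)

end

/-! ### Every factorization is a retract of one in the image -/

namespace MF

variable {B : Type u} [CommRing B] {w : B}

/-- If `x` is regular, multiplication by `x` on a factorization `M` of `x y - p` is null-homotopic,
and `φ̄`, `ψ̄` are reductions of the operators modulo `x` whose products are `-p`, then `M` is a
retract of
the object attached to `(φ̄, -ψ̄)`. -/
theorem nonempty_retract_thetaGen {x y p : B} (hw : w = x * y - p)
    (hx : ∀ a b, x * a = x * b → a = b) (M : MF w) (hM : Null (scal x M))
    (φ' φ₁ : Matrix M.ι₁ M.ι₀ B) (ψ' ψ₁ : Matrix M.ι₀ M.ι₁ B)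
    (hφ : M.φ = φ' + x • φ₁) (hψ : M.ψ = ψ' + x • ψ₁)
    (hφψ : φ' * ψ' = -(p • 1)) (hψφ : ψ' * φ' = -(p • 1)) (e : φ' * -ψ' = p • 1)
    (e' : -ψ' * φ' = p • 1) :
    Nonempty (Retract M (thetaGenObj hw ⟨M.ι₀, M.ι₁, φ', -ψ', e, e'⟩)) ∧
      φ' * ψ₁ + φ₁ * M.ψ = y • 1 ∧ ψ' * φ₁ + ψ₁ * M.φ = y • 1 := by
  have cancel : ∀ {m n : Type} {P Q : Matrix m n B}, x • P = x • Q → P = Q := fun h =>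
    Matrix.ext fun i j => hx _ _ (congrFun (congrFun h i) j)
  have hw' : ∀ {m : Type} [DecidableEq m], w • (1 : Matrix m m B) = (x * y) • 1 - p • 1 := by
    intro m _
    rw [← sub_smul, ← hw]
  have MM : M.φ * M.ψ = (x * y) • 1 - p • 1 := M.φ_mul_ψ.trans hw'
  have MM' : M.ψ * M.φ = (x * y) • 1 - p • 1 := M.ψ_mul_φ.trans hw'
  -- Multiply by x and replace xφ₁, xψ₁ by differences: the mixed terms cancel and xy remains. The
  -- four relations are the four ways of taking the difference of a product.
  have r₁ : φ' * ψ₁ + φ₁ * M.ψ = y • 1 := cancel <| by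
    rw [smul_add, ← Matrix.mul_smul, ← Matrix.smul_mul, eq_sub_of_add_eq' hψ.symm,
      eq_sub_of_add_eq' hφ.symm, Matrix.mul_sub, Matrix.sub_mul, hφψ, MM, mul_smul]
    abel
  have r₂ : ψ' * φ₁ + ψ₁ * M.φ = y • 1 := cancel <| by
    rw [smul_add, ← Matrix.mul_smul, ← Matrix.smul_mul, eq_sub_of_add_eq' hψ.symm,
      eq_sub_of_add_eq' hφ.symm, Matrix.mul_sub, Matrix.sub_mul, hψφ, MM', mul_smul]
    abel
  have r₃ : M.ψ * φ₁ + ψ₁ * φ' = y • 1 := cancel <| by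
    rw [smul_add, ← Matrix.mul_smul, ← Matrix.smul_mul, eq_sub_of_add_eq' hψ.symm,
      eq_sub_of_add_eq' hφ.symm, Matrix.mul_sub, Matrix.sub_mul, hψφ, MM', mul_smul]
    abel
  have r₄ : M.φ * ψ₁ + φ₁ * ψ' = y • 1 := cancel <| by
    rw [smul_add, ← Matrix.mul_smul, ← Matrix.smul_mul, eq_sub_of_add_eq' hψ.symm,
      eq_sub_of_add_eq' hφ.symm, Matrix.mul_sub, Matrix.sub_mul, hφψ, MM, mul_smul]
    abel
  refine ⟨?_, r₁, r₂⟩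
  obtain ⟨h₀, h₁, e₀, e₁⟩ := hM
  have e₀ : M.ψ * h₀ + h₁ * M.φ = x • 1 := e₀.symm
  have e₁ : M.φ * h₁ + h₀ * M.ψ = x • 1 := e₁.symm
  have iφ : (Matrix.fromBlocks (x • 1) φ' (-ψ') (y • 1) : Matrix (M.ι₁ ⊕ M.ι₀) (M.ι₁ ⊕ M.ι₀) B) *
      Matrix.fromRows φ₁ (1 : Matrix M.ι₀ M.ι₀ B) =
      Matrix.fromRows (1 : Matrix M.ι₁ M.ι₁ B) ψ₁ * M.φ := by
    rw [Matrix.fromBlocks_mul_fromRows, Matrix.fromRows_mul]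
    congr 1
    · rw [hφ]; simp [add_comm]
    · rw [eq_sub_of_add_eq' r₂]; simp [sub_eq_neg_add]
  have iψ : (Matrix.fromBlocks (y • 1) (-φ') (- -ψ') (x • 1) : Matrix (M.ι₁ ⊕ M.ι₀) (M.ι₁ ⊕ M.ι₀)
      B) * Matrix.fromRows (1 : Matrix M.ι₁ M.ι₁ B) ψ₁ =
      Matrix.fromRows φ₁ (1 : Matrix M.ι₀ M.ι₀ B) * M.ψ := by
    rw [Matrix.fromBlocks_mul_fromRows, Matrix.fromRows_mul]
    congr 1
    · rw [eq_sub_of_add_eq' r₁]; simp [sub_eq_add_neg]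
    · rw [hψ]; simp
  have rφ : M.φ * Matrix.fromCols h₁ (1 - h₁ * φ₁) =
      Matrix.fromCols (1 - h₀ * ψ₁) h₀ *
          (Matrix.fromBlocks (x • 1) φ' (-ψ') (y • 1) : Matrix (M.ι₁ ⊕ M.ι₀) (M.ι₁ ⊕ M.ι₀) B) := by
    rw [Matrix.fromCols_mul_fromBlocks, Matrix.mul_fromCols]
    congr 1
    · rw [eq_sub_of_add_eq e₁, hψ]
      simp [Matrix.mul_add, smul_sub]
      abel
    · have : h₀ * (y • (1 : Matrix M.ι₀ M.ι₀ B)) = h₀ * (M.ψ * φ₁) + h₀ * (ψ₁ * φ') := by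
        rw [← r₃, Matrix.mul_add]
      rw [this, Matrix.mul_sub, ← Matrix.mul_assoc, eq_sub_of_add_eq e₁, Matrix.sub_mul,
        Matrix.sub_mul, Matrix.mul_one, Matrix.one_mul, Matrix.smul_mul, Matrix.one_mul, hφ,
        Matrix.mul_assoc, Matrix.mul_assoc]
      abel
  have rψ : M.ψ * Matrix.fromCols (1 - h₀ * ψ₁) h₀ =
      Matrix.fromCols h₁ (1 - h₁ * φ₁) *
          (Matrix.fromBlocks (y • 1) (-φ') (- -ψ') (x • 1) : Matrix (M.ι₁ ⊕ M.ι₀) (M.ι₁ ⊕ M.ι₀) B)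
              := by
    rw [Matrix.fromCols_mul_fromBlocks, Matrix.mul_fromCols]
    congr 1
    · have : h₁ * (y • (1 : Matrix M.ι₁ M.ι₁ B)) = h₁ * (M.φ * ψ₁) + h₁ * (φ₁ * ψ') := by
        rw [← r₄, Matrix.mul_add]
      rw [this, neg_neg, Matrix.mul_sub, ← Matrix.mul_assoc, eq_sub_of_add_eq e₀, Matrix.sub_mul,
        Matrix.sub_mul, Matrix.mul_one, Matrix.one_mul, Matrix.smul_mul, Matrix.one_mul, hψ,
        Matrix.mul_assoc, Matrix.mul_assoc]
      abel
    · rw [eq_sub_of_add_eq e₀, hφ]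
      simp [Matrix.mul_add, smul_sub]
      abel
  -- The inclusion is built from the quotients φ₁, ψ₁ and the retraction from the homotopy h for x;
  -- the entries 1 - h₁φ₁ and 1 - h₀ψ₁ make the composite strictly the identity.
  refine ⟨⟨⟨Matrix.fromRows φ₁ (1 : Matrix M.ι₀ M.ι₀ B),
      Matrix.fromRows (1 : Matrix M.ι₁ M.ι₁ B) ψ₁, iφ, iψ⟩,
    ⟨Matrix.fromCols h₁ (1 - h₁ * φ₁), Matrix.fromCols (1 - h₀ * ψ₁) h₀, rφ, rψ⟩, ?_⟩⟩
  have k₀ : Matrix.fromCols h₁ (1 - h₁ * φ₁) * Matrix.fromRows φ₁ (1 : Matrix M.ι₀ M.ι₀ B) = 1 := by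
    rw [Matrix.fromCols_mul_fromRows]; simp
  have k₁ : Matrix.fromCols (1 - h₀ * ψ₁) h₀ * Matrix.fromRows (1 : Matrix M.ι₁ M.ι₁ B) ψ₁ = 1 := by
    rw [Matrix.fromCols_mul_fromRows]; simp
  exact hom_ext k₀ k₁

/-- The object attached to `(P, -Q)` for the pair `(y, 0)` is the cone of multiplication by `y` on
`(P, Q)`. -/
def thetaGenZeroIso {p : B} (y : B) (hp : p = y * 0 - -p) (L : MF p) :
    thetaGenObj hp (signObj rfl L) ≅ cone (scal y L) :=
  isoMk (M := thetaGenObj hp (signObj rfl L)) (N := cone (scal y L))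
    ⟨BlockAux.swap B L.ι₀ L.ι₁, (1 : Matrix (L.ι₁ ⊕ L.ι₀) (L.ι₁ ⊕ L.ι₀) B), by
      change Matrix.fromBlocks L.φ (y • 1) 0 (-L.ψ) * Matrix.fromBlocks 0 1 1 0 =
        1 * Matrix.fromBlocks (y • 1) L.φ (-L.ψ) ((0 : B) • 1)
      rw [Matrix.fromBlocks_multiply]; simp, by
      change Matrix.fromBlocks L.ψ (y • 1) 0 (-L.φ) * (1 : Matrix (L.ι₁ ⊕ L.ι₀) (L.ι₁ ⊕ L.ι₀) B) =
        Matrix.fromBlocks 0 1 1 0 * Matrix.fromBlocks ((0 : B) • 1) (-L.φ) (- -L.ψ) (y • 1)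
      rw [Matrix.fromBlocks_multiply]; simp⟩
    (BlockAux.swap B L.ι₁ L.ι₀) (1 : Matrix (L.ι₁ ⊕ L.ι₀) (L.ι₁ ⊕ L.ι₀) B)
    BlockAux.swap_mul_swap BlockAux.swap_mul_swap (Matrix.one_mul _) (Matrix.one_mul _)

/-- Used to see that y, which need not be null-homotopic on L, becomes so after `thetaGen`. -/
theorem thetaGen_map_scal {x y p : B} (hw : w = x * y - p) (b : B) (L : MF p) :
    (thetaGen hw).map (scal b L) = scal b (thetaGenObj hw L) :=
  hom_ext (smul_one_eq_fromBlocks b).symm (smul_one_eq_fromBlocks b).symm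

end MF

/-! ### Differentiating the potential. -/

noncomputable section

open MvPowerSeries

variable {A : Type u} [CommRing A] {p : A} {w : PS₂ A}

theorem PS₂.matrix_pderiv_mul (i : Fin 2) {l m n : Type} [Fintype m] (P : Matrix l m (PS₂ A))
    (Q : Matrix m n (PS₂ A)) : (P * Q).map (pderiv A i) =
      P.map (pderiv A i) * Q + P * Q.map (pderiv A i) := by
  ext a b
  simp [Matrix.mul_apply, Finset.sum_add_distrib, Derivation.leibniz]
  rw [add_comm]
  congr 1
  exact Finset.sum_congr rfl fun _ _ => congrArg _ (mul_comm _ _)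

namespace MF

theorem smul_one_map_pderiv {m : Type} [DecidableEq m] (hw : w = X 0 * X 1 - C p) :
    (w • (1 : Matrix m m (PS₂ A))).map (pderiv A 1) = (X 0 : PS₂ A) • 1 := by
  ext1 a b
  by_cases h : a = b
  · subst h
    simp [hw, Derivation.leibniz]
  · simp [h]

/-- Differentiating ψφ = w and φψ = w with respect to y exhibits ∂w/∂y = x as a boundary, the
homotopy being the derivative of the operators. -/
theorem null_scal_X_zero (hw : w = X 0 * X 1 - C p) (M : MF w) : Null (scal (X 0) M) := by
  have h₀ := congrArg (fun P => P.map (pderiv A 1)) M.ψ_mul_φ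
  have h₁ := congrArg (fun P => P.map (pderiv A 1)) M.φ_mul_ψ
  simp only [PS₂.matrix_pderiv_mul, smul_one_map_pderiv hw] at h₀ h₁
  refine ⟨M.φ.map (pderiv A 1), M.ψ.map (pderiv A 1), ?_, ?_⟩
  · rw [add_comm, h₀]; rfl
  · rw [add_comm, h₁]; rfl

end MF

end

/-! ### Reduction modulo x, then y, and essential surjectivity. -/

noncomputable section

open MvPowerSeries

variable {A : Type u} [CommRing A] {p : A} {w : PS₂ A}

namespace PS₂

/-- Setting the first variable to zero. -/
def evalZero : PS₂ A →+* PS₂ A := rescale ![0, 1]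

@[simp] theorem evalZero_C (a : A) : evalZero (C a) = C a := by
  classical
  ext n
  by_cases h : n = 0 <;> simp [evalZero, coeff_rescale, coeff_C, h]

@[simp] theorem evalZero_X_zero : evalZero (X 0 : PS₂ A) = 0 := by
  classical
  ext n
  by_cases h : n = Finsupp.single 0 1 <;> simp [evalZero, coeff_rescale, coeff_X, h]

@[simp] theorem evalZero_X_one : evalZero (X 1 : PS₂ A) = X 1 := by
  classical
  ext n
  by_cases h : n = Finsupp.single 1 1 <;> simp [evalZero, coeff_rescale, coeff_X, h]

@[simp] theorem evalZero_evalZero (f : PS₂ A) : evalZero (evalZero f) = evalZero f := by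
  simp only [evalZero]
  rw [rescale_rescale]
  congr 2
  ext i
  fin_cases i <;> simp

end PS₂

namespace MF

theorem map_mul_eq_neg {B B' : Type u} [CommRing B] [CommRing B'] (ρ : B →+* B') {w : B} {c : B'}
    (hρ : ρ w = -c) {m n : Type} [Fintype n] [DecidableEq m] {P : Matrix m n B} {Q : Matrix n m B}
    (h : P * Q = w • 1) : P.map ρ * Q.map ρ = -(c • 1) := by
  rw [← Matrix.map_mul, h]
  ext i j
  by_cases e : i = j
  · subst e; simp [hρ]
  · simp [e]

theorem map_smul_one {B B' : Type u} [CommRing B] [CommRing B'] (ρ : B →+* B') (b : B) {m : Type}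
    [DecidableEq m] : (b • (1 : Matrix m m B)).map ρ = ρ b • 1 := by
  ext i j
  by_cases e : i = j
  · subst e; simp
  · simp [e]

theorem map_C_map_constantCoeff_congr {m n : Type} (P : Matrix m n (PS₂ A)) :
    ∃ Q : Matrix m n (PS₂ A),
      P.map PS₂.evalZero = (P.map constantCoeff).map (C (σ := Fin 2) (R := A)) +
        (X 1 : PS₂ A) • Q := by
  obtain ⟨Q, hQ⟩ := exists_smul_of_dvd (x := (X 1 : PS₂ A))
    (P.map PS₂.evalZero - (P.map constantCoeff).map (C (σ := Fin 2) (R := A)))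
    fun i j => PS₂.X_one_dvd_rescale_sub (P i j)
  exact ⟨Q, by rw [← hQ]; abel⟩

theorem exists_map_evalZero_congr {m n : Type} (P : Matrix m n (PS₂ A)) :
    ∃ Q : Matrix m n (PS₂ A), P = P.map PS₂.evalZero + (X 0 : PS₂ A) • Q := by
  obtain ⟨Q, hQ⟩ := exists_smul_of_dvd (x := (X 0 : PS₂ A)) (P - P.map PS₂.evalZero)
    fun i j => PS₂.X_zero_dvd_sub_rescale (P i j)
  exact ⟨Q, by rw [← hQ]; abel⟩

theorem neg_mul_map {l m : Type} [Fintype m] {c : A} [DecidableEq l] {P : Matrix l m A}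
    {Q : Matrix m l A} (h : P * Q = -(c • 1)) : P * -Q = c • 1 ∧ -P * Q = c • 1 := by
  rw [Matrix.mul_neg, Matrix.neg_mul, h, neg_neg]
  exact ⟨rfl, rfl⟩

/-- Every factorization of `x y - p` over `A[[x, y]]` is a retract, up to homotopy, of one in the
image
of `θ`. -/
theorem exists_retract_theta (hw : w = X 0 * X 1 - C p) (Y : MF w) :
    ∃ Z : MF p, Nonempty (Retract ((HMF.proj w).obj Y) ((HMF.proj w).obj ((theta hw).obj Z))) := by
  have e₁ : PS₂.evalZero w = -C p := by simp [hw]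
  have c₁ : constantCoeff w = -p := by simp [hw]
  have hφψ := map_mul_eq_neg PS₂.evalZero e₁ Y.φ_mul_ψ
  have hψφ := map_mul_eq_neg PS₂.evalZero e₁ Y.ψ_mul_φ
  obtain ⟨φ₁, hφ₁⟩ := exists_map_evalZero_congr Y.φ
  obtain ⟨ψ₁, hψ₁⟩ := exists_map_evalZero_congr Y.ψ
  -- First reduction, setting x = 0: Y is a retract of the object attached to N below.
  obtain ⟨⟨r⟩, r₁, r₂⟩ := nonempty_retract_thetaGen hw (fun _ _ => PS₂.X_mul_cancel 0) Y
    (null_scal_X_zero hw Y) _ _ _ _ hφ₁ hψ₁ hφψ hψφ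
    (neg_mul_map hφψ (l := Y.ι₁)).1 (neg_mul_map hψφ (l := Y.ι₀)).2
  let N : MF (C p : PS₂ A) := ⟨Y.ι₀, Y.ι₁, Y.φ.map PS₂.evalZero, -Y.ψ.map PS₂.evalZero,
    (neg_mul_map hφψ (l := Y.ι₁)).1, (neg_mul_map hψφ (l := Y.ι₀)).2⟩
  have hφψ₀ := map_mul_eq_neg constantCoeff c₁ Y.φ_mul_ψ
  have hψφ₀ := map_mul_eq_neg constantCoeff c₁ Y.ψ_mul_φ
  let L₀ : MF p := ⟨Y.ι₀, Y.ι₁, Y.φ.map constantCoeff, -Y.ψ.map constantCoeff,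
    (neg_mul_map hφψ₀ (l := Y.ι₁)).1, (neg_mul_map hψφ₀ (l := Y.ι₀)).2⟩
  let L : MF (C p : PS₂ A) := baseChangeObj (C (σ := Fin 2) (R := A)) rfl L₀
  -- Setting x = 0 in the relations r₁, r₂ gives a homotopy for y; one component changes sign
  -- because the odd operator of N is minus the reduction of that of Y.
  have hN : Null (scal (X 1) N) := by
    have q₁ := congrArg (fun P => P.map PS₂.evalZero) r₁
    have q₂ := congrArg (fun P => P.map PS₂.evalZero) r₂
    simp only [Matrix.map_add _ (map_add PS₂.evalZero), Matrix.map_mul, map_smul_one,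
      PS₂.evalZero_X_one, Matrix.map_map] at q₁ q₂
    have ee : ((PS₂.evalZero : PS₂ A →+* PS₂ A) ∘ PS₂.evalZero) = PS₂.evalZero :=
      funext PS₂.evalZero_evalZero
    rw [ee] at q₁ q₂
    refine ⟨-φ₁.map PS₂.evalZero, ψ₁.map PS₂.evalZero, ?_, ?_⟩
    · exact q₂.symm.trans (congrArg (· + _) (BlockAux.neg_mul_neg' _ _).symm)
    · exact q₁.symm.trans (congrArg (_ + ·) (BlockAux.neg_mul_neg' _ _).symm)
  obtain ⟨φ₂, hφ₂⟩ := map_C_map_constantCoeff_congr Y.φ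
  obtain ⟨ψ₂, hψ₂⟩ := map_C_map_constantCoeff_congr Y.ψ
  -- The potential of N has no xy term, so it is read as that of the pair (y, 0) over -p; the same
  -- retract lemma then applies with y in the role of x.
  have hp : (C p : PS₂ A) = X 1 * 0 - -C p := by simp
  obtain ⟨⟨s⟩, -⟩ := nonempty_retract_thetaGen hp (fun _ _ => PS₂.X_mul_cancel 1) N hN
    L.φ φ₂ L.ψ (-ψ₂) hφ₂
    (by
      change -Y.ψ.map PS₂.evalZero = (-Y.ψ.map constantCoeff).map _ + (X 1 : PS₂ A) • -ψ₂
      rw [hψ₂, map_neg_ringHom, smul_neg, neg_add])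
    (by rw [neg_smul, neg_neg]; exact L.φ_mul_ψ) (by rw [neg_smul, neg_neg]; exact L.ψ_mul_φ)
    (signObj rfl L).φ_mul_ψ (signObj rfl L).ψ_mul_φ
  let s' : Retract N (cone (scal (X 1) L)) := s.trans (Retract.ofIso (thetaGenZeroIso _ hp L))
  -- After `thetaGen`, multiplication by y is null-homotopic, so its cone is isomorphic to the cone
  -- of zero, which already comes from A.
  have z₁ : (HMF.proj w).map ((thetaGen hw).map (scal (X 1) L)) = 0 := by
    rw [proj_map_eq_zero_iff, thetaGen_map_scal]
    exact null_scal_thetaGen_right hw L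
  have z₂ : (HMF.proj w).map ((theta hw).map (0 : L₀ ⟶ L₀)) = 0 := by
    rw [(theta hw).map_zero]; exact (HMF.proj w).map_zero _ _
  obtain ⟨c, -⟩ := HMF.exists_cone_iso (f := (thetaGen hw).map (scal (X 1) L))
    (f' := (theta hw).map (0 : L₀ ⟶ L₀)) (Iso.refl _) (Iso.refl _)
    ((Category.comp_id _).trans ((z₁.trans z₂.symm).trans (Category.id_comp _).symm))
  exact ⟨cone (0 : L₀ ⟶ L₀), ⟨(r.map (HMF.proj w)).trans
    (((s'.map (thetaGen hw)).map (HMF.proj w)).trans (Retract.ofIso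
      ((HMF.proj w).mapIso ((thetaGenCone hw).κ _) ≪≫ c ≪≫
        ((HMF.proj w).mapIso ((thetaCone hw).κ _)).symm)))⟩⟩

end MF

/-- A fully faithful functor from an idempotent complete category is essentially surjective when
every
object is a retract of one in the image. -/
theorem CategoryTheory.Functor.essSurj_of_retract {C : Type*} [Category C] {D : Type*} [Category D]
    [IsIdempotentComplete C] (F : C ⥤ D) [F.Full] [F.Faithful]
    (h : ∀ Y : D, ∃ Z : C, Nonempty (Retract Y (F.obj Z))) : F.EssSurj where
  mem_essImage Y := by
    obtain ⟨Z, ⟨r⟩⟩ := h Y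
    -- The idempotent of D with image Y lifts to C, where it is idempotent by faithfulness; the
    -- image of its splitting is another splitting, hence isomorphic to Y.
    obtain ⟨e, he⟩ := F.map_surjective (r.r ≫ r.i)
    obtain ⟨W, i, s, h₁, h₂⟩ := IsIdempotentComplete.idempotents_split Z e
      (F.map_injective (by simp [he]))
    refine ⟨W, ⟨F.map i ≫ r.r, r.i ≫ F.map s, ?_, ?_⟩⟩
    · have := F.congr_map h₁
      rw [Category.assoc, ← Category.assoc r.r, ← he, ← F.map_comp, ← F.map_comp, ← h₂]
      simp [h₁]
    · rw [Category.assoc, ← Category.assoc (F.map s), ← F.map_comp, h₂, he]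
      simp

/-! ### θ and its squares as triangle equivalences. -/

namespace HMF

theorem theta_isEquivalence (hw : w = X 0 * X 1 - C p) [IsIdempotentComplete (HMF p)] :
    (HMF.theta hw).IsEquivalence := by
  have := HMF.theta_full hw
  have := HMF.theta_faithful hw
  have := (HMF.theta hw).essSurj_of_retract fun Y => by
    obtain ⟨Z, h⟩ := MF.exists_retract_theta hw Y.as
    exact ⟨(proj p).obj Z, h⟩
  exact {}

theorem theta_isTriangleEquivalence (hw : w = X 0 * X 1 - C p) [IsIdempotentComplete (HMF p)] :
    IsTriangleEquivalence (distTriangles p) (distTriangles w) (HMF.theta hw) :=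
  isTriangleEquivalence_lift (MF.theta hw) (MF.theta_homotopic hw) (MF.thetaCone hw)
    (HMF.theta_isEquivalence hw)

end HMF

theorem CategoryTheory.Functor.isIdempotentComplete_of_isEquivalence {C : Type*} [Category C]
    {D : Type*} [Category D] [h : IsIdempotentComplete C] (F : C ⥤ D) [F.IsEquivalence] :
    IsIdempotentComplete D :=
  Idempotents.Equivalence.isIdempotentComplete F.asEquivalence h

namespace HMF

/-- Idempotent completeness is assumed for p only: the first equivalence carries it to xy - p, as
the second application of θ requires. -/
theorem thetaSq_isTriangleEquivalence (p : A) [IsIdempotentComplete (HMF p)] :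
    IsTriangleEquivalence (distTriangles p) (distTriangles (knorrer (knorrer p)))
      (HMF.thetaSq p) := by
  have := HMF.theta_isEquivalence (w := knorrer p) rfl
  have := (HMF.theta (w := knorrer p) rfl).isIdempotentComplete_of_isEquivalence
  exact (theta_isTriangleEquivalence rfl).comp (theta_isTriangleEquivalence rfl)

theorem thetaSqSign_isTriangleEquivalence (p : A) [IsIdempotentComplete (HMF p)] :
    IsTriangleEquivalence (distTriangles p) (distTriangles (doubleKnorrer p))
      (HMF.thetaSqSign p) := by
  have := HMF.theta_isEquivalence (w := knorrer p) rfl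
  have := (HMF.theta (w := knorrer p) rfl).isIdempotentComplete_of_isEquivalence
  have := HMF.sign_isEquivalence (w := knorrer p) rfl
  have := (HMF.sign (w := knorrer p) rfl).isIdempotentComplete_of_isEquivalence
  exact (theta_isTriangleEquivalence rfl).comp ((sign_isTriangleEquivalence rfl).comp
    (theta_isTriangleEquivalence _))

end HMF

end

/-! ### Matrices over local rings -/

namespace Matrix

variable {B : Type u} [CommRing B]

/-- The entries of `P` lie in the ideal `J`. -/
def EntriesIn {m n : Type*} (J : Ideal B) (P : Matrix m n B) : Prop := ∀ i j, P i j ∈ J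

namespace EntriesIn

variable {l m n : Type*} {J K : Ideal B} {P Q : Matrix m n B}

theorem add (hP : EntriesIn J P) (hQ : EntriesIn J Q) : EntriesIn J (P + Q) :=
  fun i j => J.add_mem (hP i j) (hQ i j)

theorem neg (hP : EntriesIn J P) : EntriesIn J (-P) :=
  fun i j => J.neg_mem (hP i j)

theorem sub (hP : EntriesIn J P) (hQ : EntriesIn J Q) : EntriesIn J (P - Q) :=
  fun i j => J.sub_mem (hP i j) (hQ i j)

theorem mono (h : J ≤ K) (hP : EntriesIn J P) : EntriesIn K P := fun i j => h (hP i j)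

theorem mul_mul [Fintype m] {P : Matrix l m B} {Q : Matrix m n B} (hP : EntriesIn J P)
    (hQ : EntriesIn K Q) : EntriesIn (J * K) (P * Q) :=
  fun i j => sum_mem fun k _ => Ideal.mul_mem_mul (hP i k) (hQ k j)

theorem mul_right [Fintype m] {P : Matrix l m B} (hP : EntriesIn J P) (Q : Matrix m n B) :
    EntriesIn J (P * Q) :=
  fun i _ => sum_mem fun k _ => J.mul_mem_right _ (hP i k)

theorem mul_left [Fintype m] (P : Matrix l m B) {Q : Matrix m n B} (hQ : EntriesIn J Q) :
    EntriesIn J (P * Q) :=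
  fun _ j => sum_mem fun k _ => J.mul_mem_left _ (hQ k j)

end EntriesIn

/-- Over a local ring idempotent matrices split. -/
theorem exists_factor_of_mul_self [IsLocalRing B] {m : Type} [Fintype m] [DecidableEq m]
    (E : Matrix m m B) (h : E * E = E) :
    ∃ (r : ℕ) (U : Matrix m (Fin r) B) (V : Matrix (Fin r) m B), V * U = 1 ∧ U * V = E := by
  let f := Matrix.toLin' E
  have hf : ∀ x, f (f x) = f x := fun x => by
    rw [← LinearMap.comp_apply, ← Matrix.toLin'_mul, h]
  have hs : f.rangeRestrict ∘ₗ (LinearMap.range f).subtype = LinearMap.id := by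
    ext1 ⟨_, x, rfl⟩
    exact Subtype.ext (hf x)
  -- The image of an idempotent is a direct summand of a free module, hence projective, and so free
  -- over the local ring.
  have : Module.Projective B (LinearMap.range f) := Module.Projective.of_split _ _ hs
  have : Module.Free B (LinearMap.range f) := Module.free_of_flat_of_isLocalRing
  let b := Module.finBasis B (LinearMap.range f)
  refine ⟨_, LinearMap.toMatrix b (Pi.basisFun B m) (LinearMap.range f).subtype,
    LinearMap.toMatrix (Pi.basisFun B m) b f.rangeRestrict, ?_, ?_⟩
  · rw [← LinearMap.toMatrix_comp, hs, LinearMap.toMatrix_id]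
  · rw [← LinearMap.toMatrix_comp]
    have : (LinearMap.range f).subtype ∘ₗ f.rangeRestrict = f := rfl
    rw [this]
    exact LinearMap.toMatrix'_toLin' E

/-- The determinant is 1 in the residue field. -/
theorem isUnit_of_entriesIn_sub_one [IsLocalRing B] {m : Type} [Fintype m] [DecidableEq m]
    {P : Matrix m m B} (h : EntriesIn (IsLocalRing.maximalIdeal B) (P - 1)) : IsUnit P := by
  rw [Matrix.isUnit_iff_isUnit_det]
  apply isUnit_of_map_unit (IsLocalRing.residue B)
  have : (IsLocalRing.residue B).mapMatrix P = 1 := by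
    ext i j
    have := (IsLocalRing.residue_eq_zero_iff _).2 (h i j)
    rw [Matrix.sub_apply, map_sub, sub_eq_zero] at this
    rw [RingHom.mapMatrix_apply, Matrix.map_apply, this]
    by_cases e : i = j
    · subst e; simp
    · simp [e]
  rw [RingHom.map_det, this, Matrix.det_one]
  exact isUnit_one

/-- U is injective, so its rank is at most that of the target; equality would make the left inverse
V two-sided. -/
theorem card_lt_of_mul_eq_one [Nontrivial B] {m n : Type} [Fintype m] [Fintype n] [DecidableEq m]
    [DecidableEq n] {U : Matrix m n B} {V : Matrix n m B} (h : V * U = 1) (h' : U * V ≠ 1) :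
    Fintype.card n < Fintype.card m := by
  refine lt_of_le_of_ne ?_ fun e => h' ((Matrix.mul_eq_one_comm_of_card_eq _ _ _ e).1 h)
  refine card_le_of_injective B U.mulVecLin fun x y hxy => ?_
  have := congrArg V.mulVecLin hxy
  simpa [Matrix.mulVec_mulVec, h] using this

end Matrix

open Matrix (EntriesIn)

/-! ### Minimal factorizations -/

namespace MF

variable {B : Type u} [CommRing B] {w : B}

theorem isIso_of_isUnit {M N : MF w} (f : M ⟶ N) (S' : Matrix M.ι₀ N.ι₀ B)
    (T' : Matrix M.ι₁ N.ι₁ B) (hS : S' * f.S = 1) (hS' : f.S * S' = 1) (hT : T' * f.T = 1)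
    (hT' : f.T * T' = 1) : IsIso f :=
  (isoMk f S' T' hS hS' hT hT').isIso_hom

variable [IsLocalRing B]

/-- Strict idempotents split. -/
theorem exists_split {M : MF w} (e : M ⟶ M) (h : e ≫ e = e) :
    ∃ (N : MF w) (i : N ⟶ M) (r : M ⟶ N), i ≫ r = 𝟙 N ∧ r ≫ i = e := by
  obtain ⟨m, U, V, hVU, hUV⟩ := Matrix.exists_factor_of_mul_self e.S (congrArg Hom.S h)
  obtain ⟨n, U', V', hVU', hUV'⟩ := Matrix.exists_factor_of_mul_self e.T (congrArg Hom.T h)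
  have c₀ : M.φ * (U * V) = U' * V' * M.φ := by rw [hUV, hUV', e.φ_comm]
  have c₁ : M.ψ * (U' * V') = U * V * M.ψ := by rw [hUV, hUV', e.ψ_comm]
  -- The operators on the image are the compressions of φ and ψ; because e is closed, φ and ψ carry
  -- the image of one component into that of the other.
  have k₀ : (V' * M.φ * U) * (V * M.ψ * U') = w • 1 := by
    calc (V' * M.φ * U) * (V * M.ψ * U') = V' * (M.φ * (U * V)) * M.ψ * U' := by
          simp only [Matrix.mul_assoc]
      _ = (V' * U') * V' * (M.φ * M.ψ) * U' := by rw [c₀]; simp only [Matrix.mul_assoc]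
      _ = w • 1 := by rw [hVU', M.φ_mul_ψ]; simp [hVU']
  have k₁ : (V * M.ψ * U') * (V' * M.φ * U) = w • 1 := by
    calc (V * M.ψ * U') * (V' * M.φ * U) = V * (M.ψ * (U' * V')) * M.φ * U := by
          simp only [Matrix.mul_assoc]
      _ = (V * U) * V * (M.ψ * M.φ) * U := by rw [c₁]; simp only [Matrix.mul_assoc]
      _ = w • 1 := by rw [hVU, M.ψ_mul_φ]; simp [hVU]
  have i₀ : M.φ * U = U' * (V' * M.φ * U) := by
    calc M.φ * U = M.φ * (U * V) * U := by rw [Matrix.mul_assoc, Matrix.mul_assoc, hVU]; simp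
      _ = _ := by rw [c₀]; simp only [Matrix.mul_assoc]
  have i₁ : M.ψ * U' = U * (V * M.ψ * U') := by
    calc M.ψ * U' = M.ψ * (U' * V') * U' := by
          rw [Matrix.mul_assoc, Matrix.mul_assoc, hVU']; simp
      _ = _ := by rw [c₁]; simp only [Matrix.mul_assoc]
  have r₀ : (V' * M.φ * U) * V = V' * M.φ := by
    calc (V' * M.φ * U) * V = V' * (M.φ * (U * V)) := by simp only [Matrix.mul_assoc]
      _ = (V' * U') * V' * M.φ := by rw [c₀]; simp only [Matrix.mul_assoc]
      _ = _ := by rw [hVU', Matrix.one_mul]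
  have r₁ : (V * M.ψ * U') * V' = V * M.ψ := by
    calc (V * M.ψ * U') * V' = V * (M.ψ * (U' * V')) := by simp only [Matrix.mul_assoc]
      _ = (V * U) * V * M.ψ := by rw [c₁]; simp only [Matrix.mul_assoc]
      _ = _ := by rw [hVU, Matrix.one_mul]
  exact ⟨⟨Fin m, Fin n, V' * M.φ * U, V * M.ψ * U', k₀, k₁⟩, ⟨U, U', i₀, i₁⟩, ⟨V, V', r₀, r₁⟩,
    hom_ext hVU hVU', hom_ext hUV hUV'⟩

/-- A factorization is minimal if its operators vanish modulo the maximal ideal. -/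
def IsMinimal (M : MF w) : Prop :=
  EntriesIn (IsLocalRing.maximalIdeal B) M.φ ∧ EntriesIn (IsLocalRing.maximalIdeal B) M.ψ

/-- A null-homotopic strict idempotent with nonzero even part splits off. -/
theorem exists_iso_card_lt {M : MF w} (e : M ⟶ M) (h : e ≫ e = e) (he : Null e) (hS : e.S ≠ 0) :
    ∃ N : MF w, Fintype.card N.ι₀ < Fintype.card M.ι₀ ∧
      Nonempty ((HMF.proj w).obj N ≅ (HMF.proj w).obj M) := by
  have h' : (𝟙 M - e) ≫ (𝟙 M - e) = 𝟙 M - e := by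
    simp [Preadditive.sub_comp, Preadditive.comp_sub, h]
  obtain ⟨N, i, r, hir, hri⟩ := exists_split (𝟙 M - e) h'
  -- N is the image of the complement 1 - e, homotopic to the identity because e is null; the rank
  -- drops because the even part of e is not zero.
  refine ⟨N, Matrix.card_lt_of_mul_eq_one (congrArg Hom.S hir) fun hc => hS ?_,
    ⟨(HMF.proj w).map i, (HMF.proj w).map r, ?_, ?_⟩⟩
  · have := (sub_S (𝟙 M) e).symm.trans ((congrArg Hom.S hri).symm.trans hc)
    exact sub_eq_self.1 this
  · rw [← (HMF.proj w).map_comp, hir, (HMF.proj w).map_id]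
  · rw [← (HMF.proj w).map_comp, hri, (HMF.proj w).map_sub, (proj_map_eq_zero_iff e).2 he, sub_zero,
      (HMF.proj w).map_id]

theorem exists_iso_card_lt_of_not_isMinimal {M : MF w} (hM : ¬ M.IsMinimal) :
    ∃ N : MF w, Fintype.card N.ι₀ < Fintype.card M.ι₀ ∧
      Nonempty ((HMF.proj w).obj N ≅ (HMF.proj w).obj M) := by
  have key : ∀ {m n : Type} [Fintype m] [Fintype n] [DecidableEq m] [DecidableEq n]
      (P : Matrix m n B), ¬ EntriesIn (IsLocalRing.maximalIdeal B) P →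
      ∃ h : Matrix n m B, h * P * h = h ∧ h * P ≠ 0 ∧ P * h ≠ 0 := by
    intro m n _ _ _ _ P hP
    simp only [EntriesIn, not_forall, IsLocalRing.mem_maximalIdeal, mem_nonunits_iff, not_not] at hP
    obtain ⟨i, j, ⟨a, ha⟩⟩ := hP
    -- A unit entry a at (i, j) yields a matrix h with hPh = h, so hP and Ph are nonzero
    -- idempotents; they become the components of a boundary.
    refine ⟨Matrix.single j i ↑a⁻¹, ?_, fun h0 => ?_, fun h0 => ?_⟩
    · rw [Matrix.single_mul_mul_single, ← ha]; simp
    · have := congrFun (congrFun h0 j) j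
      simp [← ha] at this
    · have := congrFun (congrFun h0 i) i
      simp [← ha] at this
  rw [IsMinimal, not_and_or] at hM
  rcases hM with hM | hM
  · obtain ⟨h, h₁, h₂, -⟩ := key _ hM
    refine exists_iso_card_lt (bdry 0 h) (hom_ext ?_ ?_) (null_bdry _ _) ?_
    · change (M.ψ * 0 + h * M.φ) * (M.ψ * 0 + h * M.φ) = M.ψ * 0 + h * M.φ
      rw [Matrix.mul_zero, zero_add, ← Matrix.mul_assoc, h₁]
    · change (M.φ * h + 0 * M.ψ) * (M.φ * h + 0 * M.ψ) = M.φ * h + 0 * M.ψ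
      rw [Matrix.zero_mul, add_zero, Matrix.mul_assoc, ← Matrix.mul_assoc h, h₁]
    · change M.ψ * 0 + h * M.φ ≠ 0
      rwa [Matrix.mul_zero, zero_add]
  · obtain ⟨h, h₁, -, h₂⟩ := key _ hM
    refine exists_iso_card_lt (bdry h 0) (hom_ext ?_ ?_) (null_bdry _ _) ?_
    · change (M.ψ * h + 0 * M.φ) * (M.ψ * h + 0 * M.φ) = M.ψ * h + 0 * M.φ
      rw [Matrix.zero_mul, add_zero, Matrix.mul_assoc, ← Matrix.mul_assoc h, h₁]
    · change (M.φ * 0 + h * M.ψ) * (M.φ * 0 + h * M.ψ) = M.φ * 0 + h * M.ψ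
      rw [Matrix.mul_zero, zero_add, ← Matrix.mul_assoc, h₁]
    · change M.ψ * h + 0 * M.φ ≠ 0
      rwa [Matrix.zero_mul, add_zero]

/-- Every factorization is homotopy equivalent to a minimal one. -/
theorem exists_isMinimal_iso (M : MF w) :
    ∃ N : MF w, N.IsMinimal ∧ Nonempty ((HMF.proj w).obj N ≅ (HMF.proj w).obj M) := by
  by_cases hM : M.IsMinimal
  · exact ⟨M, hM, ⟨Iso.refl _⟩⟩
  · obtain ⟨M', hlt, ⟨i⟩⟩ := exists_iso_card_lt_of_not_isMinimal hM
    obtain ⟨N, hN, ⟨j⟩⟩ := exists_isMinimal_iso M'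
    exact ⟨N, hN, ⟨j ≪≫ i⟩⟩
termination_by Fintype.card M.ι₀

/-- Every term of a boundary contains a factor φ or ψ of one of the two minimal factorizations. -/
theorem entriesIn_of_null {M N : MF w} (hM : M.IsMinimal) (hN : N.IsMinimal) {f : M ⟶ N}
    (h : Null f) : EntriesIn (IsLocalRing.maximalIdeal B) f.S ∧
      EntriesIn (IsLocalRing.maximalIdeal B) f.T := by
  obtain ⟨h₀, h₁, e₀, e₁⟩ := h
  rw [e₀, e₁]
  exact ⟨(hN.2.mul_right _).add (hM.1.mul_left _), (hN.1.mul_right _).add (hM.2.mul_left _)⟩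

theorem isIso_of_entriesIn {M : MF w} {f : M ⟶ M}
    (h₀ : EntriesIn (IsLocalRing.maximalIdeal B) (f.S - 1))
    (h₁ : EntriesIn (IsLocalRing.maximalIdeal B) (f.T - 1)) : IsIso f := by
  obtain ⟨S, hS⟩ := Matrix.isUnit_of_entriesIn_sub_one h₀
  obtain ⟨T, hT⟩ := Matrix.isUnit_of_entriesIn_sub_one h₁
  apply isIso_of_isUnit f ↑S⁻¹ ↑T⁻¹ <;> simp [← hS, ← hT]

/-- A homotopy equivalence between minimal factorizations is a strict isomorphism. -/
theorem isIso_of_isIso_proj {M N : MF w} (hM : M.IsMinimal) (hN : N.IsMinimal) (f : M ⟶ N)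
    [IsIso ((HMF.proj w).map f)] : IsIso f := by
  obtain ⟨g, hg⟩ := HMF.exists_proj_map (inv ((HMF.proj w).map f))
  -- An endomorphism homotopic to the identity is congruent to it modulo the maximal ideal, hence
  -- invertible.
  have key : ∀ {X : MF w} (_ : X.IsMinimal) (u : X ⟶ X), (HMF.proj w).map u = 𝟙 _ → IsIso u := by
    intro X hX u hu
    have : Null (u - 𝟙 X) := by
      rw [← proj_map_eq_zero_iff, (HMF.proj w).map_sub, hu, (HMF.proj w).map_id, sub_self]
    have := entriesIn_of_null hX hX this
    rw [sub_S, sub_T] at this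
    exact isIso_of_entriesIn this.1 this.2
  have := key hM (f ≫ g) (by rw [(HMF.proj w).map_comp, hg, IsIso.hom_inv_id])
  have := key hN (g ≫ f) (by rw [(HMF.proj w).map_comp, hg, IsIso.inv_hom_id])
  exact isIso_of_comp_isIso f g

end MF

/-! ### Idempotents in the homotopy category -/

section Newton

variable {R : Type*} [Ring R]

/-- One step of Newton's iteration for the equation `e ^ 2 = e`. -/
def newtonStep (e : R) : R := 3 * e ^ 2 - 2 * e ^ 3

theorem newtonStep_sub_self (e : R) : newtonStep e - e = -((e * e - e) * (2 * e - 1)) := by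
  unfold newtonStep; noncomm_ring

/-- The defect e² - e is squared at each step, up to a factor. -/
theorem newtonStep_mul_self_sub (e : R) : newtonStep e * newtonStep e - newtonStep e =
    (e * e - e) * (e * e - e) * ((2 * e - 3) * (2 * e + 1)) := by
  unfold newtonStep; noncomm_ring

end Newton

namespace Matrix

variable {B : Type u} [CommRing B] {J : Ideal B}

theorem EntriesIn.eq_of_pow [IsHausdorff J B] {m n : Type*} {P Q : Matrix m n B}
    (h : ∀ k, EntriesIn (J ^ k) (P - Q)) : P = Q := by
  ext i j
  rw [← sub_eq_zero]
  refine IsHausdorff.haus inferInstance (I := J) _ fun k => ?_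
  rw [SModEq.zero, smul_eq_mul, Ideal.mul_top]
  exact h k i j

theorem exists_limit [IsPrecomplete J B] {m n : Type*} (P : ℕ → Matrix m n B)
    (h : ∀ k, EntriesIn (J ^ k) (P (k + 1) - P k)) :
    ∃ L : Matrix m n B, ∀ k, EntriesIn (J ^ k) (L - P k) := by
  have key : ∀ i j, ∃ L : B, ∀ k, L - P k i j ∈ J ^ k := by
    intro i j
    obtain ⟨L, hL⟩ := IsPrecomplete.prec (I := J) inferInstance (f := fun k => P k i j) (by
      intro a b hab
      rw [SModEq.sub_mem, smul_eq_mul, Ideal.mul_top, ← neg_mem_iff, neg_sub]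
      induction b, hab using Nat.le_induction with
      | base => simp
      | succ b hab ih =>
        have := (J ^ a).add_mem (Ideal.pow_le_pow_right hab (h b i j)) ih
        rwa [Matrix.sub_apply, sub_add_sub_cancel] at this)
    refine ⟨L, fun k => ?_⟩
    have := hL k
    rw [SModEq.sub_mem, smul_eq_mul, Ideal.mul_top] at this
    rw [← neg_mem_iff, neg_sub]
    exact this
  choose L hL using key
  exact ⟨L, fun k i j => hL i j k⟩

/-- The step is an integral polynomial in its argument, so each approximation remains a closed
morphism. -/
theorem newtonStep_comm {m n : Type} [Fintype m] [Fintype n] [DecidableEq m] [DecidableEq n]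
    {P : Matrix n m B} {S : Matrix m m B} {T : Matrix n n B} (h : P * S = T * P) :
    P * newtonStep S = newtonStep T * P := by
  have h₂ : P * S ^ 2 = T ^ 2 * P := by
    rw [pow_two, pow_two, ← Matrix.mul_assoc, h, Matrix.mul_assoc, h, Matrix.mul_assoc]
  have h₃ : P * S ^ 3 = T ^ 3 * P := by
    rw [pow_succ S, pow_succ T, ← Matrix.mul_assoc, h₂, Matrix.mul_assoc, h, Matrix.mul_assoc]
  have e : ∀ {l : Type} [Fintype l] [DecidableEq l] (X : Matrix l l B),
      newtonStep X = (3 : ℤ) • X ^ 2 - (2 : ℤ) • X ^ 3 := by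
    intro l _ _ X
    simp [newtonStep, zsmul_eq_mul]
  rw [e, e, Matrix.mul_sub, Matrix.sub_mul, Matrix.mul_smul, Matrix.mul_smul, Matrix.smul_mul,
    Matrix.smul_mul, h₂, h₃]

/-- Convergence is quadratic, but the exponent k + 1 is enough for the limit and simpler to carry.
-/
theorem EntriesIn.newton {m : Type} [Fintype m] [DecidableEq m] {E : Matrix m m B}
    (h : EntriesIn J (E * E - E)) (k : ℕ) :
    EntriesIn (J ^ (k + 1)) (newtonStep^[k] E * newtonStep^[k] E - newtonStep^[k] E) := by
  induction k with
  | zero => simpa using h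
  | succ k ih =>
    rw [Function.iterate_succ_apply', newtonStep_mul_self_sub]
    refine ((ih.mul_mul ih).mul_right _).mono ?_
    rw [← pow_add]
    exact Ideal.pow_le_pow_right (by omega)

theorem EntriesIn.newton_sub {m : Type} [Fintype m] [DecidableEq m] {E : Matrix m m B}
    (h : EntriesIn J (E * E - E)) (k : ℕ) :
    EntriesIn (J ^ (k + 1)) (newtonStep^[k + 1] E - newtonStep^[k] E) := by
  rw [Function.iterate_succ_apply', newtonStep_sub_self]
  exact ((h.newton k).mul_right _).neg

/-- Continuity of multiplication in the adic topology. It passes both idempotency and commutation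
with the operators to the limit. -/
theorem mul_eq_of_limit [IsHausdorff J B] {l m n k : Type*} [Fintype m] [Fintype n]
    {P : Matrix l m B} {Q : Matrix m k B} {P' : Matrix l n B} {Q' : Matrix n k B}
    (p : ℕ → Matrix l m B) (q : ℕ → Matrix m k B) (p' : ℕ → Matrix l n B) (q' : ℕ → Matrix n k B)
    (hp : ∀ k, EntriesIn (J ^ k) (P - p k)) (hq : ∀ k, EntriesIn (J ^ k) (Q - q k))
    (hp' : ∀ k, EntriesIn (J ^ k) (P' - p' k)) (hq' : ∀ k, EntriesIn (J ^ k) (Q' - q' k))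
    (h : ∀ k, EntriesIn (J ^ k) (p k * q k - p' k * q' k)) : P * Q = P' * Q' := by
  refine EntriesIn.eq_of_pow (J := J) fun k => ?_
  have : P * Q - P' * Q' = ((P - p k) * Q + p k * (Q - q k)) -
      ((P' - p' k) * Q' + p' k * (Q' - q' k)) + (p k * q k - p' k * q' k) := by
    simp only [Matrix.sub_mul, Matrix.mul_sub]
    abel
  rw [this]
  exact ((((hp k).mul_right _).add ((hq k).mul_left _)).sub
    (((hp' k).mul_right _).add ((hq' k).mul_left _))).add (h k)

end Matrix

open Matrix (EntriesIn)

namespace MF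

variable {B : Type u} [CommRing B] {w : B}

/-- A strict endomorphism that is idempotent modulo `J` lifts to a strict idempotent. -/
theorem exists_idempotent_lift {J : Ideal B} [IsAdicComplete J B] {M : MF w} (e : M ⟶ M)
    (h₀ : EntriesIn J (e.S * e.S - e.S)) (h₁ : EntriesIn J (e.T * e.T - e.T)) :
    ∃ e' : M ⟶ M, e' ≫ e' = e' ∧ EntriesIn J (e'.S - e.S) ∧ EntriesIn J (e'.T - e.T) := by
  have lim : ∀ {m : Type} [Fintype m] [DecidableEq m] (E : Matrix m m B),
      EntriesIn J (E * E - E) → ∃ L : Matrix m m B,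
        (∀ k, EntriesIn (J ^ k) (L - newtonStep^[k] E)) ∧ L * L = L ∧ EntriesIn J (L - E) := by
    intro m _ _ E h
    obtain ⟨L, hL⟩ := Matrix.exists_limit (J := J) (fun k => newtonStep^[k] E)
      fun k => (h.newton_sub k).mono (Ideal.pow_le_pow_right k.le_succ)
    refine ⟨L, hL, ?_, ?_⟩
    -- Idempotency is written L·L = L·1, with the constant sequence 1 as approximation of the last
    -- factor.
    · have := Matrix.mul_eq_of_limit (J := J) (P := L) (Q := L) (P' := L) (Q' := 1) _ _ _
        (fun _ => 1) hL hL hL (fun k i j => by simp)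
        fun k => by
          rw [Matrix.mul_one]
          exact (h.newton k).mono (Ideal.pow_le_pow_right k.le_succ)
      rwa [Matrix.mul_one] at this
    · have a := hL 1
      have b := h.newton_sub 0
      rw [pow_one] at a
      rw [zero_add, pow_one] at b
      have := a.add b
      rwa [sub_add_sub_cancel] at this
  obtain ⟨S, hS, hS', hS''⟩ := lim e.S h₀
  obtain ⟨T, hT, hT', hT''⟩ := lim e.T h₁
  have comm : ∀ {m n : Type} [Fintype m] [Fintype n] [DecidableEq m] [DecidableEq n]
      {P : Matrix n m B} {S : Matrix m m B} {T : Matrix n n B} {S' : Matrix m m B}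
      {T' : Matrix n n B} (_ : P * S = T * P)
      (_ : ∀ k, EntriesIn (J ^ k) (S' - newtonStep^[k] S))
      (_ : ∀ k, EntriesIn (J ^ k) (T' - newtonStep^[k] T)), P * S' = T' * P := by
    intro m n _ _ _ _ P S T S' T' h hS hT
    refine Matrix.mul_eq_of_limit (J := J) (fun _ => P) _ _ (fun _ => P) (fun k i j => by simp) hS
      hT (fun k i j => by simp) fun k => ?_
    have : P * newtonStep^[k] S = newtonStep^[k] T * P := by
      induction k with
      | zero => exact h
      | succ k ih =>
        rw [Function.iterate_succ_apply', Function.iterate_succ_apply']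
        exact Matrix.newtonStep_comm ih
    rw [this, sub_self]
    exact fun i j => by simp
  exact ⟨⟨S, T, comm e.φ_comm hS hT, comm e.ψ_comm hT hS⟩, hom_ext hS' hT', hS'', hT''⟩

/-- The standard element E'E + (1 - E')(1 - E), which conjugates nearby idempotents, is congruent to
1; here E is idempotent only modulo J, which adds the second error term. -/
theorem entriesIn_conj {m : Type} [Fintype m] [DecidableEq m] {J : Ideal B} {E E' : Matrix m m B}
    (h : EntriesIn J (E * E - E)) (h' : EntriesIn J (E' - E)) :
    EntriesIn J (E' * E + (1 - E') * (1 - E) - 1) := by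
  have : E' * E + (1 - E') * (1 - E) - 1 = (E' - E) * (2 * E - 1) + 2 * (E * E - E) := by
    noncomm_ring
  rw [this]
  exact (h'.mul_right _).add (h.mul_left _)

end MF

instance HMF.isIdempotentComplete {B : Type u} [CommRing B] [IsLocalRing B]
    [IsAdicComplete (IsLocalRing.maximalIdeal B) B] (w : B) : IsIdempotentComplete (HMF w) where
  idempotents_split X e he := by
    obtain ⟨N, hN, ⟨i⟩⟩ := MF.exists_isMinimal_iso X.as
    change (proj w).obj N ≅ X at i
    obtain ⟨e₀, he₀⟩ := exists_proj_map (i.hom ≫ e ≫ i.inv)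
    have hee : (proj w).map (e₀ ≫ e₀) = (proj w).map e₀ := by
      rw [(proj w).map_comp, he₀]
      simp [reassoc_of% he]
    have hnull : MF.Null (e₀ ≫ e₀ - e₀) := by
      rw [← MF.proj_map_eq_zero_iff, (proj w).map_sub, hee, sub_self]
    have hm := MF.entriesIn_of_null hN hN hnull
    rw [MF.sub_S, MF.sub_T] at hm
    obtain ⟨e₁, he₁, hS, hT⟩ := MF.exists_idempotent_lift e₀ hm.1 hm.2
    -- c is strictly invertible, being congruent to 1 modulo the maximal ideal, and it conjugates e₀
    -- into e₁ in the homotopy category, where e₀ is idempotent.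
    let c : N ⟶ N := e₀ ≫ e₁ + (𝟙 N - e₀) ≫ (𝟙 N - e₁)
    have : IsIso c := by
      have h₀ := MF.entriesIn_conj hm.1 hS
      have h₁ := MF.entriesIn_conj hm.2 hT
      refine MF.isIso_of_entriesIn ?_ ?_
      · rw [MF.add_S, MF.comp_S, MF.comp_S, MF.sub_S, MF.sub_S]
        exact h₀
      · rw [MF.add_T, MF.comp_T, MF.comp_T, MF.sub_T, MF.sub_T]
        exact h₁
    have hc : (proj w).map e₀ ≫ (proj w).map c = (proj w).map c ≫ (proj w).map e₁ := by
      rw [← (proj w).map_comp, ← (proj w).map_comp]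
      have l₁ : e₀ ≫ c = (e₀ ≫ e₀) ≫ e₁ + (e₀ - e₀ ≫ e₀) ≫ (𝟙 N - e₁) := by
        simp [c, Preadditive.comp_sub, Preadditive.sub_comp]
      have l₂ : c ≫ e₁ = e₀ ≫ e₁ := by
        simp [c, Preadditive.comp_sub, Preadditive.sub_comp, he₁]
      rw [l₁, l₂, (proj w).map_add, (proj w).map_comp, (proj w).map_comp (_ - _), (proj w).map_sub,
        hee, sub_self, Limits.zero_comp, add_zero, (proj w).map_comp]
    obtain ⟨K, j, r, hjr, hrj⟩ := MF.exists_split e₁ he₁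
    -- e corresponds to e₁ under i and c, so the strict splitting of e₁ yields one of e.
    refine Idempotents.split_imp_of_iso (i.symm ≪≫ asIso ((proj w).map c)).symm
      ((proj w).map e₁) e ?_ ⟨(proj w).obj K, (proj w).map j, (proj w).map r, ?_, ?_⟩
    · have : (proj w).map e₁ = inv ((proj w).map c) ≫ (proj w).map e₀ ≫ (proj w).map c := by
        rw [hc, IsIso.inv_hom_id_assoc]
      rw [this, he₀]
      simp
    · rw [← (proj w).map_comp, hjr, (proj w).map_id]
    · rw [← (proj w).map_comp, hrj]

/-! ### Transposition of pairings -/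

namespace MF

variable {B : Type u} [CommRing B] {w : B}

theorem zsmul_S {M N : MF w} (z : ℤ) (f : M ⟶ N) : (z • f).S = z • f.S :=
  map_zsmul (AddMonoidHom.mk' (fun f : M ⟶ N => f.S) fun _ _ => rfl) z f

theorem zsmul_T {M N : MF w} (z : ℤ) (f : M ⟶ N) : (z • f).T = z • f.T :=
  map_zsmul (AddMonoidHom.mk' (fun f : M ⟶ N => f.T) fun _ _ => rfl) z f

theorem transpose_comm_of_comm {m n : Type} [Fintype m] [Fintype n] {P : Matrix m n B}
    {S : Matrix m n B} {T : Matrix n m B} (h : -P.transpose * S = T * P) :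
    -P.transpose * T.transpose = S.transpose * P := by
  have := congrArg (fun X => -X.transpose) h
  simpa [Matrix.transpose_mul, Matrix.transpose_neg] using this.symm

/-- The transpose of a pairing `M ⟶ M*`. -/
def dagger {M : MF w} : (M ⟶ M.dual) →+ (M ⟶ M.dual) :=
  AddMonoidHom.mk' (fun β =>
    { S := β.T.transpose
      T := β.S.transpose
      φ_comm := transpose_comm_of_comm β.φ_comm
      ψ_comm := transpose_comm_of_comm β.ψ_comm })
    fun _ _ => rfl

@[simp] theorem dagger_dagger {M : MF w} (β : M ⟶ M.dual) : dagger (dagger β) = β := rfl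

theorem dagger_scal_comp {M : MF w} (c : B) (β : M ⟶ M.dual) :
    dagger (scal c M ≫ β) = scal c M ≫ dagger β := by
  have key : ∀ {m n : Type} [Fintype m] [Fintype n] [DecidableEq m] [DecidableEq n]
      (P : Matrix m n B), (P * (c • (1 : Matrix n n B))).transpose =
      P.transpose * (c • (1 : Matrix m m B)) := by
    intros; simp
  exact hom_ext (key β.T) (key β.S)

/-- Transposing a boundary gives the boundary of minus the transposed homotopy, so transposition is
defined on homotopy classes of pairings. -/
theorem Null.dagger {M : MF w} {β : M ⟶ M.dual} (h : Null β) : Null (dagger β) := by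
  obtain ⟨h₀, h₁, e₀, e₁⟩ := h
  have key : ∀ {m n : Type} [Fintype m] [Fintype n] {P : Matrix m n B} {Q : Matrix n m B}
      {h₀ : Matrix m m B} {h₁ : Matrix n n B} {T : Matrix n m B},
      T = -P.transpose * h₀ + h₁ * Q →
        T.transpose = -Q.transpose * -h₁.transpose + -h₀.transpose * P := by
    intro m n _ _ P Q h₀ h₁ T h
    rw [h]
    simp [Matrix.transpose_mul, add_comm]
  have e₀ : β.S = -M.ψ.transpose * h₀ + h₁ * M.φ := e₀
  have e₁ : β.T = -M.φ.transpose * h₁ + h₀ * M.ψ := e₁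
  exact ⟨-h₀.transpose, -h₁.transpose, key e₁, key e₀⟩

theorem proj_map_dagger_congr {M : MF w} {β γ : M ⟶ M.dual}
    (h : (HMF.proj w).map β = (HMF.proj w).map γ) :
    (HMF.proj w).map (dagger β) = (HMF.proj w).map (dagger γ) := by
  rw [← sub_eq_zero, ← (HMF.proj w).map_sub, ← map_sub, proj_map_eq_zero_iff]
  rw [← sub_eq_zero, ← (HMF.proj w).map_sub, proj_map_eq_zero_iff] at h
  exact h.dagger

theorem dualMap_comp {M N P : MF w} (f : M ⟶ N) (g : N ⟶ P) :
    dualMap (f ≫ g) = dualMap g ≫ dualMap f :=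
  hom_ext (Matrix.transpose_mul _ _) (Matrix.transpose_mul _ _)

theorem dualMap_id (M : MF w) : dualMap (𝟙 M) = 𝟙 M.dual :=
  hom_ext Matrix.transpose_one Matrix.transpose_one

theorem isIso_proj_map_dualMap {M N : MF w} (f : M ⟶ N) [IsIso ((HMF.proj w).map f)] :
    IsIso ((HMF.proj w).map (dualMap f)) := by
  obtain ⟨g, hg⟩ := HMF.exists_proj_map (inv ((HMF.proj w).map f))
  have h₁ : (HMF.proj w).map (f ≫ g) = (HMF.proj w).map (𝟙 _) := by
    rw [(HMF.proj w).map_comp, hg, IsIso.hom_inv_id, (HMF.proj w).map_id]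
  have h₂ : (HMF.proj w).map (g ≫ f) = (HMF.proj w).map (𝟙 _) := by
    rw [(HMF.proj w).map_comp, hg, IsIso.inv_hom_id, (HMF.proj w).map_id]
  have h₁' := (HMF.proj_map_eq_iff _ _).2 (dualMap_homotopic ((HMF.proj_map_eq_iff _ _).1 h₁))
  have h₂' := (HMF.proj_map_eq_iff _ _).2 (dualMap_homotopic ((HMF.proj_map_eq_iff _ _).1 h₂))
  rw [dualMap_comp, dualMap_id, (HMF.proj w).map_comp, (HMF.proj w).map_id] at h₁' h₂'
  exact ⟨(HMF.proj w).map (dualMap g), h₂', h₁'⟩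

/-- A pulled back pairing keeps its symmetry. -/
theorem dagger_comp_comp_dualMap {M N : MF w} (g : M ⟶ N) (b : N ⟶ N.dual) :
    dagger (g ≫ b ≫ dualMap g) = g ≫ dagger b ≫ dualMap g := by
  have key : ∀ {k l m n : Type} [Fintype k] [Fintype l] [Fintype m] [Fintype n]
      (S : Matrix k l B) (T : Matrix m n B) (b : Matrix k m B),
      ((S.transpose * b) * T).transpose = (T.transpose * b.transpose) * S := by
    intros
    simp [Matrix.mul_assoc]
  exact hom_ext (key _ _ _) (key _ _ _)

/-- Expresses the symmetry of a form as an eigenvector equation for `dagger`, which makes sense up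
to homotopy as well. -/
theorem dagger_eq_iff {M : MF w} (ε : ℤˣ) (b : M ⟶ M.dual) :
    dagger b = -((ε : ℤ) • b) ↔ b.T = -((ε : ℤ) • b.S.transpose) := by
  have hε : ((ε : ℤ) * ε) = 1 := by rcases Int.units_eq_one_or ε with rfl | rfl <;> rfl
  constructor
  · intro h
    have h' : b.S.transpose = -((ε : ℤ) • b.T) :=
      (congrArg Hom.T h).trans ((neg_T _).trans (congrArg Neg.neg (zsmul_T _ _)))
    rw [h', smul_neg, neg_neg, smul_smul, hε, one_smul]
  · intro h
    refine hom_ext ?_ ?_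
    · rw [neg_S, zsmul_S]
      change b.T.transpose = _
      rw [h, Matrix.transpose_neg, Matrix.transpose_smul]
      rfl
    · rw [neg_T, zsmul_T, h, smul_neg, neg_neg, smul_smul, hε, one_smul]
      rfl

theorem IsMinimal.dual [IsLocalRing B] {M : MF w} (h : M.IsMinimal) : M.dual.IsMinimal :=
  ⟨fun i j => neg_mem (h.1 j i), fun i j => neg_mem (h.2 j i)⟩

/-- A functor compatible with duality up to sign: `can` identifies `F(M*)` with `F(M)*` naturally,
and
under it `F` anticommutes with transposition of pairings. -/
structure DualCompat {B' : Type u} [CommRing B'] {w' : B'} (F : MF w ⥤ MF w') where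
  /-- the comparison of duals -/
  can : ∀ M : MF w, F.obj M.dual ≅ (F.obj M).dual
  naturality : ∀ {M N : MF w} (f : M ⟶ N),
    F.map (dualMap f) ≫ (can M).hom = (can N).hom ≫ dualMap (F.map f)
  dagger_can : ∀ {M : MF w} (β : M ⟶ M.dual),
    dagger (F.map β ≫ (can M).hom) = -(F.map (dagger β) ≫ (can M).hom)

/-- The anticommutation with `dagger` turns the sign ε into -ε: orthogonal and symplectic are
exchanged. -/
theorem DualCompat.dagger_eq {B' : Type u} [CommRing B'] {w' : B'} {F : MF w ⥤ MF w'}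
    [F.Additive] (h : DualCompat F) {ε δ : ℤˣ} (hδ : δ = -ε) {M : MF w} {b : M ⟶ M.dual}
    (hb : dagger b = -((ε : ℤ) • b)) :
    dagger (F.map b ≫ (h.can M).hom) = -((δ : ℤ) • (F.map b ≫ (h.can M).hom)) := by
  rw [h.dagger_can, hb, F.map_neg, F.map_zsmul, hδ]
  simp

end MF

/-! ### Functors between categories of forms -/

section FormFunctor

variable {B B' : Type u} [CommRing B] [CommRing B'] {w : B} {w' : B'} {ε δ : ℤˣ}

/-- The image of a factorization with form under a functor compatible with duality. -/
def FormMF.map {F : MF w ⥤ MF w'} [F.Additive] (h : MF.DualCompat F) (hδ : δ = -ε)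
    (X : FormMF ε w) : FormMF δ w' where
  toMF := F.obj X.toMF
  b := F.mapIso X.b ≪≫ h.can X.toMF
  symm := (MF.dagger_eq_iff δ _).1 (h.dagger_eq hδ ((MF.dagger_eq_iff ε _).2 X.symm))

/-- The functor between categories of forms attached to a functor compatible with duality. -/
def FormHMF.lift (F : MF w ⥤ MF w') [F.Additive]
    (hF : ∀ (M N : MF w) (f g : M ⟶ N), MF.Homotopic f g → MF.Homotopic (F.map f) (F.map g))
    (h : MF.DualCompat F) (hδ : δ = -ε) : FormHMF ε w ⥤ FormHMF δ w' where
  obj X := FormMF.map h hδ X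
  map {X Y} f := InducedCategory.homMk (X := FormMF.map h hδ X) (Y := FormMF.map h hδ Y)
    ((HMF.lift F hF).map f.hom)
  map_id _ := InducedCategory.hom_ext ((HMF.lift F hF).map_id _)
  map_comp _ _ := InducedCategory.hom_ext ((HMF.lift F hF).map_comp _ _)

namespace FormHMF

/-- The class of a strict morphism. -/
def mk {X Y : FormHMF ε w} (f : X.toMF ⟶ Y.toMF) : X ⟶ Y :=
  InducedCategory.homMk ((HMF.proj w).map f)

theorem exists_mk {X Y : FormHMF ε w} (f : X ⟶ Y) : ∃ f₀ : X.toMF ⟶ Y.toMF, mk f₀ = f := by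
  obtain ⟨f₀, h⟩ := HMF.exists_proj_map (M := X.toMF) (N := Y.toMF) f.hom
  exact ⟨f₀, InducedCategory.hom_ext h⟩

theorem adj_mk {X Y : FormHMF ε w} (f : X.toMF ⟶ Y.toMF) :
    adj (mk f) = mk (FormMF.adj (X := X) (Y := Y) f) := rfl

theorem mk_comp {X Y Z : FormHMF ε w} (f : X.toMF ⟶ Y.toMF) (g : Y.toMF ⟶ Z.toMF) :
    (mk f : X ⟶ Y) ≫ (mk g : Y ⟶ Z) = mk (f ≫ g) :=
  InducedCategory.hom_ext ((HMF.proj w).map_comp f g).symm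

theorem adj_comp {X Y Z : FormHMF ε w} (f : X ⟶ Y) (g : Y ⟶ Z) :
    adj (f ≫ g) = adj g ≫ adj f := by
  obtain ⟨f, rfl⟩ := exists_mk f
  obtain ⟨g, rfl⟩ := exists_mk g
  rw [mk_comp, adj_mk, adj_mk, adj_mk, mk_comp]
  refine congrArg mk ?_
  simp [FormMF.adj, MF.dualMap_comp]

theorem IsIsometry.comp {X Y Z : FormHMF ε w} {f : X ⟶ Y} {g : Y ⟶ Z} (hf : IsIsometry f)
    (hg : IsIsometry g) : IsIsometry (f ≫ g) := by
  obtain ⟨hf, hf'⟩ := hf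
  obtain ⟨hg, hg'⟩ := hg
  constructor
  · rw [adj_comp, Category.assoc, reassoc_of% hg, hf]
  · rw [adj_comp, Category.assoc, reassoc_of% hf', hg']

variable (F : MF w ⥤ MF w') [F.Additive]
  (hF : ∀ (M N : MF w) (f g : M ⟶ N), MF.Homotopic f g → MF.Homotopic (F.map f) (F.map g))
  (h : MF.DualCompat F) (hδ : δ = -ε)

/-- Already true for strict morphisms: by naturality the comparison of duals cancels between the two
forms. -/
theorem lift_map_adj {X Y : FormHMF ε w} (f : X ⟶ Y) :
    (lift F hF h hδ).map (adj f) = adj ((lift F hF h hδ).map f) := by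
  obtain ⟨f, rfl⟩ := exists_mk f
  refine congrArg (mk (X := FormMF.map h hδ Y) (Y := FormMF.map h hδ X)) ?_
  change F.map (Y.b.hom ≫ MF.dualMap f ≫ X.b.inv) = (F.map Y.b.hom ≫ (h.can _).hom) ≫
    MF.dualMap (F.map f) ≫ (h.can _).inv ≫ F.map X.b.inv
  rw [F.map_comp, F.map_comp, Category.assoc, ← Category.assoc (h.can _).hom, ← h.naturality]
  simp

/-- A pairing that is symmetric up to homotopy on a minimal factorization can be replaced by a
form, if
`2` is invertible. -/
theorem _root_.MF.exists_form [IsLocalRing B] {c : B} (hc : c + c = 1) {M : MF w}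
    (hM : M.IsMinimal) (β : M ⟶ M.dual) [IsIso ((HMF.proj w).map β)]
    (hβ : (HMF.proj w).map (MF.dagger β) = -((ε : ℤ) • (HMF.proj w).map β)) :
    ∃ b : M ≅ M.dual, MF.dagger b.hom = -((ε : ℤ) • b.hom) ∧
      (HMF.proj w).map b.hom = (HMF.proj w).map β := by
  have hε : ((ε : ℤ) * ε) = 1 := by rcases Int.units_eq_one_or ε with rfl | rfl <;> rfl
  -- With c = 1/2 this is the projection of β to the eigenspace of `dagger` with eigenvalue -ε; it
  -- does not change the homotopy class, where β already has the symmetry.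
  let b := MF.scal c M ≫ (β - (ε : ℤ) • MF.dagger β)
  have h₁ : MF.dagger b = -((ε : ℤ) • b) := by
    simp only [b]
    rw [MF.dagger_scal_comp, map_sub, map_zsmul, MF.dagger_dagger, ← Preadditive.comp_zsmul,
      ← Preadditive.comp_neg, smul_sub, smul_smul, hε, one_smul, neg_sub]
  have h₂ : (HMF.proj w).map b = (HMF.proj w).map β := by
    have : MF.scal c M ≫ (β + β) = β := by
      have key : ∀ {m n : Type} [Fintype m] [Fintype n] [DecidableEq n] (P : Matrix m n B),
          (P + P) * (c • (1 : Matrix n n B)) = P := by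
        intro m n _ _ _ P
        rw [Matrix.mul_smul, Matrix.mul_one, smul_add, ← add_smul, hc, one_smul]
      exact MF.hom_ext (key β.S) (key β.T)
    conv_rhs => rw [← this]
    rw [(HMF.proj w).map_comp, (HMF.proj w).map_comp, (HMF.proj w).map_sub, (HMF.proj w).map_add,
      (HMF.proj w).map_zsmul, hβ, smul_neg, smul_smul, hε, one_smul, sub_neg_eq_add]
  have : IsIso ((HMF.proj w).map b) := by rw [h₂]; infer_instance
  -- M and its dual are minimal, so the homotopy equivalence b is a strict isomorphism, as a form
  -- must be.
  have := MF.isIso_of_isIso_proj hM hM.dual b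
  exact ⟨asIso b, h₁, h₂⟩

theorem exists_isIsometry_lift [IsLocalRing B] {c : B} (hc : c + c = 1)
    [(HMF.lift F hF).IsEquivalence] (Y : FormHMF δ w') :
    ∃ (X : FormHMF ε w) (f : (lift F hF h hδ).obj X ⟶ Y), IsIsometry f := by
  -- The preimage is taken minimal, so that a pairing obtained only up to homotopy can be made into
  -- a form.
  obtain ⟨M, hM, ⟨i⟩⟩ := MF.exists_isMinimal_iso
    ((HMF.lift F hF).objPreimage ((HMF.proj w').obj Y.toMF)).as
  let g : (HMF.proj w').obj (F.obj M) ≅ (HMF.proj w').obj Y.toMF :=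
    (HMF.lift F hF).mapIso i ≪≫ (HMF.lift F hF).objObjPreimageIso _
  obtain ⟨g₀, hg₀⟩ := HMF.exists_proj_map g.hom
  have : IsIso ((HMF.proj w').map g₀) := by rw [hg₀]; infer_instance
  have := MF.isIso_proj_map_dualMap g₀
  -- The form of Y pulled back along a strict representative: its symmetry is strict, though it is
  -- invertible only up to homotopy.
  let γ := g₀ ≫ Y.b.hom ≫ MF.dualMap g₀
  have hγ : MF.dagger γ = -((δ : ℤ) • γ) := by
    simp only [γ]
    rw [MF.dagger_comp_comp_dualMap, (MF.dagger_eq_iff δ _).2 Y.symm]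
    simp
  have : IsIso ((HMF.proj w').map γ) := by
    simp only [γ, Functor.map_comp]; infer_instance
  obtain ⟨β', hβ'⟩ := (HMF.lift F hF).map_surjective (X := (HMF.proj w).obj M)
    (Y := (HMF.proj w).obj M.dual) ((HMF.proj w').map (γ ≫ (h.can M).inv))
  obtain ⟨β, rfl⟩ := HMF.exists_proj_map β'
  have e : (HMF.proj w').map (F.map β) = (HMF.proj w').map (γ ≫ (h.can M).inv) := hβ'
  have e' : (HMF.proj w').map (F.map β ≫ (h.can M).hom) = (HMF.proj w').map γ := by
    rw [(HMF.proj w').map_comp, e, ← (HMF.proj w').map_comp, Category.assoc, Iso.inv_hom_id,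
      Category.comp_id]
  have : IsIso ((HMF.lift F hF).map ((HMF.proj w).map β)) := by
    rw [HMF.lift_proj_map, e, (HMF.proj w').map_comp]
    exact IsIso.comp_isIso' this ((HMF.proj w').mapIso (h.can M)).isIso_inv
  have := isIso_of_reflects_iso ((HMF.proj w).map β) (HMF.lift F hF)
  -- The symmetry of γ descends to β: transposition anticommutes with the functor, the comparison of
  -- duals is cancelled, and faithfulness concludes.
  have hβ : (HMF.proj w).map (MF.dagger β) = -((ε : ℤ) • (HMF.proj w).map β) := by
    have k := MF.proj_map_dagger_congr e'
    rw [h.dagger_can, hγ, (HMF.proj w').map_neg, (HMF.proj w').map_neg, neg_inj,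
      (HMF.proj w').map_zsmul, ← e', (HMF.proj w').map_comp, (HMF.proj w').map_comp,
      ← Preadditive.zsmul_comp, cancel_mono, hδ] at k
    apply (HMF.lift F hF).map_injective
    have := HMF.lift_additive F hF
    rw [(HMF.lift F hF).map_neg, (HMF.lift F hF).map_zsmul, HMF.lift_proj_map, HMF.lift_proj_map,
      k, Units.val_neg, neg_smul]
    rfl
  obtain ⟨b, hb, hbβ⟩ := MF.exists_form hc hM β hβ
  let X : FormMF ε w := ⟨M, b, (MF.dagger_eq_iff ε _).1 hb⟩
  let f : (lift F hF h hδ).obj X ⟶ Y := mk (X := FormMF.map h hδ X) g₀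
  have : IsIso f := by
    have : IsIso ((forget δ w').map f) := ‹IsIso ((HMF.proj w').map g₀)›
    exact isIso_of_reflects_iso f (forget δ w')
  -- The composite is γ followed by the inverse of the form on F(M), and that form was built to be
  -- homotopic to γ.
  have hf : f ≫ adj f = 𝟙 _ := by
    refine InducedCategory.hom_ext ?_
    let bX : F.obj M ≅ (F.obj M).dual := F.mapIso b ≪≫ h.can M
    have e₁ : (HMF.proj w').map bX.hom = (HMF.proj w').map γ := by
      rw [← e']
      change (HMF.proj w').map (F.map b.hom ≫ (h.can M).hom) = _
      rw [(HMF.proj w').map_comp, (HMF.proj w').map_comp, ← HMF.lift_proj_map F hF,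
        ← HMF.lift_proj_map F hF, hbβ]
    change (HMF.proj w').map (g₀ ≫ Y.b.hom ≫ MF.dualMap g₀ ≫ bX.inv) = 𝟙 _
    have e₂ : g₀ ≫ Y.b.hom ≫ MF.dualMap g₀ ≫ bX.inv = γ ≫ bX.inv := by
      simp only [γ, Category.assoc]
    rw [e₂, (HMF.proj w').map_comp, ← e₁, ← (HMF.proj w').map_comp, Iso.hom_inv_id,
      (HMF.proj w').map_id]
  -- f is invertible, so the one-sided identity makes its adjoint the inverse.
  exact ⟨X, f, hf, by rw [IsIso.eq_inv_of_hom_inv_id hf, IsIso.inv_hom_id]⟩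

theorem isFormEquivalence_lift [IsLocalRing B] {c : B} (hc : c + c = 1)
    (hE : IsTriangleEquivalence (HMF.distTriangles w) (HMF.distTriangles w') (HMF.lift F hF)) :
    IsFormEquivalence (lift F hF h hδ) := by
  obtain ⟨h₁, h₂, η, hη⟩ := hE
  have iso := exists_isIsometry_lift F hF h hδ hc
  refine ⟨⟨?_, ?_, ?_⟩, fun _ _ f => lift_map_adj F hF h hδ f, iso⟩
  · have : (lift F hF h hδ).Full := ⟨fun {X Y} f => by
      obtain ⟨f', hf'⟩ := (HMF.lift F hF).map_surjective
        (X := (HMF.proj w).obj X.toMF) (Y := (HMF.proj w).obj Y.toMF) f.hom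
      exact ⟨InducedCategory.homMk f', InducedCategory.hom_ext hf'⟩⟩
    have : (lift F hF h hδ).Faithful := ⟨fun {X Y} f g e =>
      InducedCategory.hom_ext ((HMF.lift F hF).map_injective (congrArg (·.hom) e))⟩
    have : (lift F hF h hδ).EssSurj := ⟨fun Y => by
      obtain ⟨X, f, hf⟩ := iso Y
      exact ⟨X, ⟨f, adj f, hf.1, hf.2⟩⟩⟩
    exact {}
  · exact ⟨fun {X Y f g} => InducedCategory.hom_ext ((HMF.lift F hF).map_add (f := f.hom) (g :=
        g.hom))⟩
  · let η' : shift ε w ⋙ lift F hF h hδ ≅ lift F hF h hδ ⋙ shift δ w' :=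
      NatIso.ofComponents (fun X => InducedCategory.isoMk
        (X := FormMF.map h hδ (FormMF.shift X)) (Y := FormMF.shift (FormMF.map h hδ X))
        (η.app ((HMF.proj w).obj X.toMF)))
        (fun {X Y} f => InducedCategory.hom_ext (η.hom.naturality f.hom))
    refine ⟨η', fun t => ?_⟩
    -- The two underlying triangles differ only in the identities that `forgetShift` inserts in the
    -- third morphism.
    have : Tri.map (forget δ w') (forgetShift δ w') (Tri.map (lift F hF h hδ) η' t) =
        Tri.map (HMF.lift F hF) η (Tri.map (forget ε w) (forgetShift ε w) t) := by
      refine congrArg (Tri.mk _ _ _ _ _) ?_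
      exact (Category.comp_id _).trans (congrArg
        (fun z : (HMF.proj w).obj t.obj₃.toMF ⟶ (HMF.shift w).obj ((HMF.proj w).obj t.obj₁.toMF) =>
          (HMF.lift F hF).map z ≫ η.hom.app ((HMF.proj w).obj t.obj₁.toMF))
        (Category.comp_id (Y := (HMF.shift w).obj ((HMF.proj w).obj t.obj₁.toMF))
          t.mor₃.hom).symm)
    exact (iff_of_eq (congrArg (· ∈ HMF.distTriangles w') this)).trans (hη _)

end FormHMF

end FormFunctor

/-- A functor commuting with adjunction preserves isometries, and isometries compose. -/
theorem IsFormEquivalence.comp {B : Type u} {B' : Type u'} {B'' : Type v} [CommRing B]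
    [CommRing B'] [CommRing B''] {w : B} {w' : B'} {w'' : B''} {ε δ ζ : ℤˣ}
    {F : FormHMF ε w ⥤ FormHMF δ w'} {G : FormHMF δ w' ⥤ FormHMF ζ w''}
    (hF : IsFormEquivalence F) (hG : IsFormEquivalence G) : IsFormEquivalence (F ⋙ G) := by
  obtain ⟨f₁, f₂, f₃⟩ := hF
  obtain ⟨g₁, g₂, g₃⟩ := hG
  refine ⟨f₁.comp g₁, fun X Y f => ?_, fun Y => ?_⟩
  · rw [Functor.comp_map, f₂, g₂]; rfl
  · obtain ⟨X, k, hk⟩ := g₃ Y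
    obtain ⟨W, l, hl⟩ := f₃ X
    have hl' : FormHMF.IsIsometry (G.map l) := by
      constructor
      · rw [← g₂, ← G.map_comp, hl.1, G.map_id]
      · rw [← g₂, ← G.map_comp, hl.2, G.map_id]
    exact ⟨W, G.map l ≫ k, hl'.comp hk⟩

/-! ### Duality and the Faltings–Knörrer functor -/

namespace MF

section Transpose

variable {B : Type u} [CommRing B] {w : B}

/-- The transpose `Nᵀ ⟶ Mᵀ` of a morphism `M ⟶ N`. -/
def transposeMap {M N : MF w} (f : M ⟶ N) : N.transpose ⟶ M.transpose where
  S := f.S.transpose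
  T := f.T.transpose
  φ_comm := by
    change M.ψ.transpose * f.S.transpose = f.T.transpose * N.ψ.transpose
    rw [← Matrix.transpose_mul, ← Matrix.transpose_mul, f.ψ_comm]
  ψ_comm := by
    change M.φ.transpose * f.T.transpose = f.S.transpose * N.φ.transpose
    rw [← Matrix.transpose_mul, ← Matrix.transpose_mul, f.φ_comm]

theorem transpose_comm_of_comm' {m n : Type} [Fintype m] [Fintype n] {P : Matrix m n B}
    {Q : Matrix n m B} {S : Matrix n n B} {T : Matrix m m B} (h : Q.transpose * S = T * P) :
    P.transpose * T.transpose = S.transpose * Q := by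
  have := congrArg Matrix.transpose h
  simpa [Matrix.transpose_mul] using this.symm

/-- The transpose of a pairing `M ⟶ Mᵀ`. -/
def twistedDagger {M : MF w} (q : M ⟶ M.transpose) : M ⟶ M.transpose where
  S := q.S.transpose
  T := q.T.transpose
  φ_comm := transpose_comm_of_comm' q.ψ_comm
  ψ_comm := transpose_comm_of_comm' q.φ_comm

/-- A functor that takes duals to transposes, compatibly with transposition of pairings. -/
structure DualToTranspose {B' : Type u} [CommRing B'] {w' : B'} (F : MF w ⥤ MF w') where
  /-- the comparison -/
  can : ∀ M : MF w, F.obj M.dual ≅ (F.obj M).transpose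
  naturality : ∀ {M N : MF w} (f : M ⟶ N),
    F.map (dualMap f) ≫ (can M).hom = (can N).hom ≫ transposeMap (F.map f)
  dagger_can : ∀ {M : MF w} (β : M ⟶ M.dual),
    twistedDagger (F.map β ≫ (can M).hom) = F.map (dagger β) ≫ (can M).hom

/-- A functor that commutes with transposes, compatibly with transposition of pairings. -/
structure TransposeCompat {B' : Type u} [CommRing B'] {w' : B'} (F : MF w ⥤ MF w') where
  /-- the comparison -/
  can : ∀ M : MF w, F.obj M.transpose ≅ (F.obj M).transpose
  naturality : ∀ {M N : MF w} (f : M ⟶ N),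
    F.map (transposeMap f) ≫ (can M).hom = (can N).hom ≫ transposeMap (F.map f)
  dagger_can : ∀ {M : MF w} (q : M ⟶ M.transpose),
    twistedDagger (F.map q ≫ (can M).hom) = F.map (twistedDagger q) ≫ (can M).hom

/-- A functor that takes transposes to duals, and anticommutes with transposition of pairings. -/
structure TransposeToDual {B' : Type u} [CommRing B'] {w' : B'} (F : MF w ⥤ MF w') where
  /-- the comparison -/
  can : ∀ M : MF w, F.obj M.transpose ≅ (F.obj M).dual
  naturality : ∀ {M N : MF w} (f : M ⟶ N),
    F.map (transposeMap f) ≫ (can M).hom = (can N).hom ≫ dualMap (F.map f)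
  dagger_can : ∀ {M : MF w} (q : M ⟶ M.transpose),
    dagger (F.map q ≫ (can M).hom) = -(F.map (twistedDagger q) ≫ (can M).hom)

variable {B' B'' : Type u} [CommRing B'] [CommRing B''] {w' : B'} {w'' : B''}
  {F : MF w ⥤ MF w'} {G : MF w' ⥤ MF w''}

/-- Composition with a functor that commutes with transposes. -/
def DualToTranspose.comp (h : DualToTranspose F) (k : TransposeCompat G) :
    DualToTranspose (F ⋙ G) where
  can M := G.mapIso (h.can M) ≪≫ k.can (F.obj M)
  naturality {M N} f := by
    change G.map (F.map (dualMap f)) ≫ G.map (h.can M).hom ≫ (k.can (F.obj M)).hom =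
      (G.map (h.can N).hom ≫ (k.can (F.obj N)).hom) ≫ transposeMap (G.map (F.map f))
    rw [← G.map_comp_assoc, h.naturality, G.map_comp_assoc, k.naturality, Category.assoc]
  dagger_can {M} β := by
    change twistedDagger (G.map (F.map β) ≫ G.map (h.can M).hom ≫ (k.can (F.obj M)).hom) =
      G.map (F.map (dagger β)) ≫ G.map (h.can M).hom ≫ (k.can (F.obj M)).hom
    rw [← G.map_comp_assoc, ← G.map_comp_assoc, ← h.dagger_can, k.dagger_can]

/-- A functor that takes duals to transposes followed by one that takes transposes to duals. -/
def DualToTranspose.compDual (h : DualToTranspose F) (k : TransposeToDual G) :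
    DualCompat (F ⋙ G) where
  can M := G.mapIso (h.can M) ≪≫ k.can (F.obj M)
  naturality {M N} f := by
    change G.map (F.map (dualMap f)) ≫ G.map (h.can M).hom ≫ (k.can (F.obj M)).hom =
      (G.map (h.can N).hom ≫ (k.can (F.obj N)).hom) ≫ dualMap (G.map (F.map f))
    rw [← G.map_comp_assoc, h.naturality, G.map_comp_assoc, k.naturality, Category.assoc]
  dagger_can {M} β := by
    change dagger (G.map (F.map β) ≫ G.map (h.can M).hom ≫ (k.can (F.obj M)).hom) =
      -(G.map (F.map (dagger β)) ≫ G.map (h.can M).hom ≫ (k.can (F.obj M)).hom)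
    rw [← G.map_comp_assoc, ← G.map_comp_assoc, ← h.dagger_can, k.dagger_can]

theorem mapIso_trans_comp {X Y : MF w} {W : MF w'} {V : MF w''} (i : X ≅ Y)
    (j : F.obj Y ≅ W) (k : G.obj W ≅ V) :
    G.mapIso (F.mapIso i ≪≫ j) ≪≫ k = (F ⋙ G).mapIso i ≪≫ G.mapIso j ≪≫ k := by
  ext1
  simp

theorem mapIso_trans_comp_comp {B₃ : Type u} [CommRing B₃] {w₃ : B₃} {H : MF w'' ⥤ MF w₃}
    {X Y : MF w} {W : MF w'} {V : MF w''} {U : MF w₃} (i : X ≅ Y) (j : F.obj Y ≅ W)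
    (k : G.obj W ≅ V) (l : H.obj V ≅ U) :
    H.mapIso (G.mapIso (F.mapIso i ≪≫ j) ≪≫ k) ≪≫ l =
      ((F ⋙ G) ⋙ H).mapIso i ≪≫ H.mapIso (G.mapIso j ≪≫ k) ≪≫ l := by
  ext1
  simp

end Transpose

end MF

noncomputable section

open MvPowerSeries

namespace BlockAux

variable {B : Type u} [CommRing B] {m₀ m₁ n₀ n₁ : Type}
  [Fintype m₀] [Fintype m₁] [Fintype n₀] [Fintype n₁]
  [DecidableEq m₀] [DecidableEq m₁] [DecidableEq n₀] [DecidableEq n₁]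

theorem swap_diag_transpose (S : Matrix n₀ m₀ B) (T : Matrix n₁ m₁ B) :
    swap B m₁ m₀ * Matrix.fromBlocks S.transpose 0 0 T.transpose =
      (Matrix.fromBlocks T 0 0 S).transpose * swap B n₁ n₀ := by
  unfold swap
  rw [Matrix.fromBlocks_transpose, Matrix.fromBlocks_multiply, Matrix.fromBlocks_multiply]
  simp

theorem transpose_swap_mul_diag (S : Matrix m₁ m₀ B) (T : Matrix m₀ m₁ B) :
    (swap B m₁ m₀ * Matrix.fromBlocks T 0 0 S : Matrix (m₁ ⊕ m₀) (m₁ ⊕ m₀) B).transpose =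
      swap B m₁ m₀ * Matrix.fromBlocks S.transpose 0 0 T.transpose := by
  unfold swap
  rw [Matrix.fromBlocks_multiply, Matrix.fromBlocks_multiply, Matrix.fromBlocks_transpose]
  simp

theorem one_mul_diag_transpose (S : Matrix n₀ m₀ B) (T : Matrix n₁ m₁ B) :
    (1 : Matrix (m₁ ⊕ m₀) (m₁ ⊕ m₀) B) * Matrix.fromBlocks T.transpose 0 0 S.transpose =
      (Matrix.fromBlocks T 0 0 S).transpose * (1 : Matrix (n₁ ⊕ n₀) (n₁ ⊕ n₀) B) := by
  rw [Matrix.fromBlocks_transpose]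
  simp

theorem neg_one_mul_diag_transpose (S : Matrix n₀ m₀ B) (T : Matrix n₁ m₁ B) :
    (-1 : Matrix (m₁ ⊕ m₀) (m₁ ⊕ m₀) B) * Matrix.fromBlocks T.transpose 0 0 S.transpose =
      (Matrix.fromBlocks T 0 0 S).transpose * (-1 : Matrix (n₁ ⊕ n₀) (n₁ ⊕ n₀) B) := by
  rw [Matrix.fromBlocks_transpose]
  simp

/-- The identification of θ(Mᵀ) with θ(M)* has components 1 and -1, and `dagger` exchanges the two
degrees. This is the source of the sign in `DualCompat`. -/
theorem transpose_neg_one_mul_diag (S : Matrix m₀ m₀ B) (T : Matrix m₁ m₁ B) :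
    ((-1 : Matrix (m₁ ⊕ m₀) (m₁ ⊕ m₀) B) * Matrix.fromBlocks T 0 0 S).transpose =
      -((1 : Matrix (m₁ ⊕ m₀) (m₁ ⊕ m₀) B) *
        Matrix.fromBlocks T.transpose 0 0 S.transpose) := by
  rw [Matrix.neg_mul, Matrix.one_mul, Matrix.one_mul, Matrix.transpose_neg,
    Matrix.fromBlocks_transpose]
  simp

theorem transpose_one_mul_diag (S : Matrix m₀ m₀ B) (T : Matrix m₁ m₁ B) :
    ((1 : Matrix (m₁ ⊕ m₀) (m₁ ⊕ m₀) B) * Matrix.fromBlocks T 0 0 S).transpose =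
      -((-1 : Matrix (m₁ ⊕ m₀) (m₁ ⊕ m₀) B) *
        Matrix.fromBlocks T.transpose 0 0 S.transpose) := by
  rw [Matrix.neg_mul, Matrix.one_mul, Matrix.one_mul, neg_neg, Matrix.fromBlocks_transpose]
  simp

theorem transpose_neg_one_mul (T : Matrix m₁ m₁ B) :
    ((-1 : Matrix m₁ m₁ B) * T).transpose = (-1 : Matrix m₁ m₁ B) * T.transpose := by
  simp

theorem neg_one_mul_transpose (T : Matrix n₁ m₁ B) :
    (-1 : Matrix m₁ m₁ B) * T.transpose = T.transpose * (-1 : Matrix n₁ n₁ B) := by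
  simp

theorem transpose_one_mul (T : Matrix m₁ m₁ B) :
    ((1 : Matrix m₁ m₁ B) * T).transpose = (1 : Matrix m₁ m₁ B) * T.transpose := by
  simp

theorem one_mul_transpose (T : Matrix n₁ m₁ B) :
    (1 : Matrix m₁ m₁ B) * T.transpose = T.transpose * (1 : Matrix n₁ n₁ B) := by
  simp

end BlockAux

namespace MF

section Theta

variable {A : Type u} [CommRing A] {p : A} {w : PS₂ A} (hw : w = X 0 * X 1 - C p)

/-- `θ` takes duals to transposes. -/
def thetaDualToTranspose : DualToTranspose (theta hw) where
  can := thetaDual hw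
  naturality f := hom_ext (BlockAux.swap_diag_transpose (ext₂ f.S) (ext₂ f.T))
    (BlockAux.swap_diag_transpose (ext₂ f.S) (ext₂ f.T))
  dagger_can β := hom_ext (BlockAux.transpose_swap_mul_diag (ext₂ β.S) (ext₂ β.T))
    (BlockAux.transpose_swap_mul_diag (ext₂ β.S) (ext₂ β.T))

/-- `θ` takes transposes to duals. -/
def thetaTransposeToDual : TransposeToDual (theta hw) where
  can := thetaTranspose hw
  naturality f := hom_ext (BlockAux.one_mul_diag_transpose (ext₂ f.S) (ext₂ f.T))
    (BlockAux.neg_one_mul_diag_transpose (ext₂ f.S) (ext₂ f.T))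
  dagger_can q := hom_ext (BlockAux.transpose_neg_one_mul_diag (ext₂ q.S) (ext₂ q.T))
    (BlockAux.transpose_one_mul_diag (ext₂ q.S) (ext₂ q.T))

end Theta

section Sign

variable {B : Type u} [CommRing B] {w w' : B} (hw : w' = -w)

/-- The sign change commutes with transposes. -/
def signTransposeCompat : TransposeCompat (sign hw) where
  can := signTranspose hw
  naturality f := hom_ext (BlockAux.one_mul_transpose f.S) (BlockAux.neg_one_mul_transpose f.T)
  dagger_can q := hom_ext (BlockAux.transpose_one_mul q.S) (BlockAux.transpose_neg_one_mul q.T)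

end Sign

/-! ### The two squares of θ on strict categories. -/

section Square

variable {A : Type u} [CommRing A]

/-- The square of the Faltings–Knörrer functor, on strict categories. -/
def thetaSq (p : A) : MF p ⥤ MF (knorrer (knorrer p)) :=
  theta (w := knorrer p) rfl ⋙ theta rfl

/-- The square of the Faltings–Knörrer functor with a sign change in between, on strict
categories. -/
def thetaSqSign (p : A) : MF p ⥤ MF (doubleKnorrer p) :=
  (theta (w := knorrer p) rfl ⋙ sign rfl) ⋙ theta (doubleKnorrer_eq p)

instance (p : A) : (thetaSq p).Additive := by unfold thetaSq; infer_instance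

instance (p : A) : (thetaSqSign p).Additive := by unfold thetaSqSign; infer_instance

/-- The square of the Faltings–Knörrer functor is compatible with duality. -/
def thetaSqDual (p : A) : DualCompat (thetaSq p) :=
  (thetaDualToTranspose rfl).compDual (thetaTransposeToDual rfl)

/-- The signed square of the Faltings–Knörrer functor is compatible with duality. -/
def thetaSqSignDual (p : A) : DualCompat (thetaSqSign p) :=
  ((thetaDualToTranspose rfl).comp (signTransposeCompat rfl)).compDual
    (thetaTransposeToDual (doubleKnorrer_eq p))

theorem thetaSq_homotopic (p : A) (M N : MF p) (f g : M ⟶ N) (h : Homotopic f g) :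
    Homotopic ((thetaSq p).map f) ((thetaSq p).map g) :=
  theta_homotopic rfl _ _ _ _ (theta_homotopic rfl _ _ _ _ h)

theorem thetaSqSign_homotopic (p : A) (M N : MF p) (f g : M ⟶ N) (h : Homotopic f g) :
    Homotopic ((thetaSqSign p).map f) ((thetaSqSign p).map g) :=
  theta_homotopic _ _ _ _ _ (sign_homotopic rfl _ _ _ _ (theta_homotopic rfl _ _ _ _ h))

end Square

end MF

/-! ### Identification of θθ and θνθ with lifts of strict functors. -/

section Square

variable {A : Type u} [CommRing A] {ε δ : ℤˣ}

theorem HMF.thetaSq_eq_lift (p : A) :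
    HMF.thetaSq p = HMF.lift (MF.thetaSq p) (MF.thetaSq_homotopic p) :=
  CategoryTheory.Quotient.lift_unique _ _ _ _ rfl

theorem HMF.thetaSqSign_eq_lift (p : A) :
    HMF.thetaSqSign p = HMF.lift (MF.thetaSqSign p) (MF.thetaSqSign_homotopic p) :=
  CategoryTheory.Quotient.lift_unique _ _ _ _ rfl

theorem FormMF.ext_b {B : Type u} [CommRing B] {w : B} {M : MF w} {b b' : M ≅ M.dual}
    {h : b.hom.T = -((ε : ℤ) • b.hom.S.transpose)}
    {h' : b'.hom.T = -((ε : ℤ) • b'.hom.S.transpose)} (e : b = b') :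
    (FormMF.mk M b h : FormMF ε w) = FormMF.mk M b' h' := by
  subst e; rfl

/-- The two functors to be compared have the same underlying factorizations, but their forms agree
only propositionally; hence heterogeneous equality on morphisms. -/
theorem FormHMF.heq_mk {B : Type u} [CommRing B] {w : B} {M N : MF w} {b b' : M ≅ M.dual}
    {c c' : N ≅ N.dual} {hb : b.hom.T = -((ε : ℤ) • b.hom.S.transpose)}
    {hb' : b'.hom.T = -((ε : ℤ) • b'.hom.S.transpose)}
    {hc : c.hom.T = -((ε : ℤ) • c.hom.S.transpose)}
    {hc' : c'.hom.T = -((ε : ℤ) • c'.hom.S.transpose)} (e : b = b') (e' : c = c') (f : M ⟶ N) :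
    (FormHMF.mk (X := FormMF.mk M b hb) (Y := FormMF.mk N c hc) f) ≍
      (FormHMF.mk (X := FormMF.mk M b' hb') (Y := FormMF.mk N c' hc') f) := by
  subst e e'; rfl

/-- Applying θ twice to a form is the same as applying the composite once and then the composite
comparison of duals; this makes the general results on lifts available. -/
theorem FormHMF.thetaSq_eq_lift (hδ : δ = -ε) (p : A) :
    FormHMF.thetaSq hδ p = FormHMF.lift (MF.thetaSq p) (MF.thetaSq_homotopic p)
      (MF.thetaSqDual p) hδ := by
  have key : ∀ X : FormMF ε p, (TwistedFormMF.theta (w := knorrer (knorrer p)) rfl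
      (FormMF.theta (w := knorrer p) hδ rfl X)).b =
      (MF.thetaSq p).mapIso X.b ≪≫ (MF.thetaSqDual p).can X.toMF := fun X =>
    MF.mapIso_trans_comp (F := MF.theta rfl) (G := MF.theta rfl) X.b (MF.thetaDual rfl X.toMF)
      (MF.thetaTranspose rfl (MF.thetaObj rfl X.toMF))
  refine CategoryTheory.Functor.hext (fun X => ?_) fun X Y f => ?_
  · exact FormMF.ext_b (key X)
  · obtain ⟨f, rfl⟩ := FormHMF.exists_mk f
    exact FormHMF.heq_mk (key X) (key Y) ((MF.thetaSq p).map f)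

theorem FormHMF.thetaSqSign_eq_lift (hδ : δ = -ε) (p : A) :
    FormHMF.thetaSqSign hδ p = FormHMF.lift (MF.thetaSqSign p) (MF.thetaSqSign_homotopic p)
      (MF.thetaSqSignDual p) hδ := by
  have key : ∀ X : FormMF ε p, (TwistedFormMF.theta (doubleKnorrer_eq p)
      (TwistedFormMF.sign rfl (FormMF.theta (w := knorrer p) hδ rfl X))).b =
      (MF.thetaSqSign p).mapIso X.b ≪≫ (MF.thetaSqSignDual p).can X.toMF := fun X =>
    MF.mapIso_trans_comp_comp (F := MF.theta rfl) (G := MF.sign rfl)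
      (H := MF.theta (doubleKnorrer_eq p)) X.b (MF.thetaDual rfl X.toMF)
      (MF.signTranspose rfl (MF.thetaObj rfl X.toMF))
      (MF.thetaTranspose (doubleKnorrer_eq p) (MF.signObj rfl (MF.thetaObj rfl X.toMF)))
  refine CategoryTheory.Functor.hext (fun X => ?_) fun X Y f => ?_
  · exact FormMF.ext_b (key X)
  · obtain ⟨f, rfl⟩ := FormHMF.exists_mk f
    exact FormHMF.heq_mk (key X) (key Y) ((MF.thetaSqSign p).map f)

theorem FormHMF.thetaSq_isFormEquivalence [IsLocalRing A] {c : A} (hc : c + c = 1)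
    (hδ : δ = -ε) (p : A) [IsIdempotentComplete (HMF p)] :
    IsFormEquivalence (FormHMF.thetaSq hδ p) := by
  rw [FormHMF.thetaSq_eq_lift]
  refine FormHMF.isFormEquivalence_lift _ _ _ _ hc ?_
  rw [← HMF.thetaSq_eq_lift]
  exact HMF.thetaSq_isTriangleEquivalence p

theorem FormHMF.thetaSqSign_isFormEquivalence [IsLocalRing A] {c : A} (hc : c + c = 1)
    (hδ : δ = -ε) (p : A) [IsIdempotentComplete (HMF p)] :
    IsFormEquivalence (FormHMF.thetaSqSign hδ p) := by
  rw [FormHMF.thetaSqSign_eq_lift]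
  refine FormHMF.isFormEquivalence_lift _ _ _ _ hc ?_
  rw [← HMF.thetaSqSign_eq_lift]
  exact HMF.thetaSqSign_isTriangleEquivalence p

end Square

end

theorem mainTheorem2 {k : Type v} {A : Type u} [Field k] [IsAlgClosed k] [CharZero k]
    [CommRing A] [IsLocalRing A] [IsNoetherianRing A]
    [IsAdicComplete (IsLocalRing.maximalIdeal A) A] [Algebra k A]
    (hk : Function.Bijective (algebraMap k (IsLocalRing.ResidueField A)))
    (p : A) (hp : p ∈ IsLocalRing.maximalIdeal A) (ε δ : ℤˣ) (hδ : δ = -ε) :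
    -- `θθ : MF(p) ⥤ MF(uv - xy + p)` and `θθ : MF^±(p) ⥤ MF^∓(uv - xy + p)`
    IsTriangleEquivalence (HMF.distTriangles p) (HMF.distTriangles (knorrer (knorrer p)))
      (HMF.thetaSq p) ∧
    IsFormEquivalence (FormHMF.thetaSq hδ p) ∧
    -- the same with target `MF(xy + uv - p)`, `MF^∓(xy + uv - p)`
    IsTriangleEquivalence (HMF.distTriangles p) (HMF.distTriangles (doubleKnorrer p))
      (HMF.thetaSqSign p) ∧
    IsFormEquivalence (FormHMF.thetaSqSign hδ p) ∧
    -- period four: `θθθθ : MF^±(p) ⥤ MF^±`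
    IsFormEquivalence (FormHMF.thetaSq hδ p ⋙
      FormHMF.thetaSq (neg_eq_iff_eq_neg.1 hδ.symm) (knorrer (knorrer p))) := by
  have hc : algebraMap k A 2⁻¹ + algebraMap k A 2⁻¹ = 1 := by
    rw [← map_add, ← two_mul, mul_inv_cancel₀ two_ne_zero, map_one]
  -- For the second pair of applications one needs 1/2 over A[[x, y]][[u, v]]; it is the constant
  -- series.
  have hc' : (MvPowerSeries.C (MvPowerSeries.C (algebraMap k A 2⁻¹)) : PS₂ (PS₂ A)) +
      MvPowerSeries.C (MvPowerSeries.C (algebraMap k A 2⁻¹)) = 1 := by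
    rw [← map_add, ← map_add, hc, map_one, map_one]
  have h := HMF.thetaSq_isTriangleEquivalence p
  have := h.1
  -- Idempotent completeness for the intermediate potential comes from the first equivalence, not
  -- from completeness of the power series ring.
  have := (HMF.thetaSq p).isIdempotentComplete_of_isEquivalence
  exact ⟨h, FormHMF.thetaSq_isFormEquivalence hc hδ p, HMF.thetaSqSign_isTriangleEquivalence p,
    FormHMF.thetaSqSign_isFormEquivalence hc hδ p,
    (FormHMF.thetaSq_isFormEquivalence hc hδ p).comp
      (FormHMF.thetaSq_isFormEquivalence hc' _ _)⟩
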